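/- **Corollary 2.4.** Let $0\le m\le n$ and let $\mathcal K^n$ be the set of nonempty compact convex subsets of $\mathbb R^n$ with the Hausdorff distance. *Definitions.* Let $\|\cdot\|$ be a norm on $\mathbb R^n$ and $E=(\mathbb R^n,\|\cdot\|)$. For a linear subspace $F\subseteq\mathbb R^n$ with the Euclidean structure induced from $\mathbb R^n$, put $B_F=\{x\in F:\|x\|\le1\}$ and $B_F^\circ=\{y\in F:\langle x,y\rangle\le1\text{ for all }x\in B_F\}$; the Holmes–Thompson volume of $A\subseteq F$ is $\mathrm{vol}_{HT}^F(A)=\mathrm{vol}_{2\dim F}(A\times B_F^\circ)$. If $F$ is an affine subspace with parallel linear subspace $F_0$ and $A\subseteq F$, then $\mathrm{vol}_{HT}^F(A)=\mathrm{vol}_{HT}^{F_0}(A-p)$ for any $p\in F$. A function $\mu:\mathcal K^n\to\mathbb R$ is a valuation if $\mu(K\cup L)=\mu(K)+\mu(L)-\mu(K\cap L)$ whenever $K,L,K\cup L\in\mathcal K^n$. The Holmes–Thompson intrinsic volumes of $E$ are $\mu_0^E=1$ and, for $m\ge1$, the even, continuous, $m$-homogeneous, translation-invariant valuation $\mu_m^E$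 on $\mathcal K^n$ such that $\mu_m^E(K)=\mathrm{vol}_{HT}^F(K)$ for every $m$-dimensional $K\in\mathcal K^n$ with affine hull $F$. A generating measure of $E$ is a finite even (nonnegative) Borel measure $\rho$ on the Euclidean unit sphere $S^{n-1}$ with $\|x\|=\int|\langle x,y\rangle|\,d\rho(y)$ for all $x\in\mathbb R^n$. Let $\ell_1^n=(\mathbb R^n,\|\cdot\|_1)$, $\|x\|_1=\sum_i|x_i|$, and let $$V_m'(K)=\sum_P\mathrm{vol}_m(K|P),$$ where $P$ runs over the $m$-dimensional coordinate subspaces of $\mathbb R^n$ and $K|P$ is the orthogonal projection of $K$ onto $P$. *Statement.* (1) The Holmes–Thompson intrinsic volume $\mu_m^{\ell_1^n}$ exists, is unique, and satisfies $$\mu_m^{\ell_1^n}(K)=2^mV_m'(K)\qquad\text{for all }K\in\mathcal K^n.$$ (2) The constant in the Schneider–Wieacker formula is $c_m=2^m/m!$. That is, for $c\in\mathbb R$ the following two assertions are equivalent: (a) for every normed space $E=(\mathbb R^n,\|\cdot\|)$ with a generating measure $\rho$, the Holmes–Thompson intrinsic volume $\mu_m^E$ exists, is unique, and satisfies $$\mu_m^E(K)=c\int_{(S^{n-1})^m}\mathrm{vol}_m(AK)\,d\rho(x_1)\cdots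 d\rho(x_m)\qquad\text{for all }K\in\mathcal K^n,$$ where $A$ is the $m\times n$ matrix with rows $x_1,\dots,x_m$; (b) $c=2^m/m!$. -/

import Mathlib

open MeasureTheory
open scoped Pointwise

noncomputable section

/-- The polar, inside the linear subspace `F` of Euclidean space, of the unit ball
`{x ∈ F | N x ≤ 1}` of the norm `N` restricted to `F`. -/
def polarUnitBall {n : ℕ} (N : Seminorm ℝ (EuclideanSpace ℝ (Fin n)))
    (F : Submodule ℝ (EuclideanSpace ℝ (Fin n))) : Set F :=
  {y : F | ∀ x : F, N (x : EuclideanSpace ℝ (Fin n)) ≤ 1 → inner ℝ x y ≤ 1}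

/-- Holmes--Thompson volume of a subset `A` of a linear subspace `F` of `(ℝⁿ, N)`: the
`2 dim F`-dimensional Lebesgue measure of `A × B°`, where `B` is the unit ball of `F`
and `F` carries the Euclidean structure induced from `ℝⁿ`. -/
def htVolume {n : ℕ} (N : Seminorm ℝ (EuclideanSpace ℝ (Fin n)))
    (F : Submodule ℝ (EuclideanSpace ℝ (Fin n))) (A : Set F) : ℝ :=
  (((volume : Measure F).prod (volume : Measure F)) (A ×ˢ polarUnitBall N F)).toReal

/-- Convex valuations on `ℝⁿ` (functions on nonempty compact convex sets). -/
def IsConvexValuation {n : ℕ} (μ : ConvexBody (EuclideanSpace ℝ (Fin n)) → ℝ) : Prop :=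
  ∀ K L U I : ConvexBody (EuclideanSpace ℝ (Fin n)),
    (U : Set (EuclideanSpace ℝ (Fin n))) = ↑K ∪ ↑L →
    (I : Set (EuclideanSpace ℝ (Fin n))) = ↑K ∩ ↑L →
    μ U = μ K + μ L - μ I

/-- An even, continuous (for the Hausdorff distance), `m`-homogeneous,
translation-invariant convex valuation that agrees with the Holmes--Thompson volume of the
affine hull on all `m`-dimensional convex bodies. The last field translates a body `K` with
affine hull `F` by `-p`, for `p ∈ F`, so that it lies in the linear subspace parallel to `F`. -/
structure IsHTValuation {n : ℕ} (N : Seminorm ℝ (EuclideanSpace ℝ (Fin n))) (m : ℕ)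
    (μ : ConvexBody (EuclideanSpace ℝ (Fin n)) → ℝ) : Prop where
  valuation : IsConvexValuation μ
  continuous : Continuous μ
  even : ∀ K L : ConvexBody (EuclideanSpace ℝ (Fin n)),
    (L : Set (EuclideanSpace ℝ (Fin n))) = -(K : Set (EuclideanSpace ℝ (Fin n))) → μ L = μ K
  homogeneous : ∀ t : ℝ, 0 < t → ∀ K : ConvexBody (EuclideanSpace ℝ (Fin n)),
    μ (t • K) = t ^ m * μ K
  translation_invariant : ∀ (v : EuclideanSpace ℝ (Fin n))
    (K L : ConvexBody (EuclideanSpace ℝ (Fin n))),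
    (L : Set (EuclideanSpace ℝ (Fin n))) = v +ᵥ (K : Set (EuclideanSpace ℝ (Fin n))) → μ L = μ K
  eq_htVolume : ∀ K : ConvexBody (EuclideanSpace ℝ (Fin n)),
    Module.finrank ℝ (affineSpan ℝ (K : Set (EuclideanSpace ℝ (Fin n)))).direction = m →
    ∀ p ∈ affineSpan ℝ (K : Set (EuclideanSpace ℝ (Fin n))),
      μ K = htVolume N (affineSpan ℝ (K : Set (EuclideanSpace ℝ (Fin n)))).direction
        {v | p + (v : EuclideanSpace ℝ (Fin n)) ∈ K}

/-- `μ` is the `m`-th Holmes--Thompson intrinsic volume of `(ℝⁿ, N)`: the constant `1` for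
`m = 0`, and the valuation characterized above for `m ≥ 1`. -/
def IsHTIntrinsicVolume {n : ℕ} (N : Seminorm ℝ (EuclideanSpace ℝ (Fin n))) (m : ℕ)
    (μ : ConvexBody (EuclideanSpace ℝ (Fin n)) → ℝ) : Prop :=
  (m = 0 → ∀ K, μ K = 1) ∧ (1 ≤ m → IsHTValuation N m μ)

/-- The `ℓ₁` norm on `ℝⁿ`. -/
def l1Norm (n : ℕ) : Seminorm ℝ (EuclideanSpace ℝ (Fin n)) :=
  Seminorm.of (fun x => ∑ i, |x i|)
    (fun x y => by
      rw [← Finset.sum_add_distrib]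
      exact Finset.sum_le_sum fun i _ => abs_add_le (x i) (y i))
    (fun a x => by simp [abs_mul, Finset.mul_sum])

/-- The coordinate subspace of `ℝⁿ` spanned by the standard basis vectors `e_i`, `i ∈ I`. -/
def coordSubspace {n : ℕ} (I : Finset (Fin n)) : Submodule ℝ (EuclideanSpace ℝ (Fin n)) :=
  Submodule.span ℝ ((fun i => EuclideanSpace.single i (1 : ℝ)) '' (I : Set (Fin n)))

/-- Leinster's `ℓ₁` intrinsic volume: the sum, over the `m`-dimensional coordinate subspaces
`P`, of the `m`-dimensional volume of the orthogonal projection of `K` onto `P`. -/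
def l1IntrinsicVolume {n : ℕ} (m : ℕ) (K : ConvexBody (EuclideanSpace ℝ (Fin n))) : ℝ :=
  ∑ I ∈ Finset.powersetCard m (Finset.univ : Finset (Fin n)),
    ((volume : Measure (coordSubspace I))
      ((coordSubspace I).orthogonalProjectionOnto '' (K : Set (EuclideanSpace ℝ (Fin n))))).toReal

/-- `ρ` is a generating measure of the norm `N`: a finite even measure on the unit sphere with
`N x = ∫ |⟨x, y⟩| dρ(y)`. A norm that has one is hypermetric. -/
structure IsGeneratingMeasure {n : ℕ} (N : Seminorm ℝ (EuclideanSpace ℝ (Fin n)))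
    (ρ : Measure (Metric.sphere (0 : EuclideanSpace ℝ (Fin n)) 1)) : Prop where
  finite : IsFiniteMeasure ρ
  even : ρ.map (fun y => -y) = ρ
  norm_eq : ∀ x, N x = ∫ y, |inner ℝ x (y : EuclideanSpace ℝ (Fin n))| ∂ρ

/-- The linear map `ℝⁿ → ℝᵐ` given by the matrix whose rows are `y 0, …, y (m - 1)`. -/
def rowMap {n m : ℕ} (y : Fin m → Metric.sphere (0 : EuclideanSpace ℝ (Fin n)) 1)
    (x : EuclideanSpace ℝ (Fin n)) : EuclideanSpace ℝ (Fin m) :=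
  WithLp.toLp 2 (fun i => inner ℝ (y i : EuclideanSpace ℝ (Fin n)) x)

/-- The integral `∫ vol_m (A K) dρ(x₁) ⋯ dρ(x_m)`, where `A` has rows `x₁, …, x_m`. -/
def rowIntegral {n : ℕ} (m : ℕ) (ρ : Measure (Metric.sphere (0 : EuclideanSpace ℝ (Fin n)) 1))
    (K : ConvexBody (EuclideanSpace ℝ (Fin n))) : ℝ :=
  ∫ y : Fin m → Metric.sphere (0 : EuclideanSpace ℝ (Fin n)) 1,
    ((volume : Measure (EuclideanSpace ℝ (Fin m)))
      (rowMap y '' (K : Set (EuclideanSpace ℝ (Fin n))))).toReal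
    ∂(Measure.pi fun _ => ρ)

/-- The Schneider--Wieacker formula in `ℝⁿ` with constant `c`: for every norm with a generating
measure `ρ`, the `m`-th Holmes--Thompson intrinsic volume exists, is unique, and is
`K ↦ c ∫ vol_m (A K) dρ(x₁) ⋯ dρ(x_m)`. -/
def SchneiderWieackerFormula (n m : ℕ) (c : ℝ) : Prop :=
  ∀ (N : Seminorm ℝ (EuclideanSpace ℝ (Fin n)))
    (ρ : Measure (Metric.sphere (0 : EuclideanSpace ℝ (Fin n)) 1)),
    (∀ x, N x = 0 → x = 0) → IsGeneratingMeasure N ρ →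
    ∀ μ : ConvexBody (EuclideanSpace ℝ (Fin n)) → ℝ,
      IsHTIntrinsicVolume N m μ ↔ ∀ K, μ K = c * rowIntegral m ρ K

end

/-! Existence. Let μ(K) be 2^m/m! times the mean of vol_m(AK) over the rows of A (`meanVol`). Volume
of a linear image is a continuous, even, translation-invariant valuation of degree m, and averaging
keeps this. Suppose K lies in a translate of an m-dimensional subspace F. Only the projections of
the rows to F matter, and vol_m(AK) is vol(K) times the absolute determinant of these projections
(`vol_map_rows`, `meanVol_map_add_pt`). On the other side, the norm restricted to F is the support
function of the polar ball, which is therefore the zonoid generated by the projected measure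
(`polarUnitBall_eq_zonoid`). The volume of a zonoid is 2^m/m! times the mean of the absolute
determinant (`vol_zonoid`), so μ(K) is the Holmes–Thompson volume. This is the source of the
constant.

Uniqueness is Klain's theorem (`IsEvenValuation.eq_zero`): an even valuation of degree m that
vanishes on m-dimensional bodies is zero. By induction on the dimension it vanishes on bodies in
hyperplanes, that is, it is simple, and it remains to kill simple even valuations of degree below
the dimension (`IsSimpleValuation.eq_zero`). On prisms such a valuation induces one of lower degree
in lower dimension, so it vanishes there. Hence adding a segment to a body does not change its
value. The bodies whose addition changes nothing form a closed class, stable under sums and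
cancellation, so it contains all centrally symmetric bodies (`mem_of_symmetric`), and the valuation
vanishes on them. A parallelepiped is a simplex, a reflected copy of it and a symmetric middle slab;
evenness then gives zero on simplices, dissection gives zero on polytopes, and continuity on all
bodies.

The density of differences of zonotopes among symmetric bodies is obtained without spherical
harmonics. A Gaussian average of the support function is again a support function, and completing
the square expresses it through the functions exp(⟪w, x⟫²/2), each of which is an explicit cosine
transform (`integral_abs_inner_mul_cosineKernel`).

For ℓ₁ the generating measure may be replaced by counting measure on the standard basis. The mean
becomes a sum over index tuples, where repeated indices contribute zero and every m-subset occurs m!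
times, which cancels the factorial. Finally c is determined because the ℓ₁ intrinsic volume of the
unit ball is positive. -/

set_option linter.unusedSectionVars false

/-! ### Support functions and the Hausdorff metric -/

namespace ConvexBody

variable {V W : Type*} [NormedAddCommGroup V] [InnerProductSpace ℝ V] [FiniteDimensional ℝ V]
  [NormedAddCommGroup W] [InnerProductSpace ℝ W] [FiniteDimensional ℝ W]

/-- The support function of a convex body. -/
noncomputable def supp (K : ConvexBody V) (x : V) : ℝ :=
  sSup ((fun y => inner ℝ x y) '' (K : Set V))

theorem isCompact_inner_image (K : ConvexBody V) (x : V) :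
    IsCompact ((fun y => inner ℝ x y) '' (K : Set V)) :=
  K.isCompact.image (by fun_prop)

theorem inner_le_supp {K : ConvexBody V} {y : V} (hy : y ∈ K) (x : V) :
    inner ℝ x y ≤ K.supp x :=
  le_csSup (K.isCompact_inner_image x).bddAbove ⟨y, hy, rfl⟩

theorem exists_inner_eq_supp (K : ConvexBody V) (x : V) : ∃ y ∈ K, inner ℝ x y = K.supp x :=
  (K.isCompact_inner_image x).sSup_mem (K.nonempty.image _)

theorem supp_le_iff {K : ConvexBody V} {x : V} {c : ℝ} :
    K.supp x ≤ c ↔ ∀ y ∈ K, inner ℝ x y ≤ c := by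
  constructor
  · exact fun h y hy => (inner_le_supp hy x).trans h
  · intro h
    obtain ⟨y, hy, e⟩ := K.exists_inner_eq_supp x
    exact e ▸ h y hy

theorem supp_eq_of {K : ConvexBody V} {x : V} {c : ℝ} {y : V} (hy : y ∈ K) (h : inner ℝ x y = c)
    (hle : ∀ z ∈ K, inner ℝ x z ≤ c) : K.supp x = c :=
  le_antisymm (supp_le_iff.2 hle) (h ▸ inner_le_supp hy x)

/-- Separation of a point from a closed convex set by a vector. -/
theorem exists_inner_lt_of_notMem {C : Set V} (hc : Convex ℝ C) (hcl : IsClosed C) {y : V}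
    (hy : y ∉ C) : ∃ x : V, ∃ c : ℝ, (∀ z ∈ C, inner ℝ x z < c) ∧ c < inner ℝ x y := by
  obtain ⟨f, c, h1, h2⟩ := geometric_hahn_banach_closed_point hc hcl hy
  refine ⟨(InnerProductSpace.toDual ℝ V).symm f, c, fun z hz => ?_, ?_⟩
  · simpa using h1 z hz
  · simpa using h2

theorem mem_iff_inner_le_supp {K : ConvexBody V} {y : V} :
    y ∈ K ↔ ∀ x, inner ℝ x y ≤ K.supp x := by
  constructor
  · exact fun h x => inner_le_supp h x
  · intro h
    by_contra hy
    obtain ⟨x, c, h1, h2⟩ := exists_inner_lt_of_notMem K.convex K.isClosed hy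
    exact absurd (h x) (not_le.2 ((supp_le_iff.2 fun z hz => (h1 z hz).le).trans_lt h2))

theorem le_iff_supp_le {K L : ConvexBody V} : K ≤ L ↔ ∀ x, K.supp x ≤ L.supp x := by
  constructor
  · exact fun h x => supp_le_iff.2 fun y hy => inner_le_supp (h hy) x
  · exact fun h y hy => mem_iff_inner_le_supp.2 fun x => (inner_le_supp hy x).trans (h x)

theorem ext_supp {K L : ConvexBody V} (h : ∀ x, K.supp x = L.supp x) : K = L :=
  le_antisymm (le_iff_supp_le.2 fun x => (h x).le) (le_iff_supp_le.2 fun x => (h x).ge)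

theorem supp_add (K L : ConvexBody V) (x : V) : (K + L).supp x = K.supp x + L.supp x := by
  obtain ⟨y, hy, e⟩ := K.exists_inner_eq_supp x
  obtain ⟨z, hz, e'⟩ := L.exists_inner_eq_supp x
  refine supp_eq_of (y := y + z) (Set.add_mem_add hy hz) (by rw [inner_add_right, e, e']) ?_
  rintro w ⟨a, ha, b, hb, rfl⟩
  simp only [inner_add_right]
  exact add_le_add (inner_le_supp ha x) (inner_le_supp hb x)

theorem mem_smul {t : ℝ} {K : ConvexBody V} {x : V} : x ∈ t • K ↔ ∃ y ∈ K, t • y = x :=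
  Set.mem_smul_set

theorem mem_add {K L : ConvexBody V} {x : V} : x ∈ K + L ↔ ∃ y ∈ K, ∃ z ∈ L, y + z = x :=
  Set.mem_add

theorem supp_smul {t : ℝ} (ht : 0 ≤ t) (K : ConvexBody V) (x : V) :
    (t • K).supp x = t * K.supp x := by
  obtain ⟨y, hy, e⟩ := K.exists_inner_eq_supp x
  refine supp_eq_of (y := t • y) (mem_smul.2 ⟨y, hy, rfl⟩) (by rw [inner_smul_right, e]) ?_
  intro w hw
  obtain ⟨a, ha, rfl⟩ := mem_smul.1 hw
  rw [inner_smul_right]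
  exact mul_le_mul_of_nonneg_left (inner_le_supp ha x) ht

theorem supp_add_arg_le (K : ConvexBody V) (x y : V) : K.supp (x + y) ≤ K.supp x + K.supp y :=
  supp_le_iff.2 fun z hz => by
    rw [inner_add_left]; exact add_le_add (inner_le_supp hz x) (inner_le_supp hz y)

theorem supp_smul_arg {t : ℝ} (ht : 0 ≤ t) (K : ConvexBody V) (x : V) :
    K.supp (t • x) = t * K.supp x := by
  obtain ⟨y, hy, e⟩ := K.exists_inner_eq_supp x
  refine supp_eq_of hy (by rw [inner_smul_left, e]; simp) fun z hz => ?_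
  rw [inner_smul_left]
  exact mul_le_mul_of_nonneg_left (inner_le_supp hz x) ht

theorem supp_zero_arg (K : ConvexBody V) : K.supp 0 = 0 := by
  simpa using K.supp_smul_arg le_rfl 0

theorem exists_norm_le (K : ConvexBody V) : ∃ R, 0 < R ∧ ∀ y ∈ K, ‖y‖ ≤ R :=
  K.isBounded.exists_pos_norm_le

theorem abs_supp_le {K : ConvexBody V} {R : ℝ} (hR : ∀ y ∈ K, ‖y‖ ≤ R) (x : V) :
    |K.supp x| ≤ R * ‖x‖ := by
  obtain ⟨y, hy, e⟩ := K.exists_inner_eq_supp x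
  rw [← e, mul_comm]
  exact (abs_real_inner_le_norm x y).trans (by gcongr; exact hR y hy)

theorem abs_supp_sub_le {K : ConvexBody V} {R : ℝ} (hR : ∀ y ∈ K, ‖y‖ ≤ R) (x y : V) :
    |K.supp x - K.supp y| ≤ R * ‖x - y‖ := by
  have key : ∀ a b : V, K.supp a - K.supp b ≤ R * ‖a - b‖ := fun a b => by
    have := K.supp_add_arg_le (a - b) b
    rw [sub_add_cancel] at this
    linarith [(abs_le.1 (abs_supp_le hR (a - b))).2]
  refine abs_sub_le_iff.2 ⟨key x y, ?_⟩
  rw [norm_sub_rev]; exact key y x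

theorem continuous_supp (K : ConvexBody V) : Continuous K.supp := by
  obtain ⟨R, hR0, hR⟩ := K.exists_norm_le
  refine (LipschitzWith.of_dist_le_mul (K := ⟨R, hR0.le⟩) fun x y => ?_).continuous
  rw [Real.dist_eq, dist_eq_norm]
  exact abs_supp_sub_le hR x y

/-- The convex body with a given finite sublinear support function. -/
theorem exists_supp_eq (p : V → ℝ) (hsm : ∀ c : ℝ, 0 < c → ∀ x, p (c • x) = c * p x)
    (hadd : ∀ x y, p (x + y) ≤ p x + p y) {R : ℝ} (hR : ∀ x, p x ≤ R * ‖x‖) :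
    ∃ K : ConvexBody V, (∀ x, K.supp x = p x) ∧ (K : Set V) = {y | ∀ x, inner ℝ x y ≤ p x} := by
  have hp0 : p 0 = 0 := by
    have := hsm 2 two_pos 0
    rw [smul_zero] at this; linarith
  -- Hahn–Banach: the functional c x ↦ c p(x) on the line of x is dominated by p, for negative c
  -- because p(x) + p(-x) ≥ 0. A dominated extension is a point of the body that touches the
  -- supporting hyperplane with normal x.
  have att : ∀ x, ∃ y, (∀ z, inner ℝ z y ≤ p z) ∧ inner ℝ x y = p x := by
    intro x
    have hneg : - p (-x) ≤ p x := by
      have := hadd x (-x); rw [add_neg_cancel, hp0] at this; linarith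
    by_cases hx : x = 0
    · obtain ⟨g, -, hg⟩ := exists_extension_of_le_sublinear (⟨⊥, 0⟩ : V →ₗ.[ℝ] ℝ) p hsm hadd (by
        rintro ⟨y, hy⟩
        have : y = 0 := by simpa using hy
        subst this
        simp [hp0])
      refine ⟨(InnerProductSpace.toDual ℝ V).symm (LinearMap.toContinuousLinearMap g), ?_, ?_⟩
      · intro z; rw [real_inner_comm]; simpa using hg z
      · subst hx; simp [hp0]
    · obtain ⟨g, hg0, hg⟩ := exists_extension_of_le_sublinear
        (LinearPMap.mkSpanSingleton x (p x) hx) p hsm hadd (by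
        rintro ⟨y, hy⟩
        obtain ⟨c, rfl⟩ := Submodule.mem_span_singleton.1 hy
        have e : LinearPMap.mkSpanSingleton x (p x) hx ⟨c • x, hy⟩ = c * p x :=
          LinearPMap.mkSpanSingleton'_apply _ _ _ _ _
        rw [e]
        change c * p x ≤ p (c • x)
        rcases lt_trichotomy c 0 with h | h | h
        · have := hsm (-c) (neg_pos.2 h) (-x)
          rw [smul_neg, neg_smul, neg_neg] at this
          rw [this]
          nlinarith
        · simp [h, hp0]
        · rw [hsm c h])
      refine ⟨(InnerProductSpace.toDual ℝ V).symm (LinearMap.toContinuousLinearMap g), ?_, ?_⟩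
      · intro z; rw [real_inner_comm]; simpa using hg z
      · rw [real_inner_comm]
        have := hg0 ⟨x, Submodule.mem_span_singleton_self x⟩
        simp only [InnerProductSpace.toDual_symm_apply, LinearMap.coe_toContinuousLinearMap']
        exact this.trans (LinearPMap.mkSpanSingleton_apply ℝ ℝ (σ := RingHom.id ℝ) hx (p x))
  have hset : {y : V | ∀ x, inner ℝ x y ≤ p x} = ⋂ x, {y : V | inner ℝ x y ≤ p x} := by
    ext; simp
  let K : ConvexBody V :=
    { carrier := {y | ∀ x, inner ℝ x y ≤ p x}
      convex' := by
        rw [hset]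
        exact convex_iInter fun x => convex_halfSpace_le (f := fun y => inner ℝ x y)
          ⟨fun a b => inner_add_right x a b, fun c a => by simp [inner_smul_right]⟩ _
      isCompact' := by
        refine Metric.isCompact_of_isClosed_isBounded ?_ ?_
        · rw [hset]
          exact isClosed_iInter fun x => isClosed_le (by fun_prop) continuous_const
        · refine (Metric.isBounded_closedBall (x := (0 : V)) (r := max R 0)).subset fun y hy => ?_
          rw [mem_closedBall_zero_iff]
          by_cases h0 : y = 0
          · simp [h0]
          · have h1 := (hy y).trans (hR y)
            rw [real_inner_self_eq_norm_sq, sq] at h1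
            exact (le_of_mul_le_mul_right h1 (norm_pos_iff.2 h0)).trans (le_max_left _ _)
      nonempty' := by
        obtain ⟨y, hy, -⟩ := att 0
        exact ⟨y, hy⟩ }
  refine ⟨K, fun x => ?_, rfl⟩
  obtain ⟨y, hy, e⟩ := att x
  exact supp_eq_of (K := K) hy e fun z hz => hz x

/-- The segment joining two points, as a convex body. -/
def seg (a b : V) : ConvexBody V where
  carrier := segment ℝ a b
  convex' := convex_segment a b
  isCompact' := by
    rw [← convexHull_pair]; exact (Set.toFinite _).isCompact_convexHull ℝ
  nonempty' := ⟨a, left_mem_segment ℝ a b⟩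

theorem mem_seg_zero {v x : V} : x ∈ seg 0 v ↔ ∃ t : ℝ, 0 ≤ t ∧ t ≤ 1 ∧ t • v = x := by
  change x ∈ segment ℝ 0 v ↔ _
  rw [segment_eq_image']
  simp [and_assoc]

theorem supp_seg (a b x : V) : (seg a b).supp x = max (inner ℝ x a) (inner ℝ x b) := by
  have h : ∀ z ∈ seg a b, inner ℝ x z ≤ max (inner ℝ x a) (inner ℝ x b) := by
    rintro z ⟨s, t, hs, ht, hst, rfl⟩
    rw [inner_add_right, inner_smul_right, inner_smul_right]
    calc s * inner ℝ x a + t * inner ℝ x b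
        ≤ s * max (inner ℝ x a) (inner ℝ x b) + t * max (inner ℝ x a) (inner ℝ x b) := by
          gcongr
          · exact le_max_left _ _
          · exact le_max_right _ _
      _ = _ := by rw [← add_mul, hst, one_mul]
  refine le_antisymm (supp_le_iff.2 h) (max_le ?_ ?_)
  · exact inner_le_supp (left_mem_segment ℝ a b) x
  · exact inner_le_supp (right_mem_segment ℝ a b) x

theorem supp_seg_neg (v x : V) : (seg (-v) v).supp x = |inner ℝ x v| := by
  rw [supp_seg, inner_neg_right, max_comm, abs]

/-- A one-point convex body. -/
def pt (a : V) : ConvexBody V := seg a a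

theorem coe_pt (a : V) : (pt a : Set V) = {a} := segment_same ℝ a

theorem mem_pt {a x : V} : x ∈ pt a ↔ x = a := by
  rw [← SetLike.mem_coe, coe_pt, Set.mem_singleton_iff]

theorem supp_pt (a x : V) : (pt a).supp x = inner ℝ x a := by
  rw [pt, supp_seg, max_self]

theorem pt_zero : pt (0 : V) = 0 := ConvexBody.ext (by rw [coe_pt, coe_zero]; rfl)

theorem mem_add_pt {K : ConvexBody V} {a x : V} : x ∈ K + pt a ↔ x - a ∈ K := by
  rw [mem_add]
  constructor
  · rintro ⟨y, hy, z, hz, rfl⟩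
    rw [mem_pt.1 hz, add_sub_cancel_right]; exact hy
  · exact fun h => ⟨_, h, a, mem_pt.2 rfl, sub_add_cancel x a⟩

theorem coe_add_pt (K : ConvexBody V) (a : V) :
    ((K + pt a : ConvexBody V) : Set V) = a +ᵥ (K : Set V) := by
  ext x
  rw [SetLike.mem_coe, mem_add_pt, Set.mem_vadd_set_iff_neg_vadd_mem, vadd_eq_add,
    neg_add_eq_sub]
  rfl

theorem pt_add (a b : V) : pt (a + b) = pt a + pt b :=
  ext_supp fun x => by simp only [supp_add, supp_pt, inner_add_right]

theorem add_pt_neg_add_pt (K : ConvexBody V) (a : V) : K + pt (-a) + pt a = K := by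
  rw [add_assoc, ← pt_add, neg_add_cancel, pt_zero, add_zero]

theorem supp_zero (x : V) : (0 : ConvexBody V).supp x = 0 := by
  rw [← pt_zero, supp_pt, inner_zero_right]

theorem mem_zero {x : V} : x ∈ (0 : ConvexBody V) ↔ x = 0 := by
  rw [← pt_zero, mem_pt]

theorem seg_eq_add_pt (a b : V) : seg a b = seg 0 (b - a) + pt a :=
  ext_supp fun x => by
    rw [supp_add, supp_seg, supp_seg, supp_pt, inner_zero_right, inner_sub_right,
      ← max_add_add_right, zero_add, sub_add_cancel]

theorem smul_seg (t : ℝ) (a b : V) : t • seg a b = seg (t • a) (t • b) :=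
  ConvexBody.ext (by
    rw [coe_smul]
    exact image_segment ℝ (LinearMap.lsmul ℝ V t).toAffineMap a b)

/-- The image of a convex body under a linear map. -/
def map (f : V →ₗ[ℝ] W) (K : ConvexBody V) : ConvexBody W where
  carrier := f '' K
  convex' := K.convex.linear_image f
  isCompact' := K.isCompact.image f.continuous_of_finiteDimensional
  nonempty' := K.nonempty.image f

theorem coe_map (f : V →ₗ[ℝ] W) (K : ConvexBody V) : (map f K : Set W) = f '' K := rfl

theorem mem_map {f : V →ₗ[ℝ] W} {K : ConvexBody V} {y : W} : y ∈ map f K ↔ ∃ x ∈ K, f x = y :=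
  Iff.rfl

theorem supp_map (f : V →ₗ[ℝ] W) (K : ConvexBody V) (x : W) :
    (map f K).supp x = K.supp (f.adjoint x) := by
  obtain ⟨y, hy, e⟩ := K.exists_inner_eq_supp (f.adjoint x)
  refine supp_eq_of (y := f y) ⟨y, hy, rfl⟩ (by rw [← e, LinearMap.adjoint_inner_left]) ?_
  rintro _ ⟨z, hz, rfl⟩
  rw [← LinearMap.adjoint_inner_left]
  exact inner_le_supp hz _

theorem map_add (f : V →ₗ[ℝ] W) (K L : ConvexBody V) : map f (K + L) = map f K + map f L :=
  ext_supp fun x => by simp only [supp_map, supp_add]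

theorem map_pt (f : V →ₗ[ℝ] W) (a : V) : map f (pt a) = pt (f a) :=
  ext_supp fun x => by simp only [supp_map, supp_pt, LinearMap.adjoint_inner_left]

theorem map_smul (f : V →ₗ[ℝ] W) (t : ℝ) (K : ConvexBody V) : map f (t • K) = t • map f K :=
  ConvexBody.ext (by
    rw [coe_map, coe_smul, coe_smul, coe_map]
    exact Set.image_smul_comm _ _ _ fun x => f.map_smul t x)

theorem coe_neg_one_smul (K : ConvexBody V) : (((-1 : ℝ) • K : ConvexBody V) : Set V) = -K := by
  rw [coe_smul]
  ext x
  rw [Set.mem_neg, Set.mem_smul_set]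
  constructor
  · rintro ⟨y, hy, rfl⟩; simpa using hy
  · exact fun h => ⟨-x, h, by simp⟩

theorem supp_neg_one_smul (K : ConvexBody V) (x : V) : ((-1 : ℝ) • K).supp x = K.supp (-x) := by
  have : (-1 : ℝ) • K = map (-LinearMap.id) K := ConvexBody.ext (by
    rw [coe_neg_one_smul, coe_map]
    exact Set.image_neg_eq_neg.symm)
  rw [this, supp_map]
  congr 1
  refine ext_inner_right ℝ fun v => ?_
  rw [LinearMap.adjoint_inner_left]
  simp

/-- The intersection of a convex body with a closed convex set meeting it. -/
def inter (K : ConvexBody V) (C : Set V) (hc : Convex ℝ C) (hcl : IsClosed C)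
    (hne : ((K : Set V) ∩ C).Nonempty) : ConvexBody V where
  carrier := K ∩ C
  convex' := K.convex.inter hc
  isCompact' := K.isCompact.inter_right hcl
  nonempty' := hne

/-- The closed ball as a convex body. -/
def ball (a : V) (r : ℝ) (hr : 0 ≤ r) : ConvexBody V where
  carrier := Metric.closedBall a r
  convex' := convex_closedBall a r
  isCompact' := isCompact_closedBall a r
  nonempty' := ⟨a, Metric.mem_closedBall_self hr⟩

theorem mem_ball_zero {r : ℝ} {hr : 0 ≤ r} {x : V} : x ∈ ball (0 : V) r hr ↔ ‖x‖ ≤ r :=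
  mem_closedBall_zero_iff

theorem supp_ball_zero {r : ℝ} (hr : 0 ≤ r) (x : V) : (ball 0 r hr).supp x = r * ‖x‖ := by
  by_cases hx : x = 0
  · simp [hx, supp_zero_arg]
  refine supp_eq_of (y := (r / ‖x‖) • x) ?_ ?_ ?_
  · rw [mem_ball_zero, norm_smul, norm_div, norm_norm, div_mul_cancel₀ _ (norm_ne_zero_iff.2 hx),
      Real.norm_of_nonneg hr]
  · rw [inner_smul_right, real_inner_self_eq_norm_sq]
    have := norm_ne_zero_iff.2 hx
    field_simp
  · intro z hz
    rw [mem_ball_zero] at hz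
    rw [mul_comm]
    exact (real_inner_le_norm x z).trans (by gcongr)

theorem exists_dist_le_of_mem {K L : ConvexBody V} {y : V} (hy : y ∈ K) :
    ∃ z ∈ L, dist y z ≤ dist K L := by
  obtain ⟨z, hz, e⟩ := L.isCompact.exists_infDist_eq_dist L.nonempty y
  refine ⟨z, hz, ?_⟩
  rw [← e]
  exact Metric.infDist_le_hausdorffDist_of_mem hy hausdorffEDist_ne_top

/-- Since ε‖x‖ is the support function of the ε-ball, the hypothesis says that each body lies in the
sum of the other and that ball. All Hausdorff estimates thereby become estimates of support
functions. -/
theorem dist_le_of_supp {K L : ConvexBody V} {ε : ℝ} (hε : 0 ≤ ε)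
    (h : ∀ x, |K.supp x - L.supp x| ≤ ε * ‖x‖) : dist K L ≤ ε := by
  have key : ∀ K L : ConvexBody V, (∀ x, K.supp x ≤ L.supp x + ε * ‖x‖) →
      ∀ y ∈ (K : Set V), ∃ z ∈ (L : Set V), dist y z ≤ ε := by
    intro K L h y hy
    have : K ≤ L + ball 0 ε hε := le_iff_supp_le.2 fun x => by
      rw [supp_add, supp_ball_zero]; exact h x
    obtain ⟨z, hz, w, hw, rfl⟩ := mem_add.1 (this hy)
    exact ⟨z, hz, by simpa using mem_ball_zero.1 hw⟩
  refine Metric.hausdorffDist_le_of_mem_dist hε (key K L fun x => ?_) (key L K fun x => ?_)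
  · linarith [(abs_le.1 (h x)).2]
  · linarith [(abs_le.1 (h x)).1]

theorem abs_supp_sub_supp_le (K L : ConvexBody V) (x : V) :
    |K.supp x - L.supp x| ≤ dist K L * ‖x‖ := by
  have key : ∀ K L : ConvexBody V, K.supp x - L.supp x ≤ dist K L * ‖x‖ := by
    intro K L
    obtain ⟨y, hy, e⟩ := K.exists_inner_eq_supp x
    obtain ⟨z, hz, hd⟩ := exists_dist_le_of_mem (L := L) hy
    have h1 := inner_le_supp hz x
    have h2 := real_inner_le_norm x (y - z)
    rw [inner_sub_right] at h2
    rw [dist_eq_norm] at hd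
    have h3 : ‖x‖ * ‖y - z‖ ≤ ‖x‖ * dist K L := by gcongr
    linarith
  refine abs_sub_le_iff.2 ⟨key K L, ?_⟩
  rw [dist_comm]; exact key L K

theorem dist_add_right_le (K L M : ConvexBody V) : dist (K + M) (L + M) ≤ dist K L :=
  dist_le_of_supp dist_nonneg fun x => by
    rw [supp_add, supp_add, add_sub_add_right_eq_sub]; exact abs_supp_sub_supp_le K L x

theorem continuous_add_right (M : ConvexBody V) : Continuous fun K : ConvexBody V => K + M :=
  (LipschitzWith.of_dist_le_mul (K := 1) fun K L => by
    simpa using dist_add_right_le K L M).continuous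

theorem continuous_add_left (M : ConvexBody V) : Continuous fun K : ConvexBody V => M + K := by
  simpa only [add_comm] using continuous_add_right M

theorem dist_map_le (f : V →ₗ[ℝ] W) (K L : ConvexBody V) :
    dist (map f K) (map f L) ≤ ‖LinearMap.toContinuousLinearMap f.adjoint‖ * dist K L :=
  dist_le_of_supp (by positivity) fun x => by
    rw [supp_map, supp_map]
    refine (abs_supp_sub_supp_le K L _).trans ?_
    have := (LinearMap.toContinuousLinearMap f.adjoint).le_opNorm x
    rw [LinearMap.coe_toContinuousLinearMap'] at this
    calc dist K L * ‖f.adjoint x‖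
        ≤ dist K L * (‖LinearMap.toContinuousLinearMap f.adjoint‖ * ‖x‖) := by gcongr
      _ = _ := by ring

theorem continuous_map (f : V →ₗ[ℝ] W) : Continuous (map f) :=
  (LipschitzWith.of_dist_le_mul (K := ‖LinearMap.toContinuousLinearMap f.adjoint‖₊)
    fun K L => dist_map_le f K L).continuous

end ConvexBody

/-! ### Valuations, hyperplane cuts, and volume as a continuous valuation -/

namespace ConvexBody

variable {V W : Type*} [NormedAddCommGroup V] [InnerProductSpace ℝ V] [FiniteDimensional ℝ V]
  [NormedAddCommGroup W] [InnerProductSpace ℝ W] [FiniteDimensional ℝ W]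

/-- Valuations on convex bodies. -/
def IsValuation (μ : ConvexBody V → ℝ) : Prop :=
  ∀ K L U I : ConvexBody V, (U : Set V) = ↑K ∪ ↑L → (I : Set V) = ↑K ∩ ↑L → μ U = μ K + μ L - μ I

/-- Translation-invariance of a function on convex bodies. -/
def IsTranslationInvariant (μ : ConvexBody V → ℝ) : Prop :=
  ∀ K a, μ (K + pt a) = μ K

/-- A function on convex bodies is simple if it vanishes on bodies lying in a hyperplane. -/
def IsSimple (μ : ConvexBody V → ℝ) : Prop :=
  ∀ (u : V) (c : ℝ) (K : ConvexBody V), u ≠ 0 → (∀ x ∈ K, inner ℝ u x = c) → μ K = 0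

theorem mem_add_seg {K : ConvexBody V} {s : ℝ} (hs : 0 ≤ s) {v x : V} :
    x ∈ K + seg 0 (s • v) ↔ ∃ k ∈ K, ∃ r : ℝ, 0 ≤ r ∧ r ≤ s ∧ k + r • v = x := by
  rw [mem_add]
  constructor
  · rintro ⟨k, hk, z, hz, rfl⟩
    obtain ⟨t, h0, h1, rfl⟩ := mem_seg_zero.1 hz
    refine ⟨k, hk, t * s, by positivity, by nlinarith, by rw [smul_smul]⟩
  · rintro ⟨k, hk, r, h0, h1, rfl⟩
    refine ⟨k, hk, r • v, mem_seg_zero.2 ?_, rfl⟩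
    rcases hs.eq_or_lt with rfl | hs
    · exact ⟨0, le_rfl, zero_le_one, by rw [le_antisymm h1 h0]; simp⟩
    · exact ⟨r / s, by positivity, by rwa [div_le_one hs], by
        rw [smul_smul, div_mul_cancel₀ _ hs.ne']⟩

/-- `t ↦ μ (K + [0, t v]) - μ K` is additive on nonnegative reals. -/
theorem IsValuation.add_seg {μ : ConvexBody V → ℝ} (hμ : IsValuation μ)
    (hti : IsTranslationInvariant μ) (K : ConvexBody V) (v : V) {s t : ℝ} (hs : 0 ≤ s)
    (ht : 0 ≤ t) :
    μ (K + seg 0 ((s + t) • v)) + μ K = μ (K + seg 0 (s • v)) + μ (K + seg 0 (t • v)) := by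
  have key := hμ (K + seg 0 (s • v)) (K + seg 0 (t • v) + pt (s • v)) (K + seg 0 ((s + t) • v))
    (K + pt (s • v)) ?_ ?_
  · rw [hti, hti] at key; linarith
  · ext x
    simp only [SetLike.mem_coe, Set.mem_union, mem_add_pt, mem_add_seg hs, mem_add_seg ht,
      mem_add_seg (add_nonneg hs ht)]
    constructor
    · rintro ⟨k, hk, r, h0, h1, rfl⟩
      rcases le_total r s with h | h
      · exact Or.inl ⟨k, hk, r, h0, h, rfl⟩
      · exact Or.inr ⟨k, hk, r - s, by linarith, by linarith, by rw [sub_smul]; abel⟩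
    · rintro (⟨k, hk, r, h0, h1, rfl⟩ | ⟨k, hk, r, h0, h1, e⟩)
      · exact ⟨k, hk, r, h0, by linarith, rfl⟩
      · refine ⟨k, hk, r + s, by linarith, by linarith, ?_⟩
        rw [add_smul, ← add_assoc, e, sub_add_cancel]
  · ext x
    simp only [SetLike.mem_coe, Set.mem_inter_iff, mem_add_pt, mem_add_seg hs, mem_add_seg ht]
    constructor
    · intro h
      exact ⟨⟨_, h, s, hs, le_rfl, sub_add_cancel _ _⟩, ⟨_, h, 0, le_rfl, ht, by simp⟩⟩
    · rintro ⟨⟨k, hk, r, h0, h1, rfl⟩, ⟨l, hl, q, hq0, hq1, e⟩⟩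
      -- Moving back from x along v one meets k at distance r ≤ s and l at distance s + q ≥ s, so x
      -- - s v is a convex combination of k and l.
      have hsr : 0 ≤ s - r := by linarith
      rcases hsr.eq_or_lt with h | h
      · have : r = s := by linarith
        rw [this, add_sub_cancel_right]; exact hk
      · have hp : 0 < s - r + q := by linarith
        have := K.convex hk hl (a := q / (s - r + q)) (b := (s - r) / (s - r + q)) (by positivity)
          (by positivity) (by rw [← add_div, add_comm, div_self hp.ne'])
        rw [← SetLike.mem_coe]
        convert this using 1
        have hl' : l = k + r • v - s • v - q • v := by rw [← e]; abel
        rw [hl']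
        have hp' := hp.ne'
        match_scalars <;> field_simp <;> ring

/-- Cutting a body by a hyperplane. -/
theorem IsValuation.cut {μ : ConvexBody V → ℝ} (hμ : IsValuation μ) (hs : IsSimple μ)
    {u : V} (hu : u ≠ 0) {c : ℝ} {K A B : ConvexBody V}
    (hA : (A : Set V) = ↑K ∩ {x | inner ℝ u x ≤ c})
    (hB : (B : Set V) = ↑K ∩ {x | c ≤ inner ℝ u x}) : μ K = μ A + μ B := by
  obtain ⟨a, ha⟩ := A.nonempty
  obtain ⟨b, hb⟩ := B.nonempty
  rw [hA] at ha
  rw [hB] at hb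
  -- The slice must be nonempty to count as a convex body; a segment joining the two halves crosses
  -- the hyperplane.
  have hne : ((K : Set V) ∩ {x | inner ℝ u x = c}).Nonempty := by
    have hsub : segment ℝ a b ⊆ K := K.convex.segment_subset ha.1 hb.1
    have hcon : IsPreconnected (segment ℝ a b) := (convex_segment a b).isPreconnected
    obtain ⟨x, hx, e⟩ := hcon.intermediate_value (left_mem_segment ℝ a b) (right_mem_segment ℝ a b)
      (f := fun x => inner ℝ u x) (by fun_prop) ⟨ha.2, hb.2⟩
    exact ⟨x, hsub hx, e⟩
  have hlin : IsLinearMap ℝ fun x : V => inner ℝ u x :=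
    ⟨fun a b => inner_add_right u a b, fun c a => by simp [inner_smul_right]⟩
  have key := hμ A B K (K.inter {x | inner ℝ u x = c} (convex_hyperplane hlin c)
    (isClosed_eq (by fun_prop) continuous_const) hne) ?_ ?_
  · have h0 : ∀ x ∈ K.inter {x | inner ℝ u x = c} (convex_hyperplane hlin c)
        (isClosed_eq (by fun_prop) continuous_const) hne, inner ℝ u x = c := fun x hx => hx.2
    rw [hs u c _ hu h0] at key
    linarith
  · rw [hA, hB, ← Set.inter_union_distrib_left]
    symm
    rw [Set.inter_eq_left]
    exact fun x _ => le_total (inner ℝ u x) c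
  · rw [hA, hB]
    ext x
    change x ∈ (K : Set V) ∩ {x | inner ℝ u x = c} ↔ _
    simp only [Set.mem_inter_iff, Set.mem_ofPred_eq, le_antisymm_iff]
    tauto

/-- If x were outside L, a separating direction u would give h_K(u) ≥ ⟪u, x⟫ + r‖u‖ > h_L(u) + r‖u‖,
too large a gap for bodies at distance below r. -/
theorem mem_of_closedBall_subset {K L : ConvexBody V} {x : V} {r : ℝ}
    (h : Metric.closedBall x r ⊆ (K : Set V)) (hr : 0 ≤ r) (hd : dist K L < r) : x ∈ L := by
  by_contra hx
  obtain ⟨u, c, h1, h2⟩ := exists_inner_lt_of_notMem L.convex L.isClosed hx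
  have hu : u ≠ 0 := by
    rintro rfl
    obtain ⟨z, hz⟩ := L.nonempty
    have := h1 z hz
    simp only [inner_zero_left] at this h2
    linarith
  have hup := norm_pos_iff.2 hu
  have hy : x + (r / ‖u‖) • u ∈ K := h (by
    rw [Metric.mem_closedBall, dist_self_add_left, norm_smul, norm_div, norm_norm,
      div_mul_cancel₀ _ hup.ne', Real.norm_of_nonneg hr])
  have h3 := inner_le_supp hy u
  have h4 : inner ℝ u (x + (r / ‖u‖) • u) = inner ℝ u x + r * ‖u‖ := by
    rw [inner_add_right, inner_smul_right, real_inner_self_eq_norm_sq]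
    field_simp
  have h5 : L.supp u ≤ c := supp_le_iff.2 fun z hz => (h1 z hz).le
  have h6 := (abs_le.1 (abs_supp_sub_supp_le K L u)).2
  nlinarith

section Volume

variable [MeasurableSpace V] [BorelSpace V]

theorem measurableSet (K : ConvexBody V) : MeasurableSet (K : Set V) := K.isClosed.measurableSet

theorem volume_ne_top (K : ConvexBody V) : volume (K : Set V) ≠ ⊤ :=
  K.isCompact.measure_lt_top.ne

/-- The volume of a convex body depends continuously on the body. -/
theorem continuous_volume : Continuous fun K : ConvexBody V => (volume (K : Set V)).toReal := by
  have hint : ∀ K : ConvexBody V,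
      (volume (K : Set V)).toReal = ∫ x, (K : Set V).indicator (fun _ => (1 : ℝ)) x := fun K => by
    rw [integral_indicator K.measurableSet, setIntegral_const, smul_eq_mul, mul_one]
    rfl
  simp_rw [hint]
  refine continuous_iff_continuousAt.2 fun K => ?_
  obtain ⟨R, hR0, hR⟩ := K.exists_norm_le
  refine tendsto_integral_filter_of_dominated_convergence
    ((Metric.closedBall (0 : V) (R + 1)).indicator fun _ => (1 : ℝ)) ?_ ?_ ?_ ?_
  · exact Filter.Eventually.of_forall fun L =>
      (measurable_const.indicator L.measurableSet).aestronglyMeasurable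
  · classical
    filter_upwards [Metric.ball_mem_nhds K one_pos] with L hL
    refine Filter.Eventually.of_forall fun x => ?_
    rw [Set.indicator_apply, Set.indicator_apply]
    split_ifs with h1 h2 h2
    · simp
    · exfalso; apply h2
      obtain ⟨z, hz, hd⟩ := exists_dist_le_of_mem (L := K) h1
      rw [Metric.mem_ball] at hL
      rw [dist_eq_norm] at hd
      rw [mem_closedBall_zero_iff]
      linarith [hR z hz, norm_le_norm_add_norm_sub z x, norm_sub_rev z x]
    · simp
    · simp
  · exact (integrable_indicator_iff measurableSet_closedBall).2
      (integrableOn_const (measure_closedBall_lt_top.ne))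
  -- Off the boundary of K the indicators of nearby bodies are eventually constant, and the boundary
  -- of a convex set is null.
  · have hnull : ∀ᵐ x ∂(volume : Measure V), x ∉ frontier (K : Set V) :=
      measure_eq_zero_iff_ae_notMem.1 (K.convex.addHaar_frontier volume)
    filter_upwards [hnull] with x hx
    refine tendsto_const_nhds.congr' ?_
    by_cases hxK : x ∈ (K : Set V)
    · have hi : x ∈ interior (K : Set V) := by
        by_contra h
        exact hx ⟨subset_closure hxK, h⟩
      obtain ⟨r, hr, hb⟩ := Metric.nhds_basis_closedBall.mem_iff.1 (mem_interior_iff_mem_nhds.1 hi)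
      filter_upwards [Metric.ball_mem_nhds K hr] with L hL
      rw [Metric.mem_ball, dist_comm] at hL
      have : x ∈ (L : Set V) := mem_of_closedBall_subset hb hr.le hL
      simp [hxK, this]
    · have hpos : 0 < Metric.infDist x (K : Set V) :=
        (K.isClosed.notMem_iff_infDist_pos K.nonempty).1 hxK
      filter_upwards [Metric.ball_mem_nhds K hpos] with L hL
      have : x ∉ (L : Set V) := fun h => by
        obtain ⟨z, hz, hd⟩ := exists_dist_le_of_mem (L := K) h
        exact absurd (Metric.infDist_le_dist_of_mem hz) (not_le.2 (hd.trans_lt hL))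
      simp [hxK, this]

theorem isValuation_volume : IsValuation fun K : ConvexBody V => (volume (K : Set V)).toReal := by
  intro K L U I hU hI
  have := measure_union_add_inter (μ := (volume : Measure V)) (K : Set V) L.measurableSet
  rw [← hU, ← hI] at this
  have h2 := congrArg ENNReal.toReal this
  rw [ENNReal.toReal_add U.volume_ne_top I.volume_ne_top,
    ENNReal.toReal_add K.volume_ne_top L.volume_ne_top] at h2
  simp only
  linarith

theorem isTranslationInvariant_volume :
    IsTranslationInvariant fun K : ConvexBody V => (volume (K : Set V)).toReal := by
  intro K a
  simp only [coe_add_pt, measure_vadd]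

end Volume

end ConvexBody

/-! ### Gaussian integrals and an explicit cosine transform -/

section GaussianIntegrals

variable {V : Type*} [NormedAddCommGroup V] [InnerProductSpace ℝ V] [FiniteDimensional ℝ V]
  [MeasurableSpace V] [BorelSpace V]

theorem integrable_exp_neg_mul_norm_sq {b : ℝ} (hb : 0 < b) :
    Integrable fun v : V => Real.exp (-b * ‖v‖ ^ 2) := by
  have h := (GaussianFourier.integrable_cexp_neg_mul_sq_norm_add (V := V) (b := (b : ℂ))
    (by simpa using hb) 0 0).norm
  refine h.congr (Filter.Eventually.of_forall fun v => ?_)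
  simp only [zero_mul, add_zero, Complex.norm_exp]
  norm_cast

/-- Bound (1 + t)^k by exp(kt) and complete the square, giving away half of the Gaussian exponent.
-/
theorem one_add_pow_mul_exp_le (k : ℕ) {b : ℝ} (hb : 0 < b) {t : ℝ} (ht : 0 ≤ t) :
    (1 + t) ^ k * Real.exp (-b * t ^ 2) ≤
      Real.exp ((k : ℝ) ^ 2 / (2 * b)) * Real.exp (-(b / 2) * t ^ 2) := by
  have h1 : (1 + t) ^ k ≤ Real.exp (k * t) := by
    rw [Real.exp_nat_mul]
    gcongr
    linarith [Real.add_one_le_exp t]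
  calc (1 + t) ^ k * Real.exp (-b * t ^ 2)
      ≤ Real.exp (k * t) * Real.exp (-b * t ^ 2) := by gcongr
    _ = Real.exp (k * t + -b * t ^ 2) := by rw [Real.exp_add]
    _ ≤ Real.exp ((k : ℝ) ^ 2 / (2 * b) + -(b / 2) * t ^ 2) := by
        apply Real.exp_le_exp.2
        have : 0 ≤ (k - b * t) ^ 2 / (2 * b) := by positivity
        have e : (k - b * t) ^ 2 / (2 * b) = (k : ℝ) ^ 2 / (2 * b) - k * t + b / 2 * t ^ 2 := by
          field_simp; ring
        rw [e] at this
        linarith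
    _ = _ := by rw [Real.exp_add]

theorem integrable_one_add_norm_pow_mul_exp (k : ℕ) {b : ℝ} (hb : 0 < b) :
    Integrable fun v : V => (1 + ‖v‖) ^ k * Real.exp (-b * ‖v‖ ^ 2) := by
  refine ((integrable_exp_neg_mul_norm_sq (V := V) (half_pos hb)).const_mul
    (Real.exp ((k : ℝ) ^ 2 / (2 * b)))).mono' (by fun_prop) (Filter.Eventually.of_forall fun v => ?_)
  rw [Real.norm_of_nonneg (by positivity)]
  exact one_add_pow_mul_exp_le k hb (norm_nonneg v)

/-- A function bounded by a polynomial times a Gaussian is integrable. -/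
theorem integrable_of_le_pow_mul_exp {f : V → ℝ} (hf : AEStronglyMeasurable f) (C : ℝ) (k : ℕ)
    {b : ℝ} (hb : 0 < b) (h : ∀ v, |f v| ≤ C * ((1 + ‖v‖) ^ k * Real.exp (-b * ‖v‖ ^ 2))) :
    Integrable f :=
  ((integrable_one_add_norm_pow_mul_exp k hb).const_mul C).mono' hf
    (Filter.Eventually.of_forall fun v => h v)

theorem integral_exp_quadratic_real {A : ℝ} (hA : 0 < A) (s : ℝ) :
    ∫ a : ℝ, Real.exp (-(A / 2) * a ^ 2 + s * a) =
      √(Real.pi / (A / 2)) * Real.exp (s ^ 2 / (2 * A)) := by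
  have h : ∀ a : ℝ, Real.exp (-(A / 2) * a ^ 2 + s * a) =
      Real.exp (-(A / 2) * (a - s / A) ^ 2) * Real.exp (s ^ 2 / (2 * A)) := fun a => by
    rw [← Real.exp_add]
    congr 1
    field_simp
    ring
  simp_rw [h]
  rw [integral_mul_const, integral_sub_right_eq_self (fun a => Real.exp (-(A / 2) * a ^ 2)),
    integral_gaussian]

/-- Integration over the orthogonal decomposition along a unit vector. -/
theorem measurePreserving_unit_decomposition {x : V} (hx : ‖x‖ = 1) :
    MeasurePreserving (fun p : ℝ × (Submodule.span ℝ {x})ᗮ => p.1 • x + (p.2 : V))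
      (volume.prod volume) volume := by
  have h1 := (LinearIsometryEquiv.toSpanUnitSingleton (𝕜 := ℝ) x hx).measurePreserving
  have h2 := MeasurePreserving.id (volume : Measure (Submodule.span ℝ {x})ᗮ)
  have h3 := WithLp.volume_preserving_toLp (Submodule.span ℝ {x}) (Submodule.span ℝ {x})ᗮ
  have h4 := (Submodule.span ℝ {x}).orthogonalDecomposition.symm.measurePreserving
  have := h4.comp (h3.comp (h1.prod h2))
  have e : (fun p : ℝ × (Submodule.span ℝ {x})ᗮ => p.1 • x + (p.2 : V)) =
      (Submodule.span ℝ {x}).orthogonalDecomposition.symm ∘ WithLp.toLp 2 ∘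
        Prod.map (LinearIsometryEquiv.toSpanUnitSingleton (𝕜 := ℝ) x hx) id := by
    funext p
    simp only [Function.comp_apply, Submodule.orthogonalDecomposition_symm_apply]
    rfl
  rw [e]
  exact this

theorem measurableEmbedding_unit_decomposition {x : V} (hx : ‖x‖ = 1) :
    MeasurableEmbedding (fun p : ℝ × (Submodule.span ℝ {x})ᗮ => p.1 • x + (p.2 : V)) := by
  refine Continuous.measurableEmbedding (by fun_prop) ?_
  rintro ⟨t, v⟩ ⟨s, w⟩ h
  have hv : inner ℝ x (v : V) = 0 := Submodule.mem_orthogonal_singleton_iff_inner_right.1 v.2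
  have hw : inner ℝ x (w : V) = 0 := Submodule.mem_orthogonal_singleton_iff_inner_right.1 w.2
  have h' := congrArg (fun y => inner ℝ x y) h
  simp only [inner_add_right, inner_smul_right, real_inner_self_eq_norm_sq, hx, hv, hw] at h'
  have hts : t = s := by linarith
  subst hts
  simpa using h

/-- Real and imaginary parts of the Fourier transform of the Gaussian, multiplied by the phase
exp(ia). -/
theorem integral_cos_add_inner (w : V) (a : ℝ) :
    ∫ v : V, Real.cos (a + inner ℝ w v) * Real.exp (-(1 / 2) * ‖v‖ ^ 2) =
      (2 * Real.pi) ^ ((Module.finrank ℝ V : ℝ) / 2) * Real.exp (-‖w‖ ^ 2 / 2) * Real.cos a ∧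
    ∫ v : V, Real.sin (a + inner ℝ w v) * Real.exp (-(1 / 2) * ‖v‖ ^ 2) =
      (2 * Real.pi) ^ ((Module.finrank ℝ V : ℝ) / 2) * Real.exp (-‖w‖ ^ 2 / 2) * Real.sin a := by
  have hb : (0 : ℝ) < (1 / 2 : ℂ).re := by norm_num
  have hint := (GaussianFourier.integrable_cexp_neg_mul_sq_norm_add hb Complex.I w).const_mul
    (Complex.exp (a * Complex.I))
  have key := GaussianFourier.integral_cexp_neg_mul_sq_norm_add hb Complex.I w
  have hpt : ∀ v : V, Complex.exp (a * Complex.I) *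
      Complex.exp (-(1 / 2 : ℂ) * (‖v‖ : ℂ) ^ 2 + Complex.I * ((inner ℝ w v : ℝ) : ℂ)) =
      ((Real.cos (a + inner ℝ w v) * Real.exp (-(1 / 2) * ‖v‖ ^ 2) : ℝ) : ℂ) +
      ((Real.sin (a + inner ℝ w v) * Real.exp (-(1 / 2) * ‖v‖ ^ 2) : ℝ) : ℂ) * Complex.I := by
    intro v
    rw [← Complex.exp_add, show (a : ℂ) * Complex.I + (-(1 / 2 : ℂ) * (‖v‖ : ℂ) ^ 2 +
      Complex.I * ((inner ℝ w v : ℝ) : ℂ)) = ((-(1 / 2) * ‖v‖ ^ 2 : ℝ) : ℂ) +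
        ((a + inner ℝ w v : ℝ) : ℂ) * Complex.I by push_cast; ring, Complex.exp_add,
      Complex.exp_mul_I]
    push_cast
    ring
  have hval : Complex.exp (a * Complex.I) * ((↑Real.pi / (1 / 2 : ℂ)) ^
      (((Module.finrank ℝ V : ℕ) : ℂ) / 2) *
      Complex.exp (Complex.I ^ 2 * (‖w‖ : ℂ) ^ 2 / (4 * (1 / 2 : ℂ)))) =
      (((2 * Real.pi) ^ ((Module.finrank ℝ V : ℝ) / 2) * Real.exp (-‖w‖ ^ 2 / 2) * Real.cos a : ℝ)
        : ℂ) + (((2 * Real.pi) ^ ((Module.finrank ℝ V : ℝ) / 2) * Real.exp (-‖w‖ ^ 2 / 2) *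
          Real.sin a : ℝ) : ℂ) * Complex.I := by
    rw [Complex.exp_mul_I]
    push_cast
    rw [Complex.ofReal_cpow (by positivity)]
    push_cast
    rw [Complex.I_sq, show (↑Real.pi / (1 / 2 : ℂ)) = 2 * ↑Real.pi by ring,
      show (-1 * (‖w‖ : ℂ) ^ 2 / (4 * (1 / 2))) = -(‖w‖ : ℂ) ^ 2 / 2 by ring]
    ring
  have hF := hval
  rw [← key, ← integral_const_mul] at hF
  refine ⟨?_, ?_⟩
  · have h := congrArg Complex.re hF
    rw [← RCLike.re_eq_complex_re, ← integral_re hint] at h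
    simpa only [hpt, RCLike.re_eq_complex_re, Complex.add_re, Complex.ofReal_re, Complex.mul_re,
      Complex.I_re, Complex.I_im, Complex.ofReal_im, mul_zero, mul_one, sub_zero, add_zero] using h
  · have h := congrArg Complex.im hF
    rw [← RCLike.im_eq_complex_im, ← integral_im hint] at h
    simpa only [hpt, RCLike.im_eq_complex_im, Complex.add_im, Complex.ofReal_re, Complex.mul_im,
      Complex.I_re, Complex.I_im, Complex.ofReal_im, mul_zero, mul_one, zero_add, add_zero] using h

theorem hasFDerivAt_exp_norm_sq (v : V) : HasFDerivAt
    (fun v : V => Real.exp (-(1 / 2) * ‖v‖ ^ 2))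
    (-(Real.exp (-(1 / 2) * ‖v‖ ^ 2)) • innerSL ℝ v) v := by
  have h := ((hasStrictFDerivAt_norm_sq v).hasFDerivAt.const_mul (-(1 / 2 : ℝ))).exp
  convert h using 1
  ext u
  simp

theorem hasFDerivAt_sin_add_inner (w : V) (a : ℝ) (v : V) : HasFDerivAt
    (fun v : V => Real.sin (a + inner ℝ w v)) (Real.cos (a + inner ℝ w v) • innerSL ℝ w) v := by
  exact ((innerSL ℝ w).hasFDerivAt.const_add a).sin

/-- Stein's identity for `v ↦ sin (a + ⟪w, v⟫)`. -/
theorem integral_inner_mul_sin_add_inner (w : V) (a : ℝ) :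
    ∫ v : V, inner ℝ w v * Real.sin (a + inner ℝ w v) * Real.exp (-(1 / 2) * ‖v‖ ^ 2) =
      ‖w‖ ^ 2 * ∫ v : V, Real.cos (a + inner ℝ w v) * Real.exp (-(1 / 2) * ‖v‖ ^ 2) := by
  have hw : ∀ v : V, |inner ℝ w v| ≤ ‖w‖ * (1 + ‖v‖) := fun v =>
    (abs_real_inner_le_norm w v).trans (by gcongr; linarith)
  -- Integration by parts in direction w: differentiating the Gaussian produces the factor -⟪v, w⟫,
  -- differentiating the sine produces ‖w‖² cos.
  have key := integral_mul_fderiv_eq_neg_fderiv_mul_of_integrable (μ := (volume : Measure V))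
    (f := fun v : V => Real.exp (-(1 / 2) * ‖v‖ ^ 2))
    (g := fun v : V => Real.sin (a + inner ℝ w v)) (v := w) ?_ ?_ ?_
    (fun v _ => (hasFDerivAt_exp_norm_sq v).differentiableAt)
    (fun v _ => (hasFDerivAt_sin_add_inner w a v).differentiableAt)
  · simp only [(hasFDerivAt_exp_norm_sq _).fderiv, (hasFDerivAt_sin_add_inner w a _).fderiv,
      smul_apply, innerSL_apply_apply, smul_eq_mul,
      real_inner_self_eq_norm_sq] at key
    rw [← integral_neg] at key
    rw [← integral_const_mul]
    calc _ = _ := integral_congr_ae (Filter.Eventually.of_forall fun v => by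
            simp only [real_inner_comm v w]; ring)
      _ = _ := key.symm
      _ = _ := integral_congr_ae (Filter.Eventually.of_forall fun v => by simp only; ring)
  · simp only [(hasFDerivAt_exp_norm_sq _).fderiv,
      smul_apply, innerSL_apply_apply, smul_eq_mul]
    refine integrable_of_le_pow_mul_exp (Continuous.aestronglyMeasurable (by fun_prop)) ‖w‖ 1
      (half_pos one_pos) fun v => ?_
    rw [abs_mul, abs_mul, abs_neg, Real.abs_exp, pow_one, real_inner_comm]
    calc _ ≤ Real.exp (-(1 / 2) * ‖v‖ ^ 2) * (‖w‖ * (1 + ‖v‖)) * 1 := by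
            gcongr
            · exact hw v
            · exact Real.abs_sin_le_one _
      _ = _ := by ring
  · simp only [(hasFDerivAt_sin_add_inner w a _).fderiv,
      smul_apply, innerSL_apply_apply, smul_eq_mul]
    refine integrable_of_le_pow_mul_exp (Continuous.aestronglyMeasurable (by fun_prop)) (‖w‖ ^ 2) 0
      (half_pos one_pos) fun v => ?_
    rw [abs_mul, abs_mul, Real.abs_exp, pow_zero, one_mul, real_inner_self_eq_norm_sq, abs_sq]
    calc _ ≤ Real.exp (-(1 / 2) * ‖v‖ ^ 2) * (1 * ‖w‖ ^ 2) := by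
            gcongr
            exact Real.abs_cos_le_one _
      _ = _ := by ring
  · refine integrable_of_le_pow_mul_exp (Continuous.aestronglyMeasurable (by fun_prop)) 1 0
      (half_pos one_pos) fun v => ?_
    rw [abs_mul, Real.abs_exp, pow_zero, one_mul, one_mul]
    exact mul_le_of_le_one_right (Real.exp_nonneg _) (Real.abs_sin_le_one _)

/-- The integrand is even, and on the positive half-line it has the antiderivative -exp(-t²/2)(cos
tz + zt sin tz), which runs from -1 to 0. The independence of z is what makes the kernel below work.
-/
theorem integral_abs_mul_kernel (z : ℝ) :
    ∫ t : ℝ, |t| * ((1 - z ^ 2) * Real.cos (t * z) + t * z * Real.sin (t * z)) *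
      Real.exp (-(1 / 2) * t ^ 2) = 2 := by
  set f : ℝ → ℝ := fun t => t * ((1 - z ^ 2) * Real.cos (t * z) + t * z * Real.sin (t * z)) *
      Real.exp (-(1 / 2) * t ^ 2) with hf
  have hfe : ∀ t : ℝ, |t| * ((1 - z ^ 2) * Real.cos (t * z) + t * z * Real.sin (t * z)) *
      Real.exp (-(1 / 2) * t ^ 2) = f |t| := fun t => by
    rcases abs_choice t with h | h <;> simp only [hf, h]
    simp only [neg_mul, Real.cos_neg, Real.sin_neg, even_two.neg_pow]
    ring
  have hint : Integrable f := by
    refine integrable_of_le_pow_mul_exp (Continuous.aestronglyMeasurable (by fun_prop))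
      (1 + z ^ 2 + |z|) 2 (half_pos one_pos) fun t => ?_
    simp only [hf, abs_mul, Real.abs_exp, Real.norm_eq_abs, sq_abs]
    have h1 : |(1 - z ^ 2) * Real.cos (t * z) + t * z * Real.sin (t * z)| ≤
        (1 + z ^ 2) * 1 + |t| * |z| * 1 := by
      refine (abs_add_le _ _).trans ?_
      rw [abs_mul, abs_mul, abs_mul]
      gcongr
      · rw [abs_le]; constructor <;> nlinarith
      · exact Real.abs_cos_le_one _
      · exact Real.abs_sin_le_one _
    have := abs_nonneg t
    have := abs_nonneg z
    have h2 : |t| * ((1 + z ^ 2) * 1 + |t| * |z| * 1) ≤ (1 + z ^ 2 + |z|) * (1 + |t|) ^ 2 := by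
      nlinarith [mul_nonneg (abs_nonneg t) (abs_nonneg z), sq_nonneg z,
        mul_nonneg (abs_nonneg t) (sq_nonneg z), mul_nonneg (sq_nonneg |t|) (sq_nonneg z)]
    rw [← mul_assoc]
    refine mul_le_mul_of_nonneg_right (le_trans ?_ h2) (Real.exp_nonneg _)
    gcongr
  have hderiv : ∀ t : ℝ, HasDerivAt (fun t => -(Real.exp (-(1 / 2) * t ^ 2) *
      (Real.cos (t * z) + z * t * Real.sin (t * z)))) (f t) t := fun t => by
    have h1 : HasDerivAt (fun t : ℝ => Real.exp (-(1 / 2) * t ^ 2))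
        (Real.exp (-(1 / 2) * t ^ 2) * (-(1 / 2) * (2 * t))) t := by
      simpa using ((hasDerivAt_pow 2 t).const_mul (-(1 / 2 : ℝ))).exp
    have h2 : HasDerivAt (fun t : ℝ => t * z) z t := by
      simpa using (hasDerivAt_id t).mul_const z
    have h3 : HasDerivAt (fun t : ℝ => z * t) z t := by
      simpa using (hasDerivAt_id t).const_mul z
    exact (h1.mul (h2.cos.add (h3.mul h2.sin))).neg.congr_deriv (by
      simp only [hf, Pi.add_apply, Pi.mul_apply]; ring)
  have hlim : Filter.Tendsto (fun t => -(Real.exp (-(1 / 2) * t ^ 2) *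
      (Real.cos (t * z) + z * t * Real.sin (t * z)))) Filter.atTop (nhds 0) := by
    have hb : Filter.Tendsto (fun t : ℝ => (1 + |z|) * (Real.exp ((1 : ℝ) ^ 2 / (2 * (1 / 2))) *
        Real.exp (-((1 / 2) / 2) * t ^ 2))) Filter.atTop (nhds 0) := by
      rw [show (0 : ℝ) = (1 + |z|) * (Real.exp ((1 : ℝ) ^ 2 / (2 * (1 / 2))) * 0) by simp]
      refine (Filter.Tendsto.const_mul _ (Real.tendsto_exp_atBot.comp ?_)).const_mul _
      exact Filter.Tendsto.const_mul_atTop_of_neg (by norm_num)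
        (Filter.tendsto_pow_atTop two_ne_zero)
    refine squeeze_zero_norm' ?_ hb
    filter_upwards [Filter.eventually_ge_atTop 0] with t ht
    rw [norm_neg, norm_mul, Real.norm_of_nonneg (Real.exp_nonneg _), Real.norm_eq_abs]
    have h1 : |Real.cos (t * z) + z * t * Real.sin (t * z)| ≤ (1 + |z|) * (1 + t) := by
      refine (abs_add_le _ _).trans ?_
      rw [abs_mul, abs_mul, abs_of_nonneg ht]
      have h2 := Real.abs_cos_le_one (t * z)
      have h3 : |z| * t * |Real.sin (t * z)| ≤ |z| * t * 1 := by
        gcongr; exact Real.abs_sin_le_one _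
      nlinarith [abs_nonneg z]
    have h4 := one_add_pow_mul_exp_le 1 (half_pos one_pos) ht
    rw [pow_one, Nat.cast_one] at h4
    calc _ ≤ Real.exp (-(1 / 2) * t ^ 2) * ((1 + |z|) * (1 + t)) := by gcongr
      _ = (1 + |z|) * ((1 + t) * Real.exp (-(1 / 2) * t ^ 2)) := by ring
      _ ≤ _ := by gcongr
  simp_rw [hfe]
  rw [integral_comp_abs, integral_Ioi_of_hasDerivAt_of_tendsto
    (hderiv 0).continuousAt.continuousWithinAt (fun t _ => hderiv t) hint.integrableOn hlim]
  simp

/-- The even kernel representing `exp (⟪w, x⟫² / 2)` through `|⟪x, u⟫|`. -/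
noncomputable def cosineKernel (w u : V) : ℝ :=
  (1 - ‖w‖ ^ 2) * Real.cos (inner ℝ w u) + inner ℝ w u * Real.sin (inner ℝ w u)

theorem continuous_cosineKernel : Continuous fun p : V × V => cosineKernel p.1 p.2 := by
  unfold cosineKernel
  fun_prop

theorem abs_cosineKernel_le (w u : V) :
    |cosineKernel w u| ≤ (1 + ‖w‖) ^ 2 * (1 + ‖u‖) := by
  have h1 : |cosineKernel w u| ≤ (1 + ‖w‖ ^ 2) * 1 + ‖w‖ * ‖u‖ * 1 := by
    refine (abs_add_le _ _).trans ?_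
    rw [abs_mul, abs_mul]
    gcongr
    · rw [abs_le]; constructor <;> nlinarith [sq_nonneg ‖w‖]
    · exact Real.abs_cos_le_one _
    · exact abs_real_inner_le_norm w u
    · exact Real.abs_sin_le_one _
  nlinarith [norm_nonneg w, norm_nonneg u, mul_nonneg (norm_nonneg w) (norm_nonneg u),
    mul_nonneg (sq_nonneg ‖w‖) (norm_nonneg u)]

/-- `exp (⟪w, x⟫² / 2)`, as a function of the unit vector `x`, is a cosine transform. -/
theorem integral_abs_inner_mul_cosineKernel {x : V} (hx : ‖x‖ = 1) (w : V) :
    ∫ u : V, |inner ℝ x u| * cosineKernel w u * Real.exp (-(1 / 2) * ‖u‖ ^ 2) =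
      2 * (2 * Real.pi) ^ ((Module.finrank ℝ (Submodule.span ℝ {x})ᗮ : ℝ) / 2) *
        Real.exp ((inner ℝ w x) ^ 2 / 2 - ‖w‖ ^ 2 / 2) := by
  set H := (Submodule.span ℝ {x})ᗮ with hH
  set z := inner ℝ w x with hz
  have hperp : ∀ v : H, inner ℝ x (v : V) = 0 := fun v =>
    Submodule.mem_orthogonal_singleton_iff_inner_right.1 v.2
  obtain ⟨w', hw'⟩ : ∃ w' : H, (w' : V) = w - z • x :=
    ⟨⟨w - z • x, Submodule.mem_orthogonal_singleton_iff_inner_right.2 (by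
      rw [inner_sub_right, inner_smul_right, real_inner_self_eq_norm_sq, hx, hz,
        real_inner_comm]; simp)⟩, rfl⟩
  have hdec : w = z • x + (w' : V) := by rw [hw']; abel
  have hinner : ∀ v : H, inner ℝ w (v : V) = inner ℝ w' v := fun v => by
    rw [Submodule.coe_inner, hw', inner_sub_left, real_inner_smul_left, hperp]; simp
  have hnw : ‖w‖ ^ 2 = z ^ 2 + ‖w'‖ ^ 2 := by
    conv_lhs => rw [hdec]
    rw [← real_inner_self_eq_norm_sq, inner_add_left, inner_add_right, inner_add_right,
      real_inner_smul_left, real_inner_smul_right, real_inner_smul_left, real_inner_smul_right,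
      real_inner_comm x (w' : V), hperp, real_inner_self_eq_norm_sq, hx, real_inner_self_eq_norm_sq]
    simp
    ring
  set F : V → ℝ := fun u => |inner ℝ x u| * cosineKernel w u * Real.exp (-(1 / 2) * ‖u‖ ^ 2) with hF
  have hFint : Integrable F := by
    refine integrable_of_le_pow_mul_exp (Continuous.aestronglyMeasurable ?_) ((1 + ‖w‖) ^ 2) 2
      (half_pos one_pos) fun u => ?_
    · have := continuous_cosineKernel (V := V).comp (Continuous.prodMk_right w)
      simp only [hF]
      simp only [Function.comp_def] at this
      fun_prop
    · simp only [hF, abs_mul, Real.abs_exp, abs_abs]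
      have h1 := abs_real_inner_le_norm x u
      rw [hx, one_mul] at h1
      calc _ ≤ (1 + ‖u‖) * ((1 + ‖w‖) ^ 2 * (1 + ‖u‖)) * Real.exp (-(1 / 2) * ‖u‖ ^ 2) := by
            gcongr
            · linarith
            · exact abs_cosineKernel_le w u
        _ = _ := by ring
  have hprod : Integrable (fun p : ℝ × H => F (p.1 • x + (p.2 : V))) (volume.prod volume) :=
    (measurePreserving_unit_decomposition hx).integrable_comp_of_integrable hFint
  change ∫ u, F u = _
  rw [← (measurePreserving_unit_decomposition hx).integral_comp
    (measurableEmbedding_unit_decomposition hx) F, integral_prod _ hprod]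
  set M := (2 * Real.pi) ^ ((Module.finrank ℝ H : ℝ) / 2) * Real.exp (-‖w'‖ ^ 2 / 2) with hM
  -- Integrate first over the complement of x. Stein's identity turns ⟪w', v⟫ sin into ‖w'‖² cos, so
  -- the cosine has coefficient 1 - ‖w‖² + ‖w'‖² = 1 - z², as in the one-dimensional integral. Only
  -- the factor exp(-‖w'‖²/2) remembers w and x.
  have hin : ∀ t : ℝ, ∫ v : H, F (t • x + (v : V)) =
      M * (|t| * ((1 - z ^ 2) * Real.cos (t * z) + t * z * Real.sin (t * z)) *
      Real.exp (-(1 / 2) * t ^ 2)) := fun t => by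
    have e : ∀ v : H, F (t • x + (v : V)) = |t| * Real.exp (-(1 / 2) * t ^ 2) *
        ((1 - ‖w‖ ^ 2) * (Real.cos (t * z + inner ℝ w' v) * Real.exp (-(1 / 2) * ‖v‖ ^ 2)) +
        t * z * (Real.sin (t * z + inner ℝ w' v) * Real.exp (-(1 / 2) * ‖v‖ ^ 2)) +
        inner ℝ w' v * Real.sin (t * z + inner ℝ w' v) * Real.exp (-(1 / 2) * ‖v‖ ^ 2)) :=
      fun v => by
      have h1 : inner ℝ x (t • x + (v : V)) = t := by
        rw [inner_add_right, inner_smul_right, real_inner_self_eq_norm_sq, hx, hperp]; simp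
      have h2 : inner ℝ w (t • x + (v : V)) = t * z + inner ℝ w' v := by
        rw [inner_add_right, inner_smul_right, hinner]
      have h3 : ‖t • x + (v : V)‖ ^ 2 = t ^ 2 + ‖v‖ ^ 2 := by
        rw [← real_inner_self_eq_norm_sq, inner_add_left, real_inner_smul_left, h1,
          inner_add_right, inner_smul_right, real_inner_comm, hperp, real_inner_self_eq_norm_sq]
        simp
        ring
      simp only [hF, cosineKernel, h1, h2, h3, mul_add, Real.exp_add]
      ring
    have i1 : Integrable fun v : H => Real.cos (t * z + inner ℝ w' v) *
        Real.exp (-(1 / 2) * ‖v‖ ^ 2) :=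
      integrable_of_le_pow_mul_exp (Continuous.aestronglyMeasurable (by fun_prop)) 1 0
        (half_pos one_pos) fun v => by
          rw [abs_mul, Real.abs_exp, pow_zero, one_mul, one_mul]
          exact mul_le_of_le_one_left (Real.exp_nonneg _) (Real.abs_cos_le_one _)
    have i2 : Integrable fun v : H => Real.sin (t * z + inner ℝ w' v) *
        Real.exp (-(1 / 2) * ‖v‖ ^ 2) :=
      integrable_of_le_pow_mul_exp (Continuous.aestronglyMeasurable (by fun_prop)) 1 0
        (half_pos one_pos) fun v => by
          rw [abs_mul, Real.abs_exp, pow_zero, one_mul, one_mul]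
          exact mul_le_of_le_one_left (Real.exp_nonneg _) (Real.abs_sin_le_one _)
    have i3 : Integrable fun v : H => inner ℝ w' v * Real.sin (t * z + inner ℝ w' v) *
        Real.exp (-(1 / 2) * ‖v‖ ^ 2) :=
      integrable_of_le_pow_mul_exp (Continuous.aestronglyMeasurable (by fun_prop)) ‖w'‖ 1
        (half_pos one_pos) fun v => by
          rw [abs_mul, abs_mul, Real.abs_exp, pow_one]
          calc _ ≤ ‖w'‖ * (1 + ‖v‖) * 1 * Real.exp (-(1 / 2) * ‖v‖ ^ 2) := by
                gcongr
                · exact (abs_real_inner_le_norm w' v).trans (by gcongr; linarith)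
                · exact Real.abs_sin_le_one _
            _ = _ := by ring
    have i12 : Integrable fun v : H => (1 - ‖w‖ ^ 2) * (Real.cos (t * z + inner ℝ w' v) *
        Real.exp (-(1 / 2) * ‖v‖ ^ 2)) + t * z * (Real.sin (t * z + inner ℝ w' v) *
        Real.exp (-(1 / 2) * ‖v‖ ^ 2)) := (i1.const_mul _).add (i2.const_mul _)
    simp_rw [e]
    rw [integral_const_mul, integral_add i12 i3,
      integral_add (i1.const_mul _) (i2.const_mul _), integral_const_mul, integral_const_mul,
      integral_inner_mul_sin_add_inner, (integral_cos_add_inner w' (t * z)).1,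
      (integral_cos_add_inner w' (t * z)).2, hnw, ← hM]
    ring
  simp_rw [hin]
  rw [integral_const_mul, integral_abs_mul_kernel, hM, hnw,
    show z ^ 2 / 2 - (z ^ 2 + ‖w'‖ ^ 2) / 2 = -‖w'‖ ^ 2 / 2 by ring]
  ring

end GaussianIntegrals

/-! ### Zonoids as limits of zonotopes -/

namespace ConvexBody

variable {V : Type*} [NormedAddCommGroup V] [InnerProductSpace ℝ V] [FiniteDimensional ℝ V]

theorem supp_sum {ι : Type*} (s : Finset ι) (K : ι → ConvexBody V) (x : V) :
    (∑ i ∈ s, K i).supp x = ∑ i ∈ s, (K i).supp x := by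
  classical
  induction s using Finset.induction_on with
  | empty => simp [supp_zero]
  | insert i s hi ih => rw [Finset.sum_insert hi, Finset.sum_insert hi, supp_add, ih]

section Zonoid

variable {Ω : Type*} [MeasurableSpace Ω] {κ : Measure Ω}

theorem integrable_abs_inner {φ : Ω → V} (hφ : Integrable φ κ) (x : V) :
    Integrable (fun ω => |inner ℝ x (φ ω)|) κ := (hφ.const_inner x).abs

theorem exists_zonoid {φ : Ω → V} (hφ : Integrable φ κ) :
    ∃ Z : ConvexBody V, (∀ x, Z.supp x = ∫ ω, |inner ℝ x (φ ω)| ∂κ) ∧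
      (Z : Set V) = {y | ∀ x, inner ℝ x y ≤ ∫ ω, |inner ℝ x (φ ω)| ∂κ} := by
  refine exists_supp_eq (fun x => ∫ ω, |inner ℝ x (φ ω)| ∂κ) (fun c hc x => ?_) (fun x y => ?_)
    (R := ∫ ω, ‖φ ω‖ ∂κ) fun x => ?_
  · rw [← integral_const_mul]
    simp only [real_inner_smul_left, abs_mul, abs_of_pos hc]
  · rw [← integral_add (integrable_abs_inner hφ x) (integrable_abs_inner hφ y)]
    refine integral_mono (integrable_abs_inner hφ _)
      ((integrable_abs_inner hφ x).add (integrable_abs_inner hφ y)) fun ω => ?_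
    simp only [inner_add_left]
    exact abs_add_le _ _
  · rw [← integral_mul_const]
    refine integral_mono (integrable_abs_inner hφ _) (hφ.norm.mul_const _) fun ω => ?_
    simp only
    rw [mul_comm]
    exact abs_real_inner_le_norm _ _

/-- The zonoid with support function `x ↦ ∫ |⟪x, φ ω⟫| dκ(ω)`. -/
noncomputable def zonoid (κ : Measure Ω) (φ : Ω → V) (hφ : Integrable φ κ) : ConvexBody V :=
  (exists_zonoid hφ).choose

theorem supp_zonoid {φ : Ω → V} (hφ : Integrable φ κ) (x : V) :
    (zonoid κ φ hφ).supp x = ∫ ω, |inner ℝ x (φ ω)| ∂κ := (exists_zonoid hφ).choose_spec.1 x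

theorem coe_zonoid {φ : Ω → V} (hφ : Integrable φ κ) : (zonoid κ φ hφ : Set V) =
    {y | ∀ x, inner ℝ x y ≤ ∫ ω, |inner ℝ x (φ ω)| ∂κ} := (exists_zonoid hφ).choose_spec.2

theorem dist_zonoid_le {φ ψ : Ω → V} (hφ : Integrable φ κ) (hψ : Integrable ψ κ) :
    dist (zonoid κ φ hφ) (zonoid κ ψ hψ) ≤ ∫ ω, ‖φ ω - ψ ω‖ ∂κ := by
  refine dist_le_of_supp (integral_nonneg fun _ => norm_nonneg _) fun x => ?_
  rw [supp_zonoid, supp_zonoid, ← integral_sub (integrable_abs_inner hφ x)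
    (integrable_abs_inner hψ x), ← integral_mul_const]
  refine (abs_integral_le_integral_abs).trans (integral_mono
    ((integrable_abs_inner hφ x).sub (integrable_abs_inner hψ x)).abs
    ((hφ.sub hψ).norm.mul_const _) fun ω => ?_)
  simp only
  refine (abs_abs_sub_abs_le_abs_sub _ _).trans ?_
  rw [← inner_sub_right, mul_comm]
  exact abs_real_inner_le_norm _ _

/-- A fibre of mass c over the value v contributes c|⟪x, v⟫|, the support function of the segment
from -cv to cv. -/
theorem zonoid_simpleFunc (s : SimpleFunc Ω V) (hs : Integrable s κ) :
    zonoid κ s hs = ∑ v ∈ s.range, seg (-(κ.real (s ⁻¹' {v}) • v)) (κ.real (s ⁻¹' {v}) • v) := by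
  refine ext_supp fun x => ?_
  rw [supp_zonoid, supp_sum]
  have h1 := s.map_integral (fun v => |inner ℝ x v|) hs (by simp)
  have h2 : Integrable (s.map fun v => |inner ℝ x v|) κ := integrable_abs_inner hs x
  rw [SimpleFunc.integral_eq_integral _ h2] at h1
  refine Eq.trans h1 (Finset.sum_congr rfl fun v _ => ?_)
  rw [supp_seg_neg, inner_smul_right, abs_mul, abs_of_nonneg measureReal_nonneg, smul_eq_mul]

variable [MeasurableSpace V] [BorelSpace V]

/-- A zonoid is a limit of zonoids of simple functions, that is, of zonotopes. -/
theorem exists_tendsto_zonoid {φ : Ω → V} (hm : Measurable φ) (hφ : Integrable φ κ) :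
    ∃ s : ℕ → SimpleFunc Ω V, ∃ hs : ∀ n, Integrable (s n) κ,
      (∀ ω, Filter.Tendsto (fun n => s n ω) Filter.atTop (nhds (φ ω))) ∧
      (∀ n ω, ‖s n ω‖ ≤ 2 * ‖φ ω‖) ∧
      Filter.Tendsto (fun n => zonoid κ (s n) (hs n)) Filter.atTop (nhds (zonoid κ φ hφ)) := by
  have hs := SimpleFunc.integrable_approxOn_range hm hφ
  refine ⟨fun n => SimpleFunc.approxOn φ hm (Set.range φ ∪ {0}) 0 (by simp) n, hs, fun ω => ?_,
    fun n ω => ?_, ?_⟩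
  · exact SimpleFunc.tendsto_approxOn hm _ (subset_closure (by simp))
  · have := SimpleFunc.norm_approxOn_zero_le hm (s := Set.range φ ∪ {0}) (by simp) ω n
    rw [two_mul]; exact this
  · have ht := tendsto_integral_norm_approxOn_sub hm hφ
    rw [tendsto_iff_dist_tendsto_zero]
    exact squeeze_zero (fun _ => dist_nonneg) (fun n => dist_zonoid_le (hs n) hφ) ht

/-- Zonotopes belong to the class as sums of segments, and zonoids are limits of zonotopes. -/
theorem zonoid_mem {S : Set (ConvexBody V)} (hcl : IsClosed S) (hseg : ∀ v, seg (-v) v ∈ S)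
    (hadd : ∀ K ∈ S, ∀ L ∈ S, K + L ∈ S) {φ : Ω → V} (hφ : Integrable φ κ) :
    zonoid κ φ hφ ∈ S := by
  have hm := hφ.1.stronglyMeasurable_mk.measurable
  have hφ' : Integrable (hφ.1.mk φ) κ := hφ.congr hφ.1.ae_eq_mk
  have e : zonoid κ φ hφ = zonoid κ (hφ.1.mk φ) hφ' := ext_supp fun x => by
    rw [supp_zonoid, supp_zonoid]
    refine integral_congr_ae ?_
    filter_upwards [hφ.1.ae_eq_mk] with ω h
    rw [← h]
  rw [e]
  obtain ⟨s, hs, -, -, ht⟩ := exists_tendsto_zonoid hm hφ'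
  refine hcl.mem_of_tendsto ht (Filter.Eventually.of_forall fun n => ?_)
  rw [zonoid_simpleFunc]
  refine Finset.sum_induction _ (· ∈ S) (fun a b ha hb => hadd a ha b hb) ?_ fun v _ => hseg _
  have := hseg 0
  rw [neg_zero] at this
  rwa [← pt_zero]

/-- Split the signed density q into positive and negative parts: K plus the zonoid of the negative
part equals the zonoid of the positive part, and the class allows cancellation. -/
theorem mem_of_supp_eq_integral {S : Set (ConvexBody V)} (hcl : IsClosed S)
    (hseg : ∀ v, seg (-v) v ∈ S) (hadd : ∀ K ∈ S, ∀ L ∈ S, K + L ∈ S)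
    (hcancel : ∀ K Z, Z ∈ S → K + Z ∈ S → K ∈ S) {q : V → ℝ} (hq : Integrable q)
    (hqn : Integrable fun u => ‖u‖ * q u) (K : ConvexBody V)
    (hK : ∀ x, K.supp x = ∫ u, |inner ℝ x u| * q u) : K ∈ S := by
  have main : ∀ g : V → ℝ, AEStronglyMeasurable g → (∀ u, |g u| ≤ |q u|) →
      Integrable fun u => g u • u := fun g hg h => by
    refine hqn.mono (hg.smul aestronglyMeasurable_id) (Filter.Eventually.of_forall fun u => ?_)
    rw [norm_smul, norm_mul, norm_norm, mul_comm]
    exact mul_le_mul_of_nonneg_left (h u) (norm_nonneg u)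
  have hp := main (fun u => max (q u) 0) (hq.1.sup aestronglyMeasurable_const) fun u => by
    rcases le_total (q u) 0 with h | h <;> simp [h]
  have hn := main (fun u => max (-q u) 0) (hq.1.neg.sup aestronglyMeasurable_const) fun u => by
    rcases le_total (q u) 0 with h | h <;> simp [h]
  refine hcancel K (zonoid volume _ hn) (zonoid_mem hcl hseg hadd hn) ?_
  convert zonoid_mem hcl hseg hadd hp using 1
  refine ext_supp fun x => ?_
  rw [supp_add, supp_zonoid, supp_zonoid, hK, ← integral_add _ (integrable_abs_inner hn x)]
  · congr 1
    funext u
    simp only [inner_smul_right, abs_mul]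
    rw [abs_of_nonneg (le_max_right (-q u) 0), abs_of_nonneg (le_max_right (q u) 0)]
    rcases le_total (q u) 0 with h | h <;> simp [h] <;> ring
  · refine (hqn.norm.const_mul ‖x‖).mono' ?_ (Filter.Eventually.of_forall fun u => ?_)
    · exact (Continuous.aestronglyMeasurable (by fun_prop)).mul hq.1
    · rw [norm_mul, norm_mul, norm_norm, Real.norm_eq_abs, abs_abs, ← mul_assoc]
      exact mul_le_mul_of_nonneg_right (abs_real_inner_le_norm x u) (norm_nonneg _)

end Zonoid

/-! ### Gaussian smoothing of a support function -/

section Smoothing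

variable [MeasurableSpace V] [BorelSpace V] (L : ConvexBody V)

/-- The Gaussian weight on `ℝ × V`. -/
noncomputable def gaussWeight (p : ℝ × V) : ℝ :=
  Real.exp (-(1 / 2) * p.1 ^ 2) * Real.exp (-(1 / 2) * ‖p.2‖ ^ 2)

theorem gaussWeight_nonneg (p : ℝ × V) : 0 ≤ gaussWeight p := by
  unfold gaussWeight; positivity

theorem continuous_gaussWeight : Continuous (gaussWeight (V := V)) := by
  unfold gaussWeight; fun_prop

theorem integrable_mul_gaussWeight :
    Integrable (fun p : ℝ × V => (1 + |p.1|) * (1 + ‖p.2‖) * gaussWeight p)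
      (volume.prod volume) := by
  have h := (integrable_one_add_norm_pow_mul_exp (V := ℝ) 1 (half_pos one_pos)).mul_prod
    (integrable_one_add_norm_pow_mul_exp (V := V) 1 (half_pos one_pos))
  refine h.congr (Filter.Eventually.of_forall fun p => ?_)
  simp only [gaussWeight, pow_one, Real.norm_eq_abs, sq_abs]
  ring

theorem integrable_mul_gaussWeight_of_le {f : ℝ × V → ℝ} (hf : Continuous f) (C : ℝ)
    (h : ∀ p, |f p| ≤ C * ((1 + |p.1|) * (1 + ‖p.2‖))) :
    Integrable (fun p => f p * gaussWeight p) (volume.prod volume) := by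
  refine (integrable_mul_gaussWeight.const_mul C).mono'
    (hf.mul continuous_gaussWeight).aestronglyMeasurable (Filter.Eventually.of_forall fun p => ?_)
  rw [norm_mul, Real.norm_of_nonneg (gaussWeight_nonneg p), ← mul_assoc]
  exact mul_le_mul_of_nonneg_right (h p) (gaussWeight_nonneg p)

/-- The Gaussian average of the support function over `a x + r ξ`. -/
noncomputable def suppAverage (x : V) (r : ℝ) : ℝ :=
  ∫ p : ℝ × V, L.supp (p.1 • x + r • p.2) * gaussWeight p ∂(volume.prod volume)

theorem integrable_suppAverage (x : V) (r : ℝ) :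
    Integrable (fun p : ℝ × V => L.supp (p.1 • x + r • p.2) * gaussWeight p)
      (volume.prod volume) := by
  obtain ⟨R, hR0, hR⟩ := L.exists_norm_le
  refine integrable_mul_gaussWeight_of_le (L.continuous_supp.comp (by fun_prop))
    (R * (‖x‖ + |r|)) fun p => (abs_supp_le hR _).trans ?_
  rw [mul_assoc]
  gcongr
  refine (norm_add_le _ _).trans ?_
  rw [norm_smul, norm_smul, Real.norm_eq_abs, Real.norm_eq_abs]
  have h1 := abs_nonneg p.1
  have h2 := norm_nonneg p.2
  have h3 := norm_nonneg x
  have h4 := abs_nonneg r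
  nlinarith [mul_nonneg h1 h2, mul_nonneg h1 h3, mul_nonneg h1 h4, mul_nonneg h2 h3,
    mul_nonneg h2 h4, mul_nonneg (mul_nonneg h1 h2) h3, mul_nonneg (mul_nonneg h1 h2) h4]

theorem suppAverage_smul {c : ℝ} (hc : 0 ≤ c) (x : V) (r : ℝ) :
    L.suppAverage (c • x) (c * r) = c * L.suppAverage x r := by
  unfold suppAverage
  rw [← integral_const_mul]
  congr 1
  funext p
  rw [show p.1 • c • x + (c * r) • p.2 = c • (p.1 • x + r • p.2) by
    rw [smul_add, smul_comm, mul_smul], supp_smul_arg hc, mul_assoc]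

theorem suppAverage_add_le (x y : V) (r s : ℝ) :
    L.suppAverage (x + y) (r + s) ≤ L.suppAverage x r + L.suppAverage y s := by
  unfold suppAverage
  rw [← integral_add (L.integrable_suppAverage x r) (L.integrable_suppAverage y s)]
  refine integral_mono (L.integrable_suppAverage _ _)
    ((L.integrable_suppAverage x r).add (L.integrable_suppAverage y s)) fun p => ?_
  simp only
  rw [← add_mul, show p.1 • (x + y) + (r + s) • p.2 = (p.1 • x + r • p.2) + (p.1 • y + s • p.2) by
    rw [smul_add, add_smul]; abel]
  exact mul_le_mul_of_nonneg_right (L.supp_add_arg_le _ _) (gaussWeight_nonneg p)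

theorem suppAverage_neg (x : V) (r : ℝ) : L.suppAverage x (-r) = L.suppAverage x r := by
  unfold suppAverage
  rw [integral_prod _ (L.integrable_suppAverage x _), integral_prod _ (L.integrable_suppAverage x _)]
  congr 1
  funext a
  rw [← integral_neg_eq_self]
  simp [gaussWeight]

/-- As a function of r the average is even and convex. The weight l is chosen so that r is the
convex combination of s and -s. -/
theorem suppAverage_mono (x : V) {r s : ℝ} (hr : 0 ≤ r) (hrs : r ≤ s) :
    L.suppAverage x r ≤ L.suppAverage x s := by
  rcases (hr.trans hrs).eq_or_lt with h | h
  · rw [show r = s by linarith]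
  set l := (1 + r / s) / 2 with hl
  have h0 : 0 ≤ l := by positivity
  have h1 : 0 ≤ 1 - l := by
    have : r / s ≤ 1 := (div_le_one h).2 hrs
    rw [hl]; linarith
  have := L.suppAverage_add_le (l • x) ((1 - l) • x) (l * s) ((1 - l) * (-s))
  rw [suppAverage_smul L h0, suppAverage_smul L h1, suppAverage_neg, ← add_smul,
    add_sub_cancel, one_smul] at this
  have e : l * s + (1 - l) * -s = r := by rw [hl]; field_simp; ring
  rw [e] at this
  linarith

/-- The normalizing constant of `suppAverage`. -/
noncomputable def suppAverageConst (V : Type*) [NormedAddCommGroup V] [InnerProductSpace ℝ V]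
    [MeasurableSpace V] [FiniteDimensional ℝ V] [BorelSpace V] : ℝ :=
  ∫ p : ℝ × V, |p.1| * gaussWeight p ∂(volume.prod volume)

theorem suppAverageConst_pos : 0 < suppAverageConst V := by
  have h : suppAverageConst V = (∫ a : ℝ, |a| * Real.exp (-(1 / 2) * a ^ 2)) *
      ∫ v : V, Real.exp (-(1 / 2) * ‖v‖ ^ 2) := by
    rw [← integral_prod_mul]
    simp only [suppAverageConst, gaussWeight, mul_assoc]
  have h2 := integral_abs_mul_kernel 0
  simp only [ne_eq, OfNat.ofNat_ne_zero, not_false_eq_true, zero_pow, sub_zero, mul_zero,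
    Real.cos_zero, Real.sin_zero, add_zero, mul_one] at h2
  rw [h, h2, GaussianFourier.integral_rexp_neg_mul_sq_norm (half_pos one_pos)]
  have := Real.pi_pos
  positivity

/-- At r = 0 symmetry of L makes the average the first absolute Gaussian moment times the support
function; the Lipschitz bound controls the shift by r ξ. -/
theorem exists_abs_suppAverage_sub_le (hL : ∀ x, L.supp (-x) = L.supp x) :
    ∃ C, 0 ≤ C ∧ ∀ x r, |L.suppAverage x r - suppAverageConst V * L.supp x| ≤ C * |r| := by
  obtain ⟨R, hR0, hR⟩ := L.exists_norm_le
  have hn : Integrable (fun p : ℝ × V => ‖p.2‖ * gaussWeight p) (volume.prod volume) :=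
    integrable_mul_gaussWeight_of_le (by fun_prop) 1 fun p => by
      rw [abs_norm]; nlinarith [abs_nonneg p.1, norm_nonneg p.2,
        mul_nonneg (abs_nonneg p.1) (norm_nonneg p.2)]
  have ha : Integrable (fun p : ℝ × V => |p.1| * gaussWeight p) (volume.prod volume) :=
    integrable_mul_gaussWeight_of_le (by fun_prop) 1 fun p => by
      rw [abs_abs]; nlinarith [abs_nonneg p.1, norm_nonneg p.2,
        mul_nonneg (abs_nonneg p.1) (norm_nonneg p.2)]
  refine ⟨R * ∫ p : ℝ × V, ‖p.2‖ * gaussWeight p ∂(volume.prod volume),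
    mul_nonneg hR0.le (integral_nonneg fun p => mul_nonneg (norm_nonneg _) (gaussWeight_nonneg p)),
    fun x r => ?_⟩
  rw [suppAverageConst, suppAverage, ← integral_mul_const,
    ← integral_sub (L.integrable_suppAverage x r) (ha.mul_const _), mul_right_comm,
    ← integral_const_mul]
  refine abs_integral_le_integral_abs.trans (integral_mono
    ((L.integrable_suppAverage x r).sub (ha.mul_const _)).abs (hn.const_mul _) fun p => ?_)
  simp only
  have h1 : |p.1| * L.supp x = L.supp (p.1 • x) := by
    rcases abs_choice p.1 with h | h
    · rw [← supp_smul_arg (abs_nonneg _), h]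
    · rw [← supp_smul_arg (abs_nonneg _), h, neg_smul, hL]
  rw [mul_right_comm, h1, ← sub_mul, abs_mul, abs_of_nonneg (gaussWeight_nonneg p), ← mul_assoc]
  refine mul_le_mul_of_nonneg_right ((abs_supp_sub_le hR _ _).trans ?_) (gaussWeight_nonneg p)
  rw [add_sub_cancel_left, norm_smul, Real.norm_eq_abs, mul_assoc]

end Smoothing

end ConvexBody

/-! ### Symmetric bodies are limits of differences of zonotopes -/

namespace ConvexBody

variable {V : Type*} [NormedAddCommGroup V] [InnerProductSpace ℝ V] [FiniteDimensional ℝ V]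

section Smoothing

variable [MeasurableSpace V] [BorelSpace V] (L : ConvexBody V)

theorem measurePreserving_shear (x : V) (b : ℝ) : MeasurePreserving
    (fun p : ℝ × V => (p.1, p.2 - (p.1 * b) • x)) (volume.prod volume) (volume.prod volume) :=
  (MeasurePreserving.id (volume : Measure ℝ)).skew_product
    (g := fun a v => v - (a * b) • x) (by fun_prop)
    (Filter.Eventually.of_forall fun a => (measurePreserving_sub_right volume ((a * b) • x)).map_eq)

/-- Completing the square: the Gaussian average as an integral against an explicit kernel. -/
theorem suppAverage_eq_integral {x : V} (hx : ‖x‖ = 1) {ε : ℝ} (hε : 0 < ε) :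
    L.suppAverage x ε = ε * √(Real.pi / ((1 + (ε⁻¹) ^ 2) / 2)) *
      ∫ y : V, L.supp y * (Real.exp (-(1 / 2) * ‖y‖ ^ 2) *
        Real.exp ((1 + ε ^ 2)⁻¹ * inner ℝ y x ^ 2 / 2)) := by
  have hA : 0 < 1 + (ε⁻¹) ^ 2 := by positivity
  -- Substituting ξ = y - (a/ε) x turns a x + ε ξ into ε y. The support function no longer depends
  -- on a, whose Gaussian integral can be evaluated.
  have hmp := measurePreserving_shear (V := V) x ε⁻¹
  have hint := hmp.integrable_comp_of_integrable (L.integrable_suppAverage x ε)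
  have hpt : ∀ p : ℝ × V, L.supp (p.1 • x + ε • (p.2 - (p.1 * ε⁻¹) • x)) *
      gaussWeight (p.1, p.2 - (p.1 * ε⁻¹) • x) =
      ε * L.supp p.2 * (Real.exp (-(1 / 2) * ‖p.2‖ ^ 2) *
        Real.exp (-((1 + (ε⁻¹) ^ 2) / 2) * p.1 ^ 2 + (inner ℝ p.2 x * ε⁻¹) * p.1)) := fun p => by
    have h1 : p.1 • x + ε • (p.2 - (p.1 * ε⁻¹) • x) = ε • p.2 := by
      rw [smul_sub, smul_smul, mul_left_comm, mul_inv_cancel₀ hε.ne', mul_one]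
      abel
    rw [h1, supp_smul_arg hε.le, gaussWeight, ← Real.exp_add, ← Real.exp_add]
    congr 2
    simp only
    rw [norm_sub_sq_real, norm_smul, hx, inner_smul_right, mul_one, Real.norm_eq_abs, sq_abs]
    ring
  have hswap : Integrable (Function.uncurry fun (a : ℝ) (y : V) =>
      ε * L.supp y * (Real.exp (-(1 / 2) * ‖y‖ ^ 2) *
        Real.exp (-((1 + (ε⁻¹) ^ 2) / 2) * a ^ 2 + (inner ℝ y x * ε⁻¹) * a)))
      (volume.prod volume) := hint.congr (Filter.Eventually.of_forall hpt)
  rw [suppAverage, integral_prod _ (L.integrable_suppAverage x ε)]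
  have h2 : ∀ a : ℝ, ∫ v : V, L.supp (a • x + ε • v) * gaussWeight (a, v) =
      ∫ y : V, ε * L.supp y * (Real.exp (-(1 / 2) * ‖y‖ ^ 2) *
        Real.exp (-((1 + (ε⁻¹) ^ 2) / 2) * a ^ 2 + (inner ℝ y x * ε⁻¹) * a)) := fun a => by
    rw [← integral_sub_right_eq_self _ ((a * ε⁻¹) • x)]
    exact integral_congr_ae (Filter.Eventually.of_forall fun y => hpt (a, y))
  simp_rw [h2]
  rw [integral_integral_swap hswap, ← integral_const_mul]
  congr 1
  funext y
  rw [integral_const_mul, integral_const_mul, integral_exp_quadratic_real hA]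
  have h3 : (inner ℝ y x * ε⁻¹) ^ 2 / (2 * (1 + (ε⁻¹) ^ 2)) =
      (1 + ε ^ 2)⁻¹ * inner ℝ y x ^ 2 / 2 := by
    field_simp
    ring
  rw [h3]
  ring

theorem finrank_orthogonal_span_unit {x : V} (hx : ‖x‖ = 1) :
    (Module.finrank ℝ (Submodule.span ℝ {x})ᗮ : ℝ) = Module.finrank ℝ V - 1 := by
  have h := (Submodule.span ℝ {x}).finrank_add_finrank_orthogonal
  rw [finrank_span_singleton (by rintro rfl; simp at hx)] at h
  rw [← h]
  push_cast
  ring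

/-- The Gaussian average of the support function is the cosine transform of a density. -/
theorem exists_suppAverage_eq_cosine {ε : ℝ} (hε : 0 < ε) :
    ∃ q : V → ℝ, Integrable q ∧ Integrable (fun u => ‖u‖ * q u) ∧
      ∀ x : V, ‖x‖ = 1 → L.suppAverage x ε = ∫ u, |inner ℝ x u| * q u := by
  obtain ⟨R, hR0, hR⟩ := L.exists_norm_le
  -- This is the coefficient of ⟪y, x⟫²/2 left by the integral over a. The kernel is used with w =
  -- √θ y, which accounts for exp(-θ‖y‖²/2) out of the Gaussian in y. Since θ < 1, a factor
  -- exp(-β‖y‖²) with β > 0 remains and makes the integrals in y converge.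
  set θ : ℝ := (1 + ε ^ 2)⁻¹ with hθ
  have hθ0 : 0 < θ := by positivity
  have hθ1 : θ < 1 := inv_lt_one_of_one_lt₀ (by nlinarith)
  set β : ℝ := (1 - θ) / 2 with hβ
  have hβ0 : 0 < β := by rw [hβ]; linarith
  set c : ℝ := 2 * (2 * Real.pi) ^ (((Module.finrank ℝ V : ℝ) - 1) / 2) with hc
  have hc0 : c ≠ 0 := by have := Real.pi_pos; positivity
  set A : ℝ := ε * √(Real.pi / ((1 + (ε⁻¹) ^ 2) / 2)) * c⁻¹ with hA
  let Ψ : V × V → ℝ := fun p => A * (L.supp p.1 * Real.exp (-β * ‖p.1‖ ^ 2)) *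
    (cosineKernel (√θ • p.1) p.2 * Real.exp (-(1 / 2) * ‖p.2‖ ^ 2))
  have hΨc : Continuous Ψ := by
    have h1 := L.continuous_supp
    have h2 := (continuous_cosineKernel (V := V)).comp
      (f := fun p : V × V => (√θ • p.1, p.2)) (by fun_prop)
    simp only [Function.comp_def] at h2
    simp only [Ψ]
    fun_prop
  have hbound : ∀ p, (1 + ‖p.2‖) * |Ψ p| ≤ |A| * R *
      (((1 + ‖p.1‖) ^ 3 * Real.exp (-β * ‖p.1‖ ^ 2)) *
      ((1 + ‖p.2‖) ^ 2 * Real.exp (-(1 / 2) * ‖p.2‖ ^ 2))) := fun p => by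
    simp only [Ψ, abs_mul, Real.abs_exp]
    have h1 := abs_supp_le hR p.1
    have h2 := abs_cosineKernel_le (√θ • p.1) p.2
    have h3 : ‖√θ • p.1‖ ≤ ‖p.1‖ := by
      rw [norm_smul, Real.norm_of_nonneg (Real.sqrt_nonneg _)]
      exact mul_le_of_le_one_left (norm_nonneg _) (Real.sqrt_le_one.2 hθ1.le)
    calc _ ≤ (1 + ‖p.2‖) * (|A| * (R * (1 + ‖p.1‖) * Real.exp (-β * ‖p.1‖ ^ 2)) *
          ((1 + ‖p.1‖) ^ 2 * (1 + ‖p.2‖) * Real.exp (-(1 / 2) * ‖p.2‖ ^ 2))) := by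
          gcongr
          · exact h1.trans (by gcongr; linarith)
          · exact h2.trans (by gcongr)
      _ = _ := by ring
  have hdom := ((integrable_one_add_norm_pow_mul_exp (V := V) 3 hβ0).mul_prod
    (integrable_one_add_norm_pow_mul_exp (V := V) 2 (half_pos one_pos))).const_mul (|A| * R)
  have hweight : ∀ w : V × V → ℝ, Continuous w → (∀ p, |w p| ≤ 1 + ‖p.2‖) →
      Integrable (fun p => w p * Ψ p) (volume.prod volume) := fun w hw h =>
    hdom.mono' (hw.mul hΨc).aestronglyMeasurable (Filter.Eventually.of_forall fun p => by
      rw [norm_mul]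
      exact (mul_le_mul_of_nonneg_right (h p) (abs_nonneg _)).trans (hbound p))
  have i1 : Integrable Ψ (volume.prod volume) := by
    simpa using hweight (fun _ => 1) continuous_const fun p => by simp
  have i2 := hweight (fun p => ‖p.2‖) (by fun_prop) fun p => by simp
  refine ⟨fun u => ∫ y, Ψ (y, u), i1.integral_prod_right, ?_, fun x hx => ?_⟩
  · have := i2.integral_prod_right
    simpa only [integral_const_mul] using this
  have i3 := hweight (fun p => |inner ℝ x p.2|) (by fun_prop) fun p => by
    rw [abs_abs]
    have := abs_real_inner_le_norm x p.2
    rw [hx] at this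
    linarith
  simp_rw [← integral_const_mul]
  rw [← integral_integral_swap (f := fun y u => |inner ℝ x u| * Ψ (y, u)) i3,
    L.suppAverage_eq_integral hx hε, ← integral_const_mul]
  congr 1
  funext y
  have key := integral_abs_inner_mul_cosineKernel hx (√θ • y)
  rw [finrank_orthogonal_span_unit hx, ← hc] at key
  have e : ∀ u, |inner ℝ x u| * Ψ (y, u) = A * (L.supp y * Real.exp (-β * ‖y‖ ^ 2)) *
      (|inner ℝ x u| * cosineKernel (√θ • y) u * Real.exp (-(1 / 2) * ‖u‖ ^ 2)) := fun u => by
    simp only [Ψ]; ring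
  simp_rw [e]
  rw [integral_const_mul, key, real_inner_smul_left, norm_smul, mul_pow, mul_pow,
    Real.norm_of_nonneg (Real.sqrt_nonneg _), Real.sq_sqrt hθ0.le, hA]
  have e2 : Real.exp (-(1 / 2) * ‖y‖ ^ 2) * Real.exp (θ * inner ℝ y x ^ 2 / 2) =
      Real.exp (-β * ‖y‖ ^ 2) * Real.exp (θ * inner ℝ y x ^ 2 / 2 - θ * ‖y‖ ^ 2 / 2) := by
    rw [← Real.exp_add, ← Real.exp_add]
    congr 1
    rw [hβ]
    ring
  rw [e2]
  field_simp

end Smoothing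

/-- Differences of zonotopes are dense among centrally symmetric bodies: a closed class of
bodies that contains the symmetric segments and is stable under sums and under
cancellation contains every centrally symmetric body. -/
theorem mem_of_symmetric {S : Set (ConvexBody V)} (hcl : IsClosed S)
    (hseg : ∀ v, seg (-v) v ∈ S) (hadd : ∀ K ∈ S, ∀ L ∈ S, K + L ∈ S)
    (hcancel : ∀ K Z, Z ∈ S → K + Z ∈ S → K ∈ S) (L : ConvexBody V)
    (hL : ∀ x, L.supp (-x) = L.supp x) : L ∈ S := by
  let _ : MeasurableSpace V := borel V
  have _ : BorelSpace V := ⟨rfl⟩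
  set c := suppAverageConst V with hc
  have hc0 : 0 < c := suppAverageConst_pos
  -- Letting the noise level be proportional to ‖x‖ makes the average homogeneous of degree one, so
  -- that it is a support function.
  have happrox : ∀ ε : ℝ, 0 < ε → ∃ K ∈ S, ∀ x, K.supp x = c⁻¹ * L.suppAverage x (ε * ‖x‖) := by
    intro ε hε
    obtain ⟨C, hC0, hC⟩ := L.exists_abs_suppAverage_sub_le hL
    obtain ⟨R, hR0, hR⟩ := L.exists_norm_le
    have hsm : ∀ t : ℝ, 0 < t → ∀ x, c⁻¹ * L.suppAverage (t • x) (ε * ‖t • x‖) =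
        t * (c⁻¹ * L.suppAverage x (ε * ‖x‖)) := fun t ht x => by
      simp only [norm_smul, Real.norm_of_nonneg ht.le]
      rw [mul_left_comm, L.suppAverage_smul ht.le, mul_left_comm]
    have hsub : ∀ x y, c⁻¹ * L.suppAverage (x + y) (ε * ‖x + y‖) ≤
        c⁻¹ * L.suppAverage x (ε * ‖x‖) + c⁻¹ * L.suppAverage y (ε * ‖y‖) := fun x y => by
      rw [← mul_add]
      gcongr
      -- By monotonicity the noise level ε‖x + y‖ may be raised to ε‖x‖ + ε‖y‖, where joint
      -- subadditivity applies.
      refine (L.suppAverage_mono _ (by positivity) ?_).trans (L.suppAverage_add_le x y _ _)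
      rw [← mul_add]
      gcongr
      exact norm_add_le x y
    have hle : ∀ x, c⁻¹ * L.suppAverage x (ε * ‖x‖) ≤ c⁻¹ * (C * ε + c * R) * ‖x‖ := fun x => by
      have h1 := (abs_le.1 (hC x (ε * ‖x‖))).2
      rw [abs_of_nonneg (by positivity)] at h1
      have h2 := (abs_le.1 (abs_supp_le hR x)).2
      rw [mul_assoc]
      gcongr
      nlinarith
    obtain ⟨K, hK, -⟩ := exists_supp_eq (fun x => c⁻¹ * L.suppAverage x (ε * ‖x‖)) hsm hsub hle
    refine ⟨K, ?_, hK⟩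
    obtain ⟨q, hq, hqn, hqx⟩ := L.exists_suppAverage_eq_cosine hε
    refine mem_of_supp_eq_integral hcl hseg hadd hcancel (hq.const_mul c⁻¹)
      ((hqn.const_mul c⁻¹).congr (Filter.Eventually.of_forall fun u => by simp only; ring))
      K fun x => ?_
    rw [hK]
    have e : ∀ u, |inner ℝ x u| * (c⁻¹ * q u) = c⁻¹ * (|inner ℝ x u| * q u) := fun u => by ring
    simp_rw [e]
    rw [integral_const_mul]
    congr 1
    by_cases hx : x = 0
    · have h0 := L.suppAverage_smul le_rfl 0 0
      simp only [smul_zero, mul_zero, zero_mul] at h0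
      simp [hx, h0]
    · have hn : ‖x‖ ≠ 0 := norm_ne_zero_iff.2 hx
      have h1 : ‖‖x‖⁻¹ • x‖ = 1 := norm_smul_inv_norm hx
      have h2 := L.suppAverage_smul (norm_nonneg x) (‖x‖⁻¹ • x) ε
      rw [smul_inv_smul₀ hn, mul_comm ‖x‖ ε, hqx _ h1, ← integral_const_mul] at h2
      rw [h2]
      congr 1
      funext u
      rw [real_inner_smul_left, abs_mul, abs_of_nonneg (inv_nonneg.2 (norm_nonneg x))]
      field_simp
  rw [← hcl.closure_eq, Metric.mem_closure_iff]
  intro δ hδ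
  obtain ⟨C, hC0, hC⟩ := L.exists_abs_suppAverage_sub_le hL
  obtain ⟨ε, hε, hεδ⟩ : ∃ ε : ℝ, 0 < ε ∧ c⁻¹ * (C * ε) < δ := by
    refine ⟨c * δ / (C + 1), by positivity, ?_⟩
    rw [mul_div_assoc', mul_div_assoc', div_lt_iff₀ (by positivity)]
    field_simp
    linarith
  obtain ⟨K, hKS, hK⟩ := happrox ε hε
  refine ⟨K, hKS, lt_of_le_of_lt (dist_le_of_supp (by positivity) fun x => ?_) hεδ⟩
  have h1 := hC x (ε * ‖x‖)
  rw [abs_of_nonneg (by positivity : 0 ≤ ε * ‖x‖), abs_sub_comm] at h1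
  have h2 : L.supp x - K.supp x = c⁻¹ * (c * L.supp x - L.suppAverage x (ε * ‖x‖)) := by
    rw [hK]; field_simp
  rw [h2, abs_mul, abs_of_pos (inv_pos.2 hc0), mul_assoc, mul_assoc]
  gcongr

end ConvexBody

/-! ### Polytopes: density, and dissection into pyramids and simplices -/

namespace ConvexBody

variable {V : Type*} [NormedAddCommGroup V] [InnerProductSpace ℝ V] [FiniteDimensional ℝ V]

theorem isLinearMap_inner (u : V) : IsLinearMap ℝ fun x : V => inner ℝ u x :=
  ⟨fun a b => inner_add_right u a b, fun c a => by simp [inner_smul_right]⟩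

/-- A convex body that is a finite intersection of closed half-spaces. -/
def IsPolytope (K : ConvexBody V) : Prop :=
  ∃ s : Finset (V × ℝ), (K : Set V) = {x | ∀ p ∈ s, inner ℝ p.1 x ≤ p.2}

/-- Polytopes are dense among convex bodies. -/
theorem exists_isPolytope_dist_le (K : ConvexBody V) {ε : ℝ} (hε : 0 < ε) :
    ∃ P : ConvexBody V, IsPolytope P ∧ dist P K ≤ ε := by
  obtain ⟨R, hR0, hR⟩ := K.exists_norm_le
  have hbd : ∀ x : V, Metric.infDist x K ≤ ε → ‖x‖ ≤ R + ε := fun x hx => by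
    obtain ⟨z, hz, e⟩ := K.isCompact.exists_infDist_eq_dist K.nonempty x
    rw [e, dist_eq_norm] at hx
    linarith [hR z hz, norm_le_norm_add_norm_sub z x, norm_sub_rev z x]
  -- This compact shell around K is covered by finitely many open half-spaces disjoint from K; the
  -- complementary closed half-spaces cut out the polytope.
  set T : Set V := {x | Metric.infDist x K = ε} with hT
  have hTc : IsCompact T := by
    refine Metric.isCompact_of_isClosed_isBounded
      (isClosed_eq (Metric.continuous_infDist_pt _) continuous_const) ?_
    refine (Metric.isBounded_closedBall (x := (0 : V)) (r := R + ε)).subset fun x hx => ?_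
    rw [mem_closedBall_zero_iff]
    exact hbd x (le_of_eq hx)
  have hsep : ∀ y ∈ T, ∃ p : V × ℝ, (∀ z ∈ K, inner ℝ p.1 z < p.2) ∧ p.2 < inner ℝ p.1 y := by
    intro y hy
    have hyK : y ∉ (K : Set V) := fun h => by
      have : Metric.infDist y K = ε := hy
      rw [Metric.infDist_zero_of_mem h] at this
      linarith
    obtain ⟨u, c, h1, h2⟩ := exists_inner_lt_of_notMem K.convex K.isClosed hyK
    exact ⟨(u, c), h1, h2⟩
  choose! p hp1 hp2 using hsep
  obtain ⟨t, htT, hcov⟩ := hTc.elim_nhds_subcover (fun y => {x | (p y).2 < inner ℝ (p y).1 x})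
    fun y hy => (isOpen_lt continuous_const (by fun_prop)).mem_nhds (hp2 y hy)
  classical
  set C : Set V := {x | ∀ q ∈ t.image p, inner ℝ q.1 x ≤ q.2} with hC
  have hCi : C = ⋂ q ∈ t.image p, {x | inner ℝ q.1 x ≤ q.2} := by ext; simp [hC]
  have hKC : (K : Set V) ⊆ C := by
    intro x hx q hq
    obtain ⟨y, hy, rfl⟩ := Finset.mem_image.1 hq
    exact (hp1 y (htT y hy) x hx).le
  have hCT : ∀ x ∈ C, x ∉ T := by
    intro x hx hxT
    obtain ⟨y, hy, hxy⟩ := Set.mem_iUnion₂.1 (hcov hxT)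
    exact absurd (hx _ (Finset.mem_image_of_mem p hy)) (not_le.2 hxy)
  have hCconv : Convex ℝ C := by
    rw [hCi]
    exact convex_iInter₂ fun q _ => convex_halfSpace_le (isLinearMap_inner q.1) _
  -- A point of C beyond the shell could be joined to K inside C, and the segment would cross the
  -- shell, which C avoids.
  have hClt : ∀ x ∈ C, Metric.infDist x K ≤ ε := by
    intro x hx
    by_contra! hlt
    obtain ⟨k, hk⟩ := K.nonempty
    obtain ⟨y, hy, e⟩ := (convex_segment k x).isPreconnected.intermediate_value
      (left_mem_segment ℝ k x) (right_mem_segment ℝ k x) (f := fun z => Metric.infDist z K)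
      (Metric.continuous_infDist_pt _).continuousOn
      (⟨by rw [Metric.infDist_zero_of_mem hk]; exact hε.le, hlt.le⟩ : ε ∈ Set.Icc _ _)
    exact hCT y (hCconv.segment_subset (hKC hk) hx hy) e
  let P : ConvexBody V :=
    { carrier := C
      convex' := hCconv
      isCompact' := by
        refine Metric.isCompact_of_isClosed_isBounded ?_ ?_
        · rw [hCi]
          exact isClosed_biInter fun q _ => isClosed_le (by fun_prop) continuous_const
        · refine (Metric.isBounded_closedBall (x := (0 : V)) (r := R + ε)).subset fun x hx => ?_
          rw [mem_closedBall_zero_iff]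
          exact hbd x (hClt x hx)
      nonempty' := K.nonempty.mono hKC }
  refine ⟨P, ⟨t.image p, rfl⟩, Metric.hausdorffDist_le_of_mem_dist hε.le (fun x hx => ?_)
    fun x hx => ⟨x, hKC hx, by simpa using hε.le⟩⟩
  obtain ⟨z, hz, e⟩ := K.isCompact.exists_infDist_eq_dist K.nonempty x
  exact ⟨z, hz, e ▸ hClt x hx⟩

theorem exists_hyperplane_of_interior_eq_empty {K : ConvexBody V}
    (h : interior (K : Set V) = ∅) : ∃ u : V, ∃ c : ℝ, u ≠ 0 ∧ ∀ x ∈ K, inner ℝ u x = c := by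
  have h1 : affineSpan ℝ (K : Set V) ≠ ⊤ := fun ht => by
    have := K.convex.interior_nonempty_iff_affineSpan_eq_top.2 ht
    rw [h] at this
    exact Set.not_nonempty_empty this
  obtain ⟨k, hk⟩ := K.nonempty
  have h2 : (affineSpan ℝ (K : Set V)).direction ≠ ⊤ := fun ht =>
    h1 ((AffineSubspace.direction_eq_top_iff_of_nonempty
      ⟨k, subset_affineSpan ℝ _ hk⟩).1 ht)
  have h3 : (affineSpan ℝ (K : Set V)).directionᗮ ≠ ⊥ := fun hb =>
    h2 (Submodule.orthogonal_eq_bot_iff.1 hb)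
  obtain ⟨u, hu, hu0⟩ := Submodule.exists_mem_ne_zero_of_ne_bot h3
  refine ⟨u, inner ℝ u k, hu0, fun x hx => ?_⟩
  have := Submodule.inner_left_of_mem_orthogonal
    (AffineSubspace.vsub_mem_direction (subset_affineSpan ℝ _ hx) (subset_affineSpan ℝ _ hk)) hu
  rw [vsub_eq_sub, inner_sub_right] at this
  linarith

/-- The part of `P` where `w` is maximal among the functionals in `W`. -/
def sector (P : ConvexBody V) (W : Finset V) (w : V) (h0 : (0 : V) ∈ P) : ConvexBody V :=
  P.inter {x | ∀ w' ∈ W, inner ℝ w' x ≤ inner ℝ w x}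
    (by
      have : {x : V | ∀ w' ∈ W, inner ℝ w' x ≤ inner ℝ w x} =
          ⋂ w' ∈ W, {x | inner ℝ (w' - w) x ≤ 0} := by ext; simp [inner_sub_left]
      rw [this]
      exact convex_iInter₂ fun q _ => convex_halfSpace_le (isLinearMap_inner _) _)
    (by
      have : {x : V | ∀ w' ∈ W, inner ℝ w' x ≤ inner ℝ w x} =
          ⋂ w' ∈ W, {x | inner ℝ w' x ≤ inner ℝ w x} := by ext; simp
      rw [this]
      exact isClosed_biInter fun q _ => isClosed_le (by fun_prop) (by fun_prop))
    ⟨0, h0, by simp⟩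

theorem mem_sector {P : ConvexBody V} {W : Finset V} {w : V} {h0 : (0 : V) ∈ P} {x : V} :
    x ∈ P.sector W w h0 ↔ x ∈ P ∧ ∀ w' ∈ W, inner ℝ w' x ≤ inner ℝ w x := Iff.rfl

theorem zero_mem_sector {P : ConvexBody V} {W : Finset V} {w : V} {h0 : (0 : V) ∈ P} :
    (0 : V) ∈ P.sector W w h0 := mem_sector.2 ⟨h0, by simp⟩

/-- Induction on the set of functionals. Adding a functional a cuts each old sector, that of w, by
the hyperplane where a and w agree. The pieces where w wins are the new sectors of w, and the pieces
where a wins are the old sectors of the new sector of a. -/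
theorem IsValuation.eq_sum_sector {μ : ConvexBody V → ℝ} (hμ : IsValuation μ) (hs : IsSimple μ)
    {W : Finset V} (hW : W.Nonempty) : ∀ (P : ConvexBody V) (h0 : (0 : V) ∈ P),
    μ P = ∑ w ∈ W, μ (P.sector W w h0) := by
  classical
  induction hW using Finset.Nonempty.cons_induction with
  | singleton a =>
    intro P h0
    rw [Finset.sum_singleton]
    congr 1
    exact SetLike.ext fun x => by simp [mem_sector]
  | cons a W ha hW ih =>
    intro P h0
    rw [Finset.sum_cons, ih P h0, ih (P.sector (Finset.cons a W ha) a h0) zero_mem_sector,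
      ← Finset.sum_add_distrib]
    refine Finset.sum_congr rfl fun w hw => ?_
    rw [add_comm]
    refine hμ.cut hs (u := a - w) (c := 0) (sub_ne_zero.2 fun h => ha (h ▸ hw)) ?_ ?_
    · ext x
      simp only [SetLike.mem_coe, Set.mem_inter_iff, mem_sector, Finset.mem_cons,
        forall_eq_or_imp, Set.mem_ofPred_eq, inner_sub_left, sub_nonpos]
      tauto
    · ext x
      simp only [SetLike.mem_coe, Set.mem_inter_iff, mem_sector, Finset.mem_cons,
        forall_eq_or_imp, Set.mem_ofPred_eq, inner_sub_left, sub_nonneg, le_refl, true_and]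
      constructor
      · rintro ⟨⟨hx, h1⟩, h2⟩
        exact ⟨⟨hx, h2⟩, h1 w hw⟩
      · rintro ⟨⟨hx, h2⟩, h1⟩
        exact ⟨⟨hx, fun w' hw' => (h2 w' hw').trans h1⟩, h2⟩

theorem convex_image_add {H : Submodule ℝ V} (q : V) {s : Set H} (hs : Convex ℝ s) :
    Convex ℝ ((fun k : H => q + (k : V)) '' s) := by
  have : (fun k : H => q + (k : V)) '' s = q +ᵥ (H.subtype '' s) := by
    rw [← Set.image_vadd, Set.image_image]; rfl
  rw [this]
  exact (hs.linear_image H.subtype).vadd q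

theorem convexHull_insert_zero_eq {H : Submodule ℝ V} (q : V) (K : ConvexBody H) :
    convexHull ℝ (insert 0 ((fun k : H => q + (k : V)) '' K)) =
      (fun p : ℝ × H => p.1 • (q + (p.2 : V))) '' (Set.Icc 0 1 ×ˢ (K : Set H)) := by
  rw [convexHull_insert (K.nonempty.image _), (convex_image_add q K.convex).convexHull_eq]
  ext x
  simp only [mem_convexJoin, Set.mem_singleton_iff, exists_eq_left, Set.mem_image, Set.mem_prod,
    Set.mem_Icc, Prod.exists]
  constructor
  · rintro ⟨_, ⟨k, hk, rfl⟩, hx⟩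
    obtain ⟨t, h0, h1, rfl⟩ := mem_seg_zero.1 hx
    exact ⟨t, k, ⟨⟨h0, h1⟩, hk⟩, rfl⟩
  · rintro ⟨t, k, ⟨⟨h0, h1⟩, hk⟩, rfl⟩
    exact ⟨_, ⟨k, hk, rfl⟩, mem_seg_zero.2 ⟨t, h0, h1, rfl⟩⟩

/-- The pyramid with apex `0` over a convex body in the affine hyperplane `q + H`. -/
def pyramid {H : Submodule ℝ V} (q : V) (K : ConvexBody H) : ConvexBody V where
  carrier := convexHull ℝ (insert 0 ((fun k : H => q + (k : V)) '' K))
  convex' := convex_convexHull ℝ _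
  isCompact' := by
    rw [convexHull_insert_zero_eq]
    exact (isCompact_Icc.prod K.isCompact).image (by fun_prop)
  nonempty' := ⟨0, subset_convexHull ℝ _ (Set.mem_insert _ _)⟩

theorem mem_pyramid {H : Submodule ℝ V} {q : V} {K : ConvexBody H} {x : V} :
    x ∈ pyramid q K ↔ ∃ t : ℝ, 0 ≤ t ∧ t ≤ 1 ∧ ∃ k ∈ K, t • (q + (k : V)) = x := by
  change x ∈ convexHull ℝ (insert 0 ((fun k : H => q + (k : V)) '' K)) ↔ _
  rw [convexHull_insert_zero_eq]
  simp only [Set.mem_image, Set.mem_prod, Set.mem_Icc, Prod.exists, SetLike.mem_coe]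
  constructor
  · rintro ⟨t, k, ⟨⟨h0, h1⟩, hk⟩, rfl⟩
    exact ⟨t, h0, h1, k, hk, rfl⟩
  · rintro ⟨t, h0, h1, k, hk, rfl⟩
    exact ⟨t, k, ⟨⟨h0, h1⟩, hk⟩, rfl⟩

section Pyramid

variable {w q : V} {H : Submodule ℝ V}

theorem inner_smul_add_of_orthogonal (hwH : ∀ k : H, inner ℝ w (k : V) = 0)
    (hwq : inner ℝ w q = 1) (t : ℝ) (k : H) : inner ℝ w (t • (q + (k : V))) = t := by
  rw [inner_smul_right, inner_add_right, hwH, hwq]; ring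

/-- The functional w reads off the height t of a point, and above height zero the base point is
determined, so unions and intersections of bases pass to the pyramids. -/
theorem IsValuation.pyramid (hwH : ∀ k : H, inner ℝ w (k : V) = 0) (hwq : inner ℝ w q = 1)
    {μ : ConvexBody V → ℝ} (hμ : IsValuation μ) :
    IsValuation fun K : ConvexBody H => μ (pyramid q K) := by
  intro K L U I hU hI
  have hU' : ∀ x, x ∈ U ↔ x ∈ K ∨ x ∈ L := fun x => by
    rw [← SetLike.mem_coe, hU]; rfl
  have hI' : ∀ x, x ∈ I ↔ x ∈ K ∧ x ∈ L := fun x => by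
    rw [← SetLike.mem_coe, hI]; rfl
  refine hμ _ _ _ _ ?_ ?_
  · ext x
    simp only [SetLike.mem_coe, Set.mem_union, mem_pyramid]
    constructor
    · rintro ⟨t, h0, h1, k, hk, rfl⟩
      rcases (hU' k).1 hk with h | h
      · exact Or.inl ⟨t, h0, h1, k, h, rfl⟩
      · exact Or.inr ⟨t, h0, h1, k, h, rfl⟩
    · rintro (⟨t, h0, h1, k, hk, rfl⟩ | ⟨t, h0, h1, k, hk, rfl⟩)
      · exact ⟨t, h0, h1, k, (hU' k).2 (Or.inl hk), rfl⟩
      · exact ⟨t, h0, h1, k, (hU' k).2 (Or.inr hk), rfl⟩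
  · ext x
    simp only [SetLike.mem_coe, Set.mem_inter_iff, mem_pyramid]
    constructor
    · rintro ⟨t, h0, h1, k, hk, rfl⟩
      exact ⟨⟨t, h0, h1, k, ((hI' k).1 hk).1, rfl⟩, ⟨t, h0, h1, k, ((hI' k).1 hk).2, rfl⟩⟩
    · rintro ⟨⟨t, h0, h1, k, hk, rfl⟩, ⟨s, -, -, l, hl, e⟩⟩
      have hst : s = t := by
        have := congrArg (fun y => inner ℝ w y) e
        simpa only [inner_smul_add_of_orthogonal hwH hwq] using this
      subst hst
      rcases h0.eq_or_lt with rfl | h0'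
      · obtain ⟨i, hi⟩ := I.nonempty
        exact ⟨0, le_rfl, zero_le_one, i, hi, by simp⟩
      · have hkl : l = k := by
          have := smul_right_injective V h0'.ne' e
          exact Subtype.ext (add_left_cancel this)
        subst hkl
        exact ⟨s, h0, h1, l, (hI' l).2 ⟨hk, hl⟩, rfl⟩

/-- The pyramid over a base in the hyperplane ⟪u, k⟫ = c lies in the linear hyperplane orthogonal to
u - c w. -/
theorem IsSimple.pyramid (hwH : ∀ k : H, inner ℝ w (k : V) = 0) (hwq : inner ℝ w q = 1)
    {μ : ConvexBody V → ℝ} (hs : IsSimple μ)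
    (hqH : ∀ k : H, inner ℝ (k : V) q = 0) :
    IsSimple fun K : ConvexBody H => μ (pyramid q K) := by
  intro u c K hu hK
  refine hs ((u : V) - c • w) 0 _ (fun h => hu ?_) fun x hx => ?_
  · have h1 : (u : V) = c • w := sub_eq_zero.1 h
    have h2 : inner ℝ (u : V) (u : V) = 0 := by
      nth_rewrite 1 [h1]
      rw [real_inner_smul_left, hwH, mul_zero]
    exact Subtype.ext (inner_self_eq_zero.1 h2)
  · obtain ⟨t, -, -, k, hk, rfl⟩ := mem_pyramid.1 hx
    have h1 : inner ℝ (u : V) (k : V) = c := hK k hk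
    rw [inner_sub_left, real_inner_smul_left, inner_smul_add_of_orthogonal hwH hwq,
      inner_smul_right, inner_add_right, hqH, h1]
    ring

end Pyramid

theorem coe_pyramid_of_coe_eq {N : ℕ} {H : Submodule ℝ V} (q : V) {K : ConvexBody H}
    {p : Fin N → H} (hp : (K : Set H) = convexHull ℝ (Set.range p)) :
    (pyramid q K : Set V) =
      convexHull ℝ (Set.range (Fin.cons 0 fun i => q + (p i : V) : Fin (N + 1) → V)) := by
  change convexHull ℝ (insert 0 ((fun k : H => q + (k : V)) '' K)) = _
  rw [Fin.range_cons, hp]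
  refine Set.Subset.antisymm ?_ ?_
  · refine convexHull_min (Set.insert_subset (subset_convexHull ℝ _ (Set.mem_insert _ _)) ?_)
      (convex_convexHull ℝ _)
    rw [Set.image_subset_iff]
    refine convexHull_min ?_ ?_
    · rintro _ ⟨i, rfl⟩
      exact subset_convexHull ℝ _ (Set.mem_insert_of_mem _ ⟨i, rfl⟩)
    · intro a ha b hb s t hs ht hst
      have := convex_convexHull ℝ (insert 0 (Set.range fun i => q + (p i : V))) ha hb hs ht hst
      rw [Set.mem_preimage]
      convert this using 1
      simp only [smul_add, Submodule.coe_add, Submodule.coe_smul]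
      nth_rewrite 1 [← one_smul ℝ q]
      rw [← hst, add_smul]
      abel
  · refine convexHull_mono (Set.insert_subset_insert ?_)
    rintro _ ⟨i, rfl⟩
    exact ⟨p i, subset_convexHull ℝ _ ⟨i, rfl⟩, rfl⟩

/-- The whole ray through such an x would lie in P, which is bounded. -/
theorem eq_zero_of_forall_inner_nonpos {P : ConvexBody V} {W : Finset V}
    (hP : (P : Set V) = {x | ∀ w ∈ W, inner ℝ w x ≤ 1}) {x : V}
    (hx : ∀ w ∈ W, inner ℝ w x ≤ 0) : x = 0 := by
  by_contra h0
  have hn := norm_pos_iff.2 h0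
  obtain ⟨R, hR0, hR⟩ := P.exists_norm_le
  have hmem : ((R + 1) / ‖x‖) • x ∈ P := by
    rw [← SetLike.mem_coe, hP]
    intro w hw
    rw [inner_smul_right]
    exact (mul_nonpos_of_nonneg_of_nonpos (by positivity) (hx w hw)).trans zero_le_one
  have := hR _ hmem
  rw [norm_smul, Real.norm_of_nonneg (by positivity), div_mul_cancel₀ _ hn.ne'] at this
  linarith

/-- The sectors of a polytope are pyramids over its facets. -/
theorem exists_sector_eq_pyramid {P : ConvexBody V} {W : Finset V}
    (hP : (P : Set V) = {x | ∀ w ∈ W, inner ℝ w x ≤ 1}) (h0 : (0 : V) ∈ P) (h0W : (0 : V) ∈ W)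
    {w : V} (hw : w ∈ W) (hne : ∃ x ∈ P, inner ℝ w x = 1) :
    ∃ F : ConvexBody (Submodule.span ℝ {w})ᗮ, IsPolytope F ∧
      P.sector W w h0 = pyramid ((‖w‖ ^ 2)⁻¹ • w) F := by
  classical
  set H := (Submodule.span ℝ {w})ᗮ with hH
  set q := (‖w‖ ^ 2)⁻¹ • w with hq
  have hmem : ∀ x, x ∈ P ↔ ∀ w ∈ W, inner ℝ w x ≤ 1 := fun x => by
    rw [← SetLike.mem_coe, hP]; rfl
  obtain ⟨x₀, hx₀P, hx₀⟩ := hne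
  have hw0 : w ≠ 0 := by rintro rfl; simp at hx₀
  have hn := norm_pos_iff.2 hw0
  have hwH : ∀ k : H, inner ℝ w (k : V) = 0 := fun k =>
    Submodule.mem_orthogonal_singleton_iff_inner_right.1 k.2
  have hwq : inner ℝ w q = 1 := by
    rw [hq, inner_smul_right, real_inner_self_eq_norm_sq, inv_mul_cancel₀ (by positivity)]
  have hHmem : ∀ x, inner ℝ w x = 1 → x - q ∈ H := fun x hx =>
    Submodule.mem_orthogonal_singleton_iff_inner_right.2 (by rw [inner_sub_right, hx, hwq, sub_self])
  let F : ConvexBody H :=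
    { carrier := (fun k : H => q + (k : V)) ⁻¹' P
      convex' := fun a ha b hb s t hs ht hst => by
        have := P.convex ha hb hs ht hst
        rw [Set.mem_preimage]
        convert this using 1
        simp only [smul_add, Submodule.coe_add, Submodule.coe_smul]
        nth_rewrite 1 [← one_smul ℝ q]
        rw [← hst, add_smul]
        abel
      isCompact' := by
        obtain ⟨R, hR0, hR⟩ := P.exists_norm_le
        refine Metric.isCompact_of_isClosed_isBounded (P.isClosed.preimage (by fun_prop)) ?_
        refine (Metric.isBounded_closedBall (x := (0 : H)) (r := R + ‖q‖)).subset fun k hk => ?_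
        rw [mem_closedBall_zero_iff, Submodule.coe_norm]
        have h1 := norm_sub_le (q + (k : V)) q
        rw [add_sub_cancel_left] at h1
        linarith [hR _ hk]
      nonempty' := ⟨⟨x₀ - q, hHmem x₀ hx₀⟩, by
        rw [Set.mem_preimage, add_sub_cancel]; exact hx₀P⟩ }
  have hF : ∀ k : H, k ∈ F ↔ q + (k : V) ∈ P := fun k => Iff.rfl
  refine ⟨F, ⟨W.image fun w' => (H.orthogonalProjectionOnto w', 1 - inner ℝ w' q), ?_⟩, ?_⟩
  · ext k
    rw [SetLike.mem_coe, hF, hmem]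
    simp only [Finset.mem_image, Set.mem_ofPred_eq, forall_exists_index, and_imp,
      forall_apply_eq_imp_iff₂]
    refine forall₂_congr fun w' _ => ?_
    rw [inner_add_right, Submodule.inner_orthogonalProjectionOnto_eq_of_mem_right, le_sub_iff_add_le']
  · refine SetLike.ext fun x => ?_
    rw [mem_sector, mem_pyramid]
    constructor
    · rintro ⟨hxP, hx⟩
      have hl0 : 0 ≤ inner ℝ w x := by simpa using hx 0 h0W
      rcases hl0.eq_or_lt with h | h
      · have hx0 : x = 0 := eq_zero_of_forall_inner_nonpos hP fun w' hw' => by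
          rw [h]; exact hx w' hw'
        obtain ⟨k, hk⟩ := F.nonempty
        exact ⟨0, le_rfl, zero_le_one, k, hk, by rw [hx0, zero_smul]⟩
      · set l := inner ℝ w x with hl
        have h1 : inner ℝ w (l⁻¹ • x) = 1 := by
          rw [inner_smul_right, ← hl, inv_mul_cancel₀ h.ne']
        -- Dividing x by its height l stays in P, because w is the largest functional at x, and
        -- lands on the facet where w equals 1.
        refine ⟨l, hl0, (hmem x).1 hxP w hw, ⟨l⁻¹ • x - q, hHmem _ h1⟩, ?_, ?_⟩
        · rw [hF, hmem]
          intro w' hw'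
          rw [add_sub_cancel, inner_smul_right, inv_mul_le_iff₀ h, mul_one]
          exact hx w' hw'
        · rw [add_sub_cancel, smul_inv_smul₀ h.ne']
    · rintro ⟨t, ht0, ht1, k, hk, rfl⟩
      have hk' := (hF k).1 hk
      refine ⟨P.convex.smul_mem_of_zero_mem h0 hk' ⟨ht0, ht1⟩, fun w' hw' => ?_⟩
      rw [inner_smul_add_of_orthogonal hwH hwq, inner_smul_right]
      exact mul_le_of_le_one_right ht0 ((hmem _).1 hk' w' hw')

theorem IsSimple.add_pt {μ : ConvexBody V → ℝ} (hs : IsSimple μ) (a : V) :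
    IsSimple fun K => μ (K + pt a) := by
  intro u c K hu hK
  refine hs u (c + inner ℝ u a) _ hu fun x hx => ?_
  have := hK _ (mem_add_pt.1 hx)
  rw [inner_sub_right] at this
  linarith

theorem IsValuation.add_pt {μ : ConvexBody V → ℝ} (hμ : IsValuation μ) (a : V) :
    IsValuation fun K => μ (K + pt a) := by
  intro K L U I hU hI
  refine hμ _ _ _ _ ?_ ?_
  · simp only [coe_add_pt, hU, Set.vadd_set_union]
  · simp only [coe_add_pt, hI, Set.vadd_set_inter]

/-- A polytope with `0` in its interior, in normalized form. -/
theorem IsPolytope.exists_normalized {P : ConvexBody V} (hP : IsPolytope P) {o : V}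
    (ho : o ∈ interior (P : Set V)) :
    ∃ W : Finset V, (0 : V) ∈ W ∧ ((P + pt (-o) : ConvexBody V) : Set V) =
      {x | ∀ w ∈ W, inner ℝ w x ≤ 1} := by
  classical
  obtain ⟨s, hs⟩ := hP
  have hmem : ∀ x, x ∈ P ↔ ∀ p ∈ s, inner ℝ p.1 x ≤ p.2 := fun x => by
    rw [← SetLike.mem_coe, hs]; rfl
  refine ⟨insert 0 (s.image fun p => (p.2 - inner ℝ p.1 o)⁻¹ • p.1), Finset.mem_insert_self _ _, ?_⟩
  ext x
  rw [SetLike.mem_coe, mem_add_pt, sub_neg_eq_add, hmem]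
  simp only [Finset.mem_insert, Finset.mem_image, Set.mem_ofPred_eq, forall_eq_or_imp,
    inner_zero_left, zero_le_one, true_and, forall_exists_index, and_imp, forall_apply_eq_imp_iff₂]
  refine forall₂_congr fun p hp => ?_
  have h0 : inner ℝ p.1 o ≤ p.2 := (hmem o).1 (interior_subset ho) p hp
  rw [real_inner_smul_left, inner_add_right]
  rcases h0.eq_or_lt with h | h
  -- A constraint that is tight at an interior point must be trivial, since a small move along its
  -- normal would violate it.
  · have hp1 : p.1 = 0 := by
      by_contra hne
      obtain ⟨r, hr, hb⟩ := Metric.nhds_basis_closedBall.mem_iff.1 (mem_interior_iff_mem_nhds.1 ho)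
      have hn := norm_pos_iff.2 hne
      have hy : o + (r / ‖p.1‖) • p.1 ∈ P := hb (by
        rw [Metric.mem_closedBall, dist_self_add_left, norm_smul, norm_div, norm_norm,
          div_mul_cancel₀ _ hn.ne', Real.norm_of_nonneg hr.le])
      have := (hmem _).1 hy p hp
      rw [inner_add_right, inner_smul_right, real_inner_self_eq_norm_sq, h] at this
      have : 0 < r / ‖p.1‖ * ‖p.1‖ ^ 2 := by positivity
      linarith
    rw [hp1] at h ⊢
    simp only [inner_zero_left] at h ⊢
    simp [← h]
  · have hd : 0 < p.2 - inner ℝ p.1 o := by linarith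
    rw [inv_mul_le_iff₀ hd, mul_one, le_sub_iff_add_le]

/-- A simple valuation that vanishes on simplices vanishes on polytopes. -/
theorem IsValuation.eq_zero_of_isPolytope (N : ℕ) : ∀ {V : Type*} [NormedAddCommGroup V]
    [InnerProductSpace ℝ V] [FiniteDimensional ℝ V], Module.finrank ℝ V = N →
    ∀ {μ : ConvexBody V → ℝ}, IsValuation μ → IsSimple μ →
    (∀ (p : Fin (N + 1) → V) (K : ConvexBody V), (K : Set V) = convexHull ℝ (Set.range p) →
      μ K = 0) → ∀ P : ConvexBody V, IsPolytope P → μ P = 0 := by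
  induction N with
  | zero =>
    intro V _ _ _ hV μ _ _ hsx P _
    have : Subsingleton V := Module.finrank_zero_iff.1 hV
    refine hsx (fun _ => 0) P ?_
    obtain ⟨x, hx⟩ := P.nonempty
    rw [Set.range_const, convexHull_singleton]
    ext y
    rw [Set.mem_singleton_iff, Subsingleton.elim x 0] at *
    exact ⟨fun _ => Subsingleton.elim _ _, fun h => h ▸ hx⟩
  | succ N ih =>
    intro V _ _ _ hV μ hμ hs hsx P hP
    by_cases hint : interior (P : Set V) = ∅
    · obtain ⟨u, c, hu, h⟩ := exists_hyperplane_of_interior_eq_empty hint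
      exact hs u c P hu h
    obtain ⟨o, ho⟩ := Set.nonempty_iff_ne_empty.2 hint
    obtain ⟨W, h0W, hW⟩ := hP.exists_normalized ho
    set Q := P + pt (-o) with hQ
    have h0 : (0 : V) ∈ Q := by
      rw [← SetLike.mem_coe, hW]; intro w _; simp
    have hμ' := hμ.add_pt o
    have hs' := hs.add_pt o
    have hPQ : μ P = μ (Q + pt o) := by rw [hQ, add_pt_neg_add_pt]
    rw [hPQ, hμ'.eq_sum_sector hs' ⟨0, h0W⟩ Q h0]
    refine Finset.sum_eq_zero fun w hw => ?_
    by_cases hne : ∃ x ∈ Q, inner ℝ w x = 1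
    · obtain ⟨F, hF, e⟩ := exists_sector_eq_pyramid hW h0 h0W hw hne
      have hw0 : w ≠ 0 := by
        rintro rfl
        obtain ⟨x, -, hx⟩ := hne
        simp at hx
      have hwH : ∀ k : (Submodule.span ℝ {w})ᗮ, inner ℝ w (k : V) = 0 := fun k =>
        Submodule.mem_orthogonal_singleton_iff_inner_right.1 k.2
      have hwq : inner ℝ w ((‖w‖ ^ 2)⁻¹ • w) = 1 := by
        have := norm_pos_iff.2 hw0
        rw [inner_smul_right, real_inner_self_eq_norm_sq, inv_mul_cancel₀ (by positivity)]
      have hdim : Module.finrank ℝ (Submodule.span ℝ {w})ᗮ = N := by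
        have h := (Submodule.span ℝ {w}).finrank_add_finrank_orthogonal
        rw [finrank_span_singleton hw0, hV] at h
        omega
      rw [e]
      -- The value on pyramids is a simple valuation of the base, one dimension lower; it vanishes
      -- on simplices because a pyramid over a simplex is a simplex.
      refine ih hdim (hμ'.pyramid hwH hwq) (hs'.pyramid hwH hwq fun k => ?_) (fun p K hK => ?_) F hF
      · rw [inner_smul_right, real_inner_comm, hwH, mul_zero]
      · refine hsx (fun i => (Fin.cons 0 fun i => (‖w‖ ^ 2)⁻¹ • w + (p i : V) :
          Fin (N + 1 + 1) → V) i + o) _ ?_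
        rw [coe_add_pt, coe_pyramid_of_coe_eq _ hK, ← convexHull_vadd]
        congr 1
        rw [← Set.image_vadd, ← Set.range_comp]
        congr 1
        funext i
        simp [add_comm]
    -- A redundant constraint: a point of its sector with ⟪w, x⟫ > 0 could be rescaled to a point of
    -- Q where w equals 1.
    · have hall : ∀ x ∈ Q.sector W w h0, x = 0 := by
        rintro x hx
        obtain ⟨hxQ, hx⟩ := mem_sector.1 hx
        refine eq_zero_of_forall_inner_nonpos hW fun w' hw' => (hx w' hw').trans ?_
        by_contra! hpos
        refine hne ⟨(inner ℝ w x)⁻¹ • x, ?_, ?_⟩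
        · rw [← SetLike.mem_coe, hW]
          intro w'' hw''
          rw [inner_smul_right, inv_mul_le_iff₀ hpos, mul_one]
          exact hx w'' hw''
        · rw [inner_smul_right, inv_mul_cancel₀ hpos.ne']
      have : Nontrivial V := Module.nontrivial_of_finrank_pos (R := ℝ) (by omega)
      obtain ⟨u, hu⟩ := exists_ne (0 : V)
      exact hs' u 0 _ hu fun x hx => by rw [hall x hx, inner_zero_right]

end ConvexBody

/-! ### Simple valuations: prisms, segments and symmetric bodies -/

namespace ConvexBody

variable {V : Type*} [NormedAddCommGroup V] [InnerProductSpace ℝ V] [FiniteDimensional ℝ V]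

/-- Even continuous simple translation-invariant valuations that are homogeneous of degree `m`
under dilation by `2`. -/
structure IsSimpleValuation (m : ℕ) (μ : ConvexBody V → ℝ) : Prop where
  valuation : IsValuation μ
  translation : IsTranslationInvariant μ
  simple : IsSimple μ
  continuous : Continuous μ
  even : ∀ K, μ ((-1 : ℝ) • K) = μ K
  two_smul : ∀ K, μ ((2 : ℝ) • K) = 2 ^ m * μ K

theorem IsSimple.zero [Nontrivial V] {μ : ConvexBody V → ℝ} (hs : IsSimple μ) : μ 0 = 0 := by
  obtain ⟨u, hu⟩ := exists_ne (0 : V)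
  exact hs u 0 0 hu fun x hx => by rw [mem_zero.1 hx, inner_zero_right]

theorem tendsto_pow_smul (K : ConvexBody V) :
    Filter.Tendsto (fun k : ℕ => ((1 / 2 : ℝ) ^ k) • K) Filter.atTop (nhds 0) := by
  obtain ⟨R, hR0, hR⟩ := K.exists_norm_le
  rw [tendsto_iff_dist_tendsto_zero]
  have h0 : Filter.Tendsto (fun k : ℕ => (1 / 2 : ℝ) ^ k * R) Filter.atTop (nhds 0) := by
    simpa using (tendsto_pow_atTop_nhds_zero_of_lt_one (by norm_num : (0 : ℝ) ≤ 1 / 2)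
      (by norm_num)).mul_const R
  refine squeeze_zero (fun _ => dist_nonneg) (fun k => ?_) h0
  refine dist_le_of_supp (by positivity) fun x => ?_
  rw [supp_smul (by positivity), supp_zero, sub_zero, abs_mul, abs_of_nonneg (by positivity),
    mul_assoc]
  exact mul_le_mul_of_nonneg_left (abs_supp_le hR x) (by positivity)

/-- Halving repeatedly shrinks K to the origin without changing the value, and a simple valuation
vanishes at a point. -/
theorem IsSimpleValuation.eq_zero_of_degree_zero [Nontrivial V] {μ : ConvexBody V → ℝ}
    (hμ : IsSimpleValuation 0 μ) (K : ConvexBody V) : μ K = 0 := by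
  have h : ∀ k : ℕ, μ (((1 / 2 : ℝ) ^ k) • K) = μ K := by
    intro k
    induction k with
    | zero => simp
    | succ k ih =>
      rw [← ih, ← one_mul (μ ((1 / 2 : ℝ) ^ (k + 1) • K)), ← pow_zero (2 : ℝ), ← hμ.two_smul,
        smul_smul]
      congr 2
      rw [pow_succ]; ring
  have h1 := (hμ.continuous.tendsto 0).comp (tendsto_pow_smul K)
  have h2 : (μ ∘ fun k : ℕ => ((1 / 2 : ℝ) ^ k) • K) = fun _ => μ K := funext h
  rw [h2, hμ.simple.zero] at h1
  exact tendsto_nhds_unique tendsto_const_nhds h1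

/-- The degree drops by one because the doubled prism consists of two stacked prisms over the
doubled base. The base itself, where the two overlap, has value zero. -/
theorem IsSimpleValuation.prism {m : ℕ} {μ : ConvexBody V → ℝ} (hμ : IsSimpleValuation (m + 1) μ)
    {H : Submodule ℝ V} {w : V} (hw : w ≠ 0) (hwH : ∀ k : H, inner ℝ w (k : V) = 0) :
    IsSimpleValuation m fun K : ConvexBody H => μ (map H.subtype K + seg 0 w) := by
  have hww : inner ℝ w w ≠ 0 := fun h => hw (inner_self_eq_zero.1 h)
  have hmem : ∀ (K : ConvexBody H) (x : V), x ∈ map H.subtype K + seg 0 w ↔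
      ∃ k ∈ K, ∃ t : ℝ, (0 ≤ t ∧ t ≤ 1) ∧ (k : V) + t • w = x := fun K x => by
    rw [mem_add]
    constructor
    · rintro ⟨_, ⟨k, hk, rfl⟩, z, hz, rfl⟩
      obtain ⟨t, h0, h1, rfl⟩ := mem_seg_zero.1 hz
      exact ⟨k, hk, t, ⟨h0, h1⟩, rfl⟩
    · rintro ⟨k, hk, t, ⟨h0, h1⟩, rfl⟩
      exact ⟨_, ⟨k, hk, rfl⟩, _, mem_seg_zero.2 ⟨t, h0, h1, rfl⟩, rfl⟩
  refine ⟨fun K L U I hU hI => ?_, fun K a => ?_, fun u c K hu hK => ?_, ?_, fun K => ?_,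
    fun K => ?_⟩
  · have hU' : ∀ x, x ∈ U ↔ x ∈ K ∨ x ∈ L := fun x => by
      rw [← SetLike.mem_coe, hU]; rfl
    have hI' : ∀ x, x ∈ I ↔ x ∈ K ∧ x ∈ L := fun x => by
      rw [← SetLike.mem_coe, hI]; rfl
    refine hμ.valuation _ _ _ _ ?_ ?_
    · ext x
      simp only [SetLike.mem_coe, Set.mem_union, hmem, hU']
      constructor
      · rintro ⟨k, h | h, t, ht, e⟩
        · exact Or.inl ⟨k, h, t, ht, e⟩
        · exact Or.inr ⟨k, h, t, ht, e⟩
      · rintro (⟨k, h, t, ht, e⟩ | ⟨k, h, t, ht, e⟩)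
        · exact ⟨k, Or.inl h, t, ht, e⟩
        · exact ⟨k, Or.inr h, t, ht, e⟩
    · ext x
      simp only [SetLike.mem_coe, Set.mem_inter_iff, hmem, hI']
      constructor
      · rintro ⟨k, ⟨h1, h2⟩, t, ht, e⟩
        exact ⟨⟨k, h1, t, ht, e⟩, ⟨k, h2, t, ht, e⟩⟩
      · rintro ⟨⟨k, hk, t, ht, rfl⟩, ⟨l, hl, s, hs, e⟩⟩
        have hst : s = t := by
          have := congrArg (fun y => inner ℝ w y) e
          simp only [inner_add_right, hwH, inner_smul_right, zero_add] at this
          exact mul_right_cancel₀ hww this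
        subst hst
        have hkl : l = k := Subtype.ext (add_right_cancel e)
        exact ⟨k, ⟨hk, hkl ▸ hl⟩, s, ht, rfl⟩
  · change μ (map H.subtype (K + pt a) + seg 0 w) = μ (map H.subtype K + seg 0 w)
    rw [map_add, map_pt, add_right_comm, hμ.translation]
  · refine hμ.simple u c _ (fun h => hu (Subtype.ext h)) fun x hx => ?_
    obtain ⟨k, hk, t, -, rfl⟩ := (hmem K x).1 hx
    have h1 : inner ℝ (u : V) (k : V) = c := hK k hk
    rw [inner_add_right, inner_smul_right, h1, real_inner_comm, hwH, mul_zero, add_zero]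
  · exact hμ.continuous.comp ((continuous_add_right _).comp (continuous_map _))
  · change μ (map H.subtype ((-1 : ℝ) • K) + seg 0 w) = μ (map H.subtype K + seg 0 w)
    -- Reflecting the prism over K gives the prism over -K up to a translation by w.
    rw [← hμ.even (map H.subtype K + seg 0 w), ← hμ.translation ((-1 : ℝ) • _) w]
    congr 1
    refine ext_supp fun x => ?_
    simp only [supp_add, supp_map, supp_neg_one_smul, supp_seg, supp_pt, inner_zero_right,
      inner_neg_left, map_neg, add_assoc, ← max_add_add_right, zero_add, neg_add_cancel]
    rw [max_comm]
  · change μ (map H.subtype ((2 : ℝ) • K) + seg 0 w) = 2 ^ m * μ (map H.subtype K + seg 0 w)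
    have h1 := hμ.valuation.add_seg hμ.translation (map H.subtype ((2 : ℝ) • K)) w
      zero_le_one zero_le_one
    have h2 : map H.subtype ((2 : ℝ) • K) + seg 0 (((1 : ℝ) + 1) • w) =
        (2 : ℝ) • (map H.subtype K + seg 0 w) := ext_supp fun x => by
      simp only [map_smul, supp_add, supp_smul zero_le_two, supp_seg, inner_zero_right,
        inner_smul_right, mul_add, mul_max_of_nonneg _ _ (zero_le_two (α := ℝ)), mul_zero]
      norm_num
    have h3 : μ (map H.subtype ((2 : ℝ) • K)) = 0 := by
      refine hμ.simple w 0 _ hw fun x hx => ?_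
      obtain ⟨k, -, rfl⟩ := mem_map.1 hx
      exact hwH k
    rw [h2, hμ.two_smul, h3, one_smul, pow_succ] at h1
    linarith

/-- Adding a long segment to a convex body has no effect if prisms have measure zero. -/
theorem IsSimpleValuation.add_long_seg {m : ℕ} {μ : ConvexBody V → ℝ}
    (hμ : IsSimpleValuation m μ) {v : V} (hv : v ≠ 0)
    (hprism : ∀ (K : ConvexBody (Submodule.span ℝ {v})ᗮ) (s : ℝ), 0 < s →
      μ (map (Submodule.span ℝ {v})ᗮ.subtype K + seg 0 (s • v)) = 0)
    (K : ConvexBody V) {ρ s t : ℝ} (hρ : ∀ k ∈ K, |inner ℝ v k| ≤ ρ) (hs : 0 < s) (ht : 0 ≤ t)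
    (hρt : 2 * ρ ≤ t * ‖v‖ ^ 2) :
    μ (K + seg 0 ((t + s) • v)) = μ (K + seg 0 (t • v)) := by
  have hn : 0 < ‖v‖ ^ 2 := by have := norm_pos_iff.2 hv; positivity
  have hvv : inner ℝ v v = ‖v‖ ^ 2 := real_inner_self_eq_norm_sq v
  set H := (Submodule.span ℝ {v})ᗮ with hH
  obtain ⟨k₀, hk₀⟩ := K.nonempty
  have hk₀' := abs_le.1 (hρ k₀ hk₀)
  have hle : ∀ c : ℝ, Convex ℝ {x : V | inner ℝ v x ≤ c} :=
    fun c => convex_halfSpace_le (isLinearMap_inner v) c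
  have hge : ∀ c : ℝ, Convex ℝ {x : V | c ≤ inner ℝ v x} :=
    fun c => convex_halfSpace_ge (isLinearMap_inner v) c
  have cle : ∀ c : ℝ, IsClosed {x : V | inner ℝ v x ≤ c} :=
    fun c => isClosed_le (by fun_prop) continuous_const
  have cge : ∀ c : ℝ, IsClosed {x : V | c ≤ inner ℝ v x} :=
    fun c => isClosed_le continuous_const (by fun_prop)
  have hinner : ∀ (k : V) (r : ℝ), inner ℝ v (k + r • v) = inner ℝ v k + r * ‖v‖ ^ 2 :=
    fun k r => by rw [inner_add_right, inner_smul_right, hvv]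
  set C := K + seg 0 (t • v) with hC
  set D := K + seg 0 ((t + s) • v) with hD
  have hCm : ∀ x, x ∈ C ↔ ∃ k ∈ K, ∃ r : ℝ, 0 ≤ r ∧ r ≤ t ∧ k + r • v = x :=
    fun x => mem_add_seg ht
  have hDm : ∀ x, x ∈ D ↔ ∃ k ∈ K, ∃ r : ℝ, 0 ≤ r ∧ r ≤ t + s ∧ k + r • v = x :=
    fun x => mem_add_seg (by linarith)
  -- Cut at height ρ, above all of K. Below ρ the bodies C and D agree, because t v already climbs
  -- 2ρ; call this part A. The rest of D is a prism M over the projection of K, of height s‖v‖²,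
  -- followed by a translate of the rest B of C.
  let A := C.inter {x | inner ℝ v x ≤ ρ} (hle ρ) (cle ρ)
    ⟨k₀, (hCm _).2 ⟨k₀, hk₀, 0, le_rfl, ht, by simp⟩, hk₀'.2⟩
  let B := C.inter {x | ρ ≤ inner ℝ v x} (hge ρ) (cge ρ)
    ⟨k₀ + t • v, (hCm _).2 ⟨k₀, hk₀, t, ht, le_rfl, rfl⟩, by
      rw [Set.mem_ofPred_eq, hinner]; linarith⟩
  let E := D.inter {x | ρ ≤ inner ℝ v x} (hge ρ) (cge ρ)
    ⟨k₀ + t • v, (hDm _).2 ⟨k₀, hk₀, t, ht, by linarith, rfl⟩, by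
      rw [Set.mem_ofPred_eq, hinner]; linarith⟩
  let M := map H.subtype (map (H.orthogonalProjectionOnto : V →ₗ[ℝ] H) K) + seg 0 (s • v)
    + pt ((ρ / ‖v‖ ^ 2) • v)
  have hdec : ∀ k : V, ((H.orthogonalProjectionOnto k : H) : V) + (inner ℝ v k / ‖v‖ ^ 2) • v = k := by
    intro k
    have h1 := Submodule.starProjection_add_starProjection_orthogonal (K := Submodule.span ℝ {v}) k
    rw [Submodule.starProjection_singleton] at h1
    rw [add_comm]
    exact h1
  have hMm : ∀ x, x ∈ M ↔ ∃ k ∈ K, ∃ r : ℝ, 0 ≤ r ∧ r ≤ s ∧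
      ((H.orthogonalProjectionOnto k : H) : V) + r • v + (ρ / ‖v‖ ^ 2) • v = x := by
    intro x
    rw [mem_add_pt, mem_add_seg hs.le]
    constructor
    · rintro ⟨_, ⟨_, ⟨k, hk, rfl⟩, rfl⟩, r, h0, h1, e⟩
      exact ⟨k, hk, r, h0, h1, by rw [← eq_sub_iff_add_eq]; exact e⟩
    · rintro ⟨k, hk, r, h0, h1, e⟩
      exact ⟨_, ⟨_, ⟨k, hk, rfl⟩, rfl⟩, r, h0, h1, by rw [eq_sub_iff_add_eq]; exact e⟩
  have e1 : μ C = μ A + μ B := hμ.valuation.cut hμ.simple hv rfl rfl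
  have e2 : μ D = μ A + μ E := by
    refine hμ.valuation.cut hμ.simple hv (c := ρ) ?_ rfl
    ext x
    change x ∈ C ∧ inner ℝ v x ≤ ρ ↔ x ∈ D ∧ inner ℝ v x ≤ ρ
    rw [hCm, hDm]
    constructor
    · rintro ⟨⟨k, hk, r, h0, h1, e⟩, h⟩
      exact ⟨⟨k, hk, r, h0, by linarith, e⟩, h⟩
    · rintro ⟨⟨k, hk, r, h0, h1, rfl⟩, h⟩
      refine ⟨⟨k, hk, r, h0, ?_, rfl⟩, h⟩
      rw [hinner] at h
      have := (abs_le.1 (hρ k hk)).1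
      exact le_of_mul_le_mul_right (by linarith) hn
  have e3 : μ E = μ M + μ (B + pt (s • v)) := by
    refine hμ.valuation.cut hμ.simple hv (c := ρ + s * ‖v‖ ^ 2) ?_ ?_
    · ext x
      change x ∈ M ↔ (x ∈ D ∧ ρ ≤ inner ℝ v x) ∧ inner ℝ v x ≤ ρ + s * ‖v‖ ^ 2
      rw [hMm, hDm]
      constructor
      · rintro ⟨k, hk, r, h0, h1, rfl⟩
        have hk' := abs_le.1 (hρ k hk)
        have e : ((H.orthogonalProjectionOnto k : H) : V) + r • v + (ρ / ‖v‖ ^ 2) • v =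
            k + (r + ρ / ‖v‖ ^ 2 - inner ℝ v k / ‖v‖ ^ 2) • v := by
          rw [eq_sub_of_add_eq (hdec k)]
          module
        have hr : (r + ρ / ‖v‖ ^ 2 - inner ℝ v k / ‖v‖ ^ 2) * ‖v‖ ^ 2 =
            r * ‖v‖ ^ 2 + ρ - inner ℝ v k := by field_simp
        have hr1 : r * ‖v‖ ^ 2 ≤ s * ‖v‖ ^ 2 := by gcongr
        have hr0 : 0 ≤ r * ‖v‖ ^ 2 := by positivity
        rw [e, hinner, hr]
        refine ⟨⟨⟨k, hk, _, ?_, ?_, rfl⟩, by linarith⟩, by linarith⟩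
        · refine nonneg_of_mul_nonneg_left (?_ : 0 ≤ _ * ‖v‖ ^ 2) hn
          rw [hr]; linarith
        · refine le_of_mul_le_mul_right ?_ hn
          rw [hr]; linarith
      · rintro ⟨⟨⟨k, hk, r, h0, h1, rfl⟩, h2⟩, h3⟩
        rw [hinner] at h2 h3
        have hr : (r + inner ℝ v k / ‖v‖ ^ 2 - ρ / ‖v‖ ^ 2) * ‖v‖ ^ 2 =
            r * ‖v‖ ^ 2 + inner ℝ v k - ρ := by field_simp
        refine ⟨k, hk, r + inner ℝ v k / ‖v‖ ^ 2 - ρ / ‖v‖ ^ 2, ?_, ?_, ?_⟩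
        · refine nonneg_of_mul_nonneg_left (?_ : 0 ≤ _ * ‖v‖ ^ 2) hn
          rw [hr]; linarith
        · refine le_of_mul_le_mul_right ?_ hn
          rw [hr]; linarith
        · rw [eq_sub_of_add_eq (hdec k)]
          module
    · ext x
      change x ∈ B + pt (s • v) ↔ (x ∈ D ∧ ρ ≤ inner ℝ v x) ∧ ρ + s * ‖v‖ ^ 2 ≤ inner ℝ v x
      rw [mem_add_pt]
      change x - s • v ∈ C ∧ ρ ≤ inner ℝ v (x - s • v) ↔ _
      rw [hCm, hDm, inner_sub_right, inner_smul_right, hvv]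
      have hsn : 0 < s * ‖v‖ ^ 2 := by positivity
      constructor
      · rintro ⟨⟨k, hk, r, h0, h1, e⟩, h⟩
        refine ⟨⟨⟨k, hk, r + s, by linarith, by linarith, ?_⟩, by linarith⟩, by linarith⟩
        rw [add_smul, ← add_assoc, e, sub_add_cancel]
      · rintro ⟨⟨⟨k, hk, r, h0, h1, rfl⟩, h2⟩, h3⟩
        refine ⟨⟨k, hk, r - s, ?_, by linarith, by rw [sub_smul]; abel⟩, by linarith⟩
        rw [hinner] at h3
        have := (abs_le.1 (hρ k hk)).2
        exact sub_nonneg.2 (le_of_mul_le_mul_right (by linarith) hn)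
  have e4 : μ M = 0 := by rw [hμ.translation]; exact hprism _ s hs
  rw [e2, e3, e4, hμ.translation, e1, zero_add]

/-- The increment caused by the segment doubles with its length, yet for long segments it no longer
changes when the length doubles. Hence it is zero. -/
theorem IsSimpleValuation.add_seg_eq {m : ℕ} {μ : ConvexBody V → ℝ}
    (hμ : IsSimpleValuation m μ) {v : V} (hv : v ≠ 0)
    (hprism : ∀ (K : ConvexBody (Submodule.span ℝ {v})ᗮ) (s : ℝ), 0 < s →
      μ (map (Submodule.span ℝ {v})ᗮ.subtype K + seg 0 (s • v)) = 0)
    (K : ConvexBody V) : μ (K + seg 0 v) = μ K := by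
  obtain ⟨R, hR0, hR⟩ := K.exists_norm_le
  have hn := norm_pos_iff.2 hv
  have hG : ∀ k : ℕ, μ (K + seg 0 ((2 : ℝ) ^ k • v)) - μ K = 2 ^ k * (μ (K + seg 0 v) - μ K) := by
    intro k
    induction k with
    | zero => simp
    | succ k ih =>
      have := hμ.valuation.add_seg hμ.translation K v (s := 2 ^ k) (t := 2 ^ k) (by positivity)
        (by positivity)
      rw [← two_mul, ← pow_succ'] at this
      rw [pow_succ']
      rw [← pow_succ']
      rw [show (2 : ℝ) ^ (k + 1) * (μ (K + seg 0 v) - μ K) =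
        2 * (2 ^ k * (μ (K + seg 0 v) - μ K)) by ring, ← ih]
      linarith
  obtain ⟨k, hk⟩ := pow_unbounded_of_one_lt (2 * (R * ‖v‖) / ‖v‖ ^ 2) (one_lt_two (α := ℝ))
  have h := hμ.add_long_seg hv hprism K (ρ := R * ‖v‖) (s := 2 ^ k) (t := 2 ^ k)
    (fun x hx => by
      rw [mul_comm]
      exact (abs_real_inner_le_norm v x).trans (by gcongr; exact hR x hx))
    (by positivity) (by positivity) ((div_le_iff₀ (by positivity)).1 hk.le)
  have h1 := hG k
  have h2 := hG (k + 1)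
  rw [← two_mul, ← pow_succ'] at h
  rw [h, h1, pow_succ] at h2
  have h3 : (2 : ℝ) ^ k * (μ (K + seg 0 v) - μ K) = 0 := by linarith
  rcases mul_eq_zero.1 h3 with h | h
  · exact absurd h (by positivity)
  · linarith

/-- A simple valuation that is not affected by adding segments vanishes on symmetric bodies. -/
theorem IsSimpleValuation.eq_zero_of_symmetric [Nontrivial V] {m : ℕ} {μ : ConvexBody V → ℝ}
    (hμ : IsSimpleValuation m μ) (hseg : ∀ K (v : V), μ (K + seg 0 v) = μ K)
    {K : ConvexBody V} {b : V} (hK : ∀ x ∈ K, b - x ∈ K) : μ K = 0 := by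
  -- The bodies whose addition never changes μ form a closed class with the stability required by
  -- `mem_of_symmetric`. Centring K at the origin puts it in this class; then take M to be the
  -- origin.
  have key : K + pt (-((1 / 2 : ℝ) • b)) ∈ {L : ConvexBody V | ∀ M, μ (M + L) = μ M} := by
    refine mem_of_symmetric ?_ (fun v M => ?_) (fun L hL L' hL' M => ?_) (fun L Z hZ hLZ M => ?_)
      _ fun x => ?_
    · have : {L : ConvexBody V | ∀ M, μ (M + L) = μ M} = ⋂ M, {L | μ (M + L) = μ M} := by
        ext; simp
      rw [this]
      exact isClosed_iInter fun M =>
        isClosed_eq (hμ.continuous.comp (continuous_add_left M)) continuous_const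
    · rw [seg_eq_add_pt, ← add_assoc, hμ.translation, hseg]
    · rw [← add_assoc, hL', hL]
    · rw [← hZ, add_assoc, hLZ]
    · rw [supp_add, supp_add, supp_pt, supp_pt]
      have h : ∀ y : V, K.supp y ≤ inner ℝ y b + K.supp (-y) := fun y => supp_le_iff.2 fun z hz => by
        have := inner_le_supp (hK z hz) (-y)
        rw [inner_neg_left, inner_sub_right] at this
        linarith
      have h1 := h x
      have h2 := h (-x)
      simp only [neg_neg, inner_neg_left, inner_neg_right, inner_smul_right] at *
      linarith
  have h := key 0
  rw [zero_add, hμ.translation, hμ.simple.zero] at h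
  exact h

end ConvexBody

/-! ### Simplices, and vanishing of simple valuations of low degree -/

namespace ConvexBody

variable {V : Type*} [NormedAddCommGroup V] [InnerProductSpace ℝ V] [FiniteDimensional ℝ V]

/-- The convex body of points whose coordinates lie in a compact convex set. -/
def coordBody {N : ℕ} (B : Module.Basis (Fin N) ℝ V) (s : Set (Fin N → ℝ)) (hs : IsCompact s)
    (hc : Convex ℝ s) (hne : s.Nonempty) : ConvexBody V where
  carrier := {x | B.equivFun x ∈ s}
  convex' := hc.linear_preimage B.equivFun.toLinearMap
  isCompact' := by
    have : {x | B.equivFun x ∈ s} = B.equivFun.symm '' s := B.equivFun.image_symm_eq_preimage s |>.symm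
    rw [this]
    exact hs.image B.equivFun.symm.toLinearMap.continuous_of_finiteDimensional
  nonempty' := by
    obtain ⟨c, hc⟩ := hne
    exact ⟨B.equivFun.symm c, by rwa [Set.mem_ofPred_eq, LinearEquiv.apply_symm_apply]⟩

theorem convexHull_range_eq_of_basis {N : ℕ} (B : Module.Basis (Fin N) ℝ V) (p : Fin (N + 1) → V)
    (hp : ∀ i, B i = p i.succ - p 0) (x : V) :
    x + p 0 ∈ convexHull ℝ (Set.range p) ↔
      (∀ i, 0 ≤ B.equivFun x i) ∧ ∑ i, B.equivFun x i ≤ 1 := by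
  constructor
  · intro hx
    have hc : Convex ℝ {y : V | (∀ i, 0 ≤ B.equivFun (y - p 0) i) ∧
        ∑ i, B.equivFun (y - p 0) i ≤ 1} := by
      intro a ha b hb s t hs ht hst
      have e : s • a + t • b - p 0 = s • (a - p 0) + t • (b - p 0) := by
        rw [smul_sub, smul_sub, ← sub_eq_zero]
        nth_rewrite 1 [← one_smul ℝ (p 0)]
        rw [← hst, add_smul]; abel
      simp only [Set.mem_ofPred_eq, e, _root_.map_add, _root_.map_smul, Pi.add_apply, Pi.smul_apply, smul_eq_mul,
        Finset.sum_add_distrib, ← Finset.mul_sum]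
      refine ⟨fun i => add_nonneg (mul_nonneg hs (ha.1 i)) (mul_nonneg ht (hb.1 i)), ?_⟩
      calc _ ≤ s * 1 + t * 1 := add_le_add (mul_le_mul_of_nonneg_left ha.2 hs)
            (mul_le_mul_of_nonneg_left hb.2 ht)
        _ = 1 := by rw [mul_one, mul_one, hst]
    have := convexHull_min (s := Set.range p) ?_ hc hx
    · rwa [Set.mem_ofPred_eq, add_sub_cancel_right] at this
    · rintro _ ⟨i, rfl⟩
      refine Fin.cases ?_ (fun i => ?_) i
      · simp
      · rw [Set.mem_ofPred_eq, ← hp]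
        simp only [Module.Basis.equivFun_self, Finset.sum_ite_eq, Finset.mem_univ, if_true, le_refl,
          and_true]
        intro j
        split_ifs <;> norm_num
  · rintro ⟨h0, h1⟩
    have key := (convex_convexHull ℝ (Set.range p)).sum_mem (t := Finset.univ)
      (w := (Fin.cons (1 - ∑ i, B.equivFun x i) (fun i => B.equivFun x i) : Fin (N + 1) → ℝ))
      (z := p) (fun i _ => by
        refine Fin.cases ?_ (fun i => ?_) i
        · rw [Fin.cons_zero]; exact sub_nonneg.2 h1
        · rw [Fin.cons_succ]; exact h0 i)
      (by rw [Fin.sum_univ_succ]; simp) fun i _ => subset_convexHull ℝ _ ⟨i, rfl⟩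
    rw [Fin.sum_univ_succ] at key
    convert key using 1
    simp only [Fin.cons_zero, Fin.cons_succ]
    nth_rewrite 1 [← B.sum_equivFun x]
    simp only [hp, smul_sub, Finset.sum_sub_distrib, sub_smul, ← Finset.sum_smul, one_smul]
    abel

/-- In edge coordinates the simplex is the corner of the unit cube where the coordinate sum is at
most 1. The cube is this corner, its reflection where the sum is at least N - 1, and the slab
between. Cube and slab are symmetric about the same centre, so by evenness twice the value on the
simplex is zero. The slab makes sense because N ≥ 2; a degenerate simplex lies in a hyperplane. -/
theorem IsSimpleValuation.eq_zero_of_simplex {m N : ℕ} {μ : ConvexBody V → ℝ}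
    (hμ : IsSimpleValuation m μ) (hN : 2 ≤ N) (hV : Module.finrank ℝ V = N)
    (hsymm : ∀ (K : ConvexBody V) (b : V), (∀ x ∈ K, b - x ∈ K) → μ K = 0)
    (p : Fin (N + 1) → V) (K : ConvexBody V) (hK : (K : Set V) = convexHull ℝ (Set.range p)) :
    μ K = 0 := by
  by_cases hli : LinearIndependent ℝ fun i : Fin N => p i.succ - p 0
  · have : NeZero N := ⟨by omega⟩
    obtain ⟨B, hB⟩ : ∃ B : Module.Basis (Fin N) ℝ V, ∀ i, B i = p i.succ - p 0 :=
      ⟨basisOfLinearIndependentOfCardEqFinrank hli (by simp [hV]), fun i => by simp⟩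
    have hmemK : ∀ x, x ∈ K + pt (-p 0) ↔
        (∀ i, 0 ≤ B.equivFun x i) ∧ ∑ i, B.equivFun x i ≤ 1 := fun x => by
      rw [mem_add_pt, sub_neg_eq_add, ← SetLike.mem_coe, hK, convexHull_range_eq_of_basis B p hB]
    let φ : V →ₗ[ℝ] ℝ := (∑ i, LinearMap.proj i) ∘ₗ B.equivFun.toLinearMap
    have hφ : ∀ x, φ x = ∑ i, B.equivFun x i := fun x => by simp [φ]
    let u := (InnerProductSpace.toDual ℝ V).symm (LinearMap.toContinuousLinearMap φ)
    have hu : ∀ x, inner ℝ u x = ∑ i, B.equivFun x i := fun x => by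
      rw [InnerProductSpace.toDual_symm_apply, LinearMap.coe_toContinuousLinearMap', hφ]
    have hu0 : u ≠ 0 := fun h => by
      have := hu (B 0)
      rw [h, inner_zero_left] at this
      simp at this
    have hN' : (2 : ℝ) ≤ N := by exact_mod_cast hN
    let Q := coordBody B (Set.Icc 0 1) isCompact_Icc (convex_Icc _ _) ⟨0, by simp⟩
    have hQ : ∀ x, x ∈ Q ↔ ∀ i, 0 ≤ B.equivFun x i ∧ B.equivFun x i ≤ 1 := fun x => by
      change B.equivFun x ∈ Set.Icc (0 : Fin N → ℝ) 1 ↔ _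
      rw [Set.mem_Icc, Pi.le_def, Pi.le_def, forall_and]; rfl
    let β := ∑ i, B i
    have hβ : ∀ i, B.equivFun β i = 1 := fun i => by
      simp [β, Module.Basis.equivFun_apply, map_sum, Finsupp.single_apply]
    have hβs : ∀ x, ∑ i, B.equivFun (β - x) i = N - ∑ i, B.equivFun x i := fun x => by
      simp only [map_sub, Pi.sub_apply, hβ, Finset.sum_sub_distrib, Finset.sum_const,
        Finset.card_univ, Fintype.card_fin, nsmul_eq_mul, mul_one]
    have hQβ : ∀ x, x ∈ Q → β - x ∈ Q := fun x hx => (hQ _).2 fun i => by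
      have := (hQ x).1 hx i
      rw [map_sub, Pi.sub_apply, hβ]
      constructor <;> linarith
    have hB0 : B 0 ∈ Q := (hQ _).2 fun i => by
      rw [Module.Basis.equivFun_self]; split_ifs <;> norm_num
    have hB0u : inner ℝ u (B 0) = 1 := by rw [hu]; simp
    have hβB0u : inner ℝ u (β - B 0) = N - 1 := by rw [hu, hβs, ← hu, hB0u]
    let U := Q.inter {x | 1 ≤ inner ℝ u x} (convex_halfSpace_ge (isLinearMap_inner u) 1)
      (isClosed_le continuous_const (by fun_prop)) ⟨B 0, hB0, hB0u.ge⟩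
    let M := U.inter {x | inner ℝ u x ≤ N - 1} (convex_halfSpace_le (isLinearMap_inner u) _)
      (isClosed_le (by fun_prop) continuous_const) ⟨B 0, ⟨hB0, hB0u.ge⟩, by
        rw [Set.mem_ofPred_eq, hB0u]; linarith⟩
    have hone : ∀ x, (∀ i, 0 ≤ B.equivFun x i) → ∑ i, B.equivFun x i ≤ 1 →
        ∀ i, B.equivFun x i ≤ 1 := fun x h0 h1 i =>
      (Finset.single_le_sum (f := fun i => B.equivFun x i) (fun i _ => h0 i)
        (Finset.mem_univ i)).trans h1
    have e1 : μ Q = μ (K + pt (-p 0)) + μ U := by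
      refine hμ.valuation.cut hμ.simple hu0 (c := 1) ?_ rfl
      ext x
      change x ∈ K + pt (-p 0) ↔ x ∈ Q ∧ inner ℝ u x ≤ 1
      rw [hmemK, hQ, hu]
      constructor
      · rintro ⟨h0, h1⟩
        exact ⟨fun i => ⟨h0 i, hone x h0 h1 i⟩, h1⟩
      · rintro ⟨h0, h1⟩
        exact ⟨fun i => (h0 i).1, h1⟩
    have e2 : μ U = μ M + μ ((-1 : ℝ) • (K + pt (-p 0)) + pt β) := by
      refine hμ.valuation.cut hμ.simple hu0 (c := N - 1) rfl ?_
      ext x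
      change x ∈ (-1 : ℝ) • (K + pt (-p 0)) + pt β ↔
        (x ∈ Q ∧ 1 ≤ inner ℝ u x) ∧ N - 1 ≤ inner ℝ u x
      rw [mem_add_pt, ← SetLike.mem_coe, coe_neg_one_smul, Set.mem_neg, neg_sub, SetLike.mem_coe,
        hmemK, hβs, hu]
      constructor
      · rintro ⟨h0, h1⟩
        have hx := hQβ (β - x) ((hQ _).2 fun i => ⟨h0 i, hone _ h0 (by rw [hβs]; exact h1) i⟩)
        rw [sub_sub_cancel] at hx
        exact ⟨⟨hx, by linarith⟩, by linarith⟩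
      · rintro ⟨⟨h0, -⟩, h1⟩
        exact ⟨fun i => ((hQ _).1 (hQβ x h0) i).1, by linarith⟩
    have e3 : μ Q = 0 := hsymm Q β hQβ
    have e4 : μ M = 0 := hsymm M β fun x hx => by
      obtain ⟨⟨h0, h1⟩, h2⟩ := hx
      have h1' : 1 ≤ inner ℝ u x := h1
      have h2' : inner ℝ u x ≤ N - 1 := h2
      have h3 : inner ℝ u (β - x) = N - inner ℝ u x := by rw [hu, hβs, hu]
      exact ⟨⟨hQβ x h0, show 1 ≤ inner ℝ u (β - x) by linarith⟩,
        show inner ℝ u (β - x) ≤ N - 1 by linarith⟩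
    rw [e1, e2, e4, hμ.translation, hμ.translation, hμ.even, hμ.translation] at e3
    linarith
  · have hne : Submodule.span ℝ (Set.range fun i : Fin N => p i.succ - p 0) ≠ ⊤ := fun h =>
      hli (linearIndependent_of_top_le_span_of_card_eq_finrank h.ge (by simp [hV]))
    have h3 : (Submodule.span ℝ (Set.range fun i : Fin N => p i.succ - p 0))ᗮ ≠ ⊥ := fun hb =>
      hne (Submodule.orthogonal_eq_bot_iff.1 hb)
    obtain ⟨u, hu, hu0⟩ := Submodule.exists_mem_ne_zero_of_ne_bot h3
    refine hμ.simple u (inner ℝ u (p 0)) K hu0 fun x hx => ?_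
    rw [← SetLike.mem_coe, hK] at hx
    refine convexHull_min (s := Set.range p) (t := {x | inner ℝ u x = inner ℝ u (p 0)}) ?_
      (convex_hyperplane (isLinearMap_inner u) _) hx
    rintro _ ⟨i, rfl⟩
    refine Fin.cases rfl (fun i => ?_) i
    have := Submodule.inner_left_of_mem_orthogonal (Submodule.subset_span (Set.mem_range_self i)) hu
    rw [inner_sub_right] at this
    rw [Set.mem_ofPred_eq]
    linarith

/-- Simple valuations of degree less than the dimension vanish. -/
theorem IsSimpleValuation.eq_zero (N : ℕ) : ∀ {V : Type*} [NormedAddCommGroup V]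
    [InnerProductSpace ℝ V] [FiniteDimensional ℝ V], Module.finrank ℝ V = N →
    ∀ {m : ℕ} {μ : ConvexBody V → ℝ}, m < N → IsSimpleValuation m μ → ∀ K, μ K = 0 := by
  induction N with
  | zero => intro V _ _ _ _ m μ h; exact absurd h (Nat.not_lt_zero m)
  | succ N ih =>
    intro V _ _ _ hV m μ hm hμ K
    have : Nontrivial V := Module.nontrivial_of_finrank_pos (R := ℝ) (by omega)
    rcases m with - | m
    · exact hμ.eq_zero_of_degree_zero K
    -- Passing to prisms lowers both degree and dimension by one, so the induction hypothesis
    -- applies.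
    have hprism : ∀ v : V, v ≠ 0 → ∀ (K : ConvexBody (Submodule.span ℝ {v})ᗮ) (s : ℝ), 0 < s →
        μ (map (Submodule.span ℝ {v})ᗮ.subtype K + seg 0 (s • v)) = 0 := by
      intro v hv K s hs
      have hdim : Module.finrank ℝ (Submodule.span ℝ {v})ᗮ = N := by
        have h := (Submodule.span ℝ {v}).finrank_add_finrank_orthogonal
        rw [finrank_span_singleton hv, hV] at h
        omega
      refine ih hdim (by omega : m < N) (hμ.prism (smul_ne_zero hs.ne' hv) fun k => ?_) K
      rw [real_inner_smul_left, Submodule.mem_orthogonal_singleton_iff_inner_right.1 k.2, mul_zero]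
    have hseg : ∀ K (v : V), μ (K + seg 0 v) = μ K := fun K v => by
      by_cases hv : v = 0
      · rw [hv]
        change μ (K + pt 0) = μ K
        rw [pt_zero, add_zero]
      · exact hμ.add_seg_eq hv (hprism v hv) K
    have hsx := hμ.eq_zero_of_simplex (by omega) hV fun K b => hμ.eq_zero_of_symmetric hseg
    have hpoly := hμ.valuation.eq_zero_of_isPolytope _ hV hμ.simple hsx
    have hcl : IsClosed {L : ConvexBody V | μ L = 0} := isClosed_eq hμ.continuous continuous_const
    refine hcl.closure_subset (Metric.mem_closure_iff.2 fun ε hε => ?_)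
    obtain ⟨P, hP, hd⟩ := K.exists_isPolytope_dist_le (half_pos hε)
    exact ⟨P, hpoly P hP, by rw [dist_comm]; linarith⟩

end ConvexBody

/-! ### Klain's theorem -/

namespace ConvexBody

variable {V W : Type*} [NormedAddCommGroup V] [InnerProductSpace ℝ V] [FiniteDimensional ℝ V]
  [NormedAddCommGroup W] [InnerProductSpace ℝ W] [FiniteDimensional ℝ W]

/-- Images do not commute with intersections in general, but they do when K ∪ L is convex: if k in K
and l in L have the same image, the segment between them is connected and covered by two closed
sets, so it meets K ∩ L. -/
theorem IsValuation.comp_map {μ : ConvexBody W → ℝ} (hμ : IsValuation μ) (f : V →ₗ[ℝ] W) :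
    IsValuation fun K => μ (map f K) := by
  intro K L U I hU hI
  refine hμ _ _ _ _ ?_ ?_
  · rw [coe_map, hU, Set.image_union]; rfl
  · rw [coe_map, hI]
    refine Set.Subset.antisymm (Set.image_inter_subset _ _ _) ?_
    rintro _ ⟨⟨k, hk, rfl⟩, ⟨l, hl, e⟩⟩
    have hsub : segment ℝ k l ⊆ ↑K ∪ ↑L := by
      rw [← hU]
      exact U.convex.segment_subset (hU ▸ Or.inl hk) (hU ▸ Or.inr hl)
    obtain ⟨z, hz, hzK, hzL⟩ := isPreconnected_closed_iff.1 (convex_segment k l).isPreconnected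
      _ _ K.isClosed L.isClosed hsub ⟨k, left_mem_segment ℝ k l, hk⟩
      ⟨l, right_mem_segment ℝ k l, hl⟩
    refine ⟨z, ⟨hzK, hzL⟩, ?_⟩
    obtain ⟨s, t, -, -, hst, rfl⟩ := hz
    rw [_root_.map_add, _root_.map_smul, _root_.map_smul, e, ← add_smul, hst, one_smul]

theorem IsTranslationInvariant.comp_map {μ : ConvexBody W → ℝ} (hμ : IsTranslationInvariant μ)
    (f : V →ₗ[ℝ] W) : IsTranslationInvariant fun K => μ (map f K) := by
  intro K a
  simp only [map_add, map_pt, hμ _ _]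

/-- Even continuous translation-invariant valuations that are homogeneous of degree `m`
under dilation by `2`. -/
structure IsEvenValuation (m : ℕ) (μ : ConvexBody V → ℝ) : Prop where
  valuation : IsValuation μ
  translation : IsTranslationInvariant μ
  continuous : Continuous μ
  even : ∀ K, μ ((-1 : ℝ) • K) = μ K
  two_smul : ∀ K, μ ((2 : ℝ) • K) = 2 ^ m * μ K

theorem IsEvenValuation.comp_map {m : ℕ} {μ : ConvexBody W → ℝ} (hμ : IsEvenValuation m μ)
    (f : V →ₗ[ℝ] W) : IsEvenValuation m fun K => μ (map f K) where
  valuation := hμ.valuation.comp_map f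
  translation := hμ.translation.comp_map f
  continuous := hμ.continuous.comp (continuous_map f)
  even K := by rw [map_smul, hμ.even]
  two_smul K := by rw [map_smul, hμ.two_smul]

theorem finrank_direction_map_subtype {H : Submodule ℝ V} (K : ConvexBody H) :
    Module.finrank ℝ (affineSpan ℝ (map H.subtype K : Set V)).direction =
      Module.finrank ℝ (affineSpan ℝ (K : Set H)).direction := by
  have : affineSpan ℝ (map H.subtype K : Set V) =
      (affineSpan ℝ (K : Set H)).map H.subtype.toAffineMap :=
    (AffineSubspace.map_span H.subtype.toAffineMap (K : Set H)).symm
  rw [this, AffineSubspace.map_direction]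
  exact Submodule.finrank_map_subtype_eq _ _

theorem dist_add_ball_le (K : ConvexBody V) {ε : ℝ} (hε : 0 ≤ ε) : dist (K + ball 0 ε hε) K ≤ ε :=
  dist_le_of_supp hε fun x => by
    rw [supp_add, supp_ball_zero, add_sub_cancel_left, abs_of_nonneg (by positivity)]

theorem affineSpan_add_ball (K : ConvexBody V) {ε : ℝ} (hε : 0 < ε) :
    affineSpan ℝ ((K + ball 0 ε hε.le : ConvexBody V) : Set V) = ⊤ := by
  refine (ConvexBody.convex _).interior_nonempty_iff_affineSpan_eq_top.1 ?_
  obtain ⟨k, hk⟩ := K.nonempty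
  refine ⟨k, mem_interior_iff_mem_nhds.2 ?_⟩
  refine Filter.mem_of_superset (Metric.closedBall_mem_nhds k hε) fun x hx => ?_
  refine mem_add.2 ⟨k, hk, x - k, mem_ball_zero.2 ?_, add_sub_cancel _ _⟩
  rwa [Metric.mem_closedBall, dist_eq_norm] at hx

theorem map_subtype_map_projection (H : Submodule ℝ V) {K : ConvexBody V} {a : V}
    (hK : ∀ x ∈ K, x - a ∈ H) :
    map H.subtype (map (H.orthogonalProjectionOnto : V →ₗ[ℝ] H) (K + pt (-a))) + pt a = K := by
  have hp : ∀ x ∈ K, ((H.orthogonalProjectionOnto (x - a) : H) : V) = x - a := fun x hx =>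
    Submodule.starProjection_eq_self_iff.2 (hK x hx)
  refine SetLike.ext fun x => ?_
  rw [mem_add_pt]
  constructor
  · rintro ⟨_, ⟨y, hy, rfl⟩, e⟩
    have hy' := mem_add_pt.1 hy
    rw [sub_neg_eq_add] at hy'
    have h1 := hp _ hy'
    rw [add_sub_cancel_right] at h1
    have h2 : y = x - a := h1.symm.trans e
    rwa [h2, sub_add_cancel] at hy'
  · intro hx
    refine ⟨_, ⟨x - a, mem_add_pt.2 (by rwa [sub_neg_eq_add, sub_add_cancel]), rfl⟩, hp x hx⟩

/-- Klain's theorem: an even valuation of degree `m` that vanishes on `m`-dimensional bodies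
is zero. -/
theorem IsEvenValuation.eq_zero {m d : ℕ} (hmd : m ≤ d) : ∀ {V : Type*} [NormedAddCommGroup V]
    [InnerProductSpace ℝ V] [FiniteDimensional ℝ V], Module.finrank ℝ V = d →
    ∀ {μ : ConvexBody V → ℝ}, IsEvenValuation m μ →
    (∀ K : ConvexBody V, Module.finrank ℝ (affineSpan ℝ (K : Set V)).direction = m → μ K = 0) →
    ∀ K, μ K = 0 := by
  induction d, hmd using Nat.le_induction with
  | base =>
    intro V _ _ _ hV μ hμ h0 K
    have hcl : IsClosed {L : ConvexBody V | μ L = 0} := isClosed_eq hμ.continuous continuous_const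
    refine hcl.closure_subset (Metric.mem_closure_iff.2 fun ε hε => ?_)
    -- In dimension m, fattening by a small ball makes any body full-dimensional.
    refine ⟨K + ball 0 (ε / 2) (half_pos hε).le, h0 _ ?_, ?_⟩
    · rw [affineSpan_add_ball K (half_pos hε), AffineSubspace.direction_top, finrank_top, hV]
    · rw [dist_comm]
      linarith [dist_add_ball_le K (half_pos hε).le]
  | succ d hmd ih =>
    intro V _ _ _ hV μ hμ h0 K
    -- The induction hypothesis on hyperplanes through the origin, together with translation
    -- invariance, says that μ is simple.
    refine IsSimpleValuation.eq_zero (d + 1) hV (m := m) (by omega)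
      ⟨hμ.valuation, hμ.translation, fun u c K hu hK => ?_, hμ.continuous, hμ.even, hμ.two_smul⟩ K
    obtain ⟨a, ha⟩ := K.nonempty
    rw [← map_subtype_map_projection (Submodule.span ℝ {u})ᗮ (K := K) (a := a) fun x hx => ?_,
      hμ.translation]
    · refine ih ?_ (hμ.comp_map (Submodule.span ℝ {u})ᗮ.subtype) (fun L hL => h0 _ ?_) _
      · have h := (Submodule.span ℝ {u}).finrank_add_finrank_orthogonal
        rw [finrank_span_singleton hu, hV] at h
        omega
      · rw [finrank_direction_map_subtype, hL]
    · rw [Submodule.mem_orthogonal_singleton_iff_inner_right, inner_sub_right, hK x hx, hK a ha,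
        sub_self]

end ConvexBody

/-! ### From tuples to subsets -/

/-- Each m-subset is the image of exactly m! injective tuples. This is the source of the factorial
both in the zonotope formula and in the ℓ₁ case. -/
theorem Finset.sum_piFinset_eq_factorial_mul {ι : Type*} [DecidableEq ι] {m : ℕ} (J : Finset ι)
    (D : (Fin m → ι) → ℝ) (g : Finset ι → ℝ) (h0 : ∀ f, ¬ Function.Injective f → D f = 0)
    (h1 : ∀ f, Function.Injective f → D f = g (Finset.univ.image f)) :
    ∑ f ∈ Fintype.piFinset (fun _ : Fin m => J), D f =
      m.factorial * ∑ I ∈ Finset.powersetCard m J, g I := by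
  classical
  have e1 : ∑ f ∈ Fintype.piFinset (fun _ : Fin m => J), D f =
      ∑ f ∈ Fintype.piFinset (fun _ : Fin m => J) with Function.Injective f, D f := by
    rw [Finset.sum_filter]
    refine Finset.sum_congr rfl fun f _ => ?_
    split_ifs with h
    · rfl
    · exact h0 f h
  rw [e1, ← Finset.sum_fiberwise_of_maps_to (t := Finset.powersetCard m J)
    (g := fun f => Finset.univ.image f), Finset.mul_sum]
  · refine Finset.sum_congr rfl fun I hI => ?_
    obtain ⟨hIJ, hIm⟩ := Finset.mem_powersetCard.1 hI
    have e2 : ∀ f ∈ ({f ∈ {f ∈ Fintype.piFinset (fun _ : Fin m => J) | Function.Injective f} |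
        Finset.univ.image f = I} : Finset (Fin m → ι)), D f = g I := fun f hf => by
      rw [Finset.mem_filter, Finset.mem_filter] at hf
      rw [h1 f hf.1.2, hf.2]
    rw [Finset.sum_congr rfl e2, Finset.sum_const, nsmul_eq_mul]
    congr 2
    have e3 : Fintype.card (Fin m ↪ I) = m.factorial := by
      rw [Fintype.card_embedding_eq, Fintype.card_coe, hIm, Fintype.card_fin,
        Nat.descFactorial_self]
    rw [← e3, ← Finset.card_univ]
    symm
    refine Finset.card_bij (fun e _ k => ((e k : I) : ι)) (fun e _ => ?_) (fun e _ e' _ h => ?_)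
      fun f hf => ?_
    · have hinj : Function.Injective fun k => ((e k : I) : ι) :=
        Subtype.val_injective.comp e.injective
      rw [Finset.mem_filter, Finset.mem_filter, Fintype.mem_piFinset]
      refine ⟨⟨fun k => hIJ (e k).2, hinj⟩, Finset.eq_of_subset_of_card_le ?_ ?_⟩
      · intro x hx
        obtain ⟨k, -, rfl⟩ := Finset.mem_image.1 hx
        exact (e k).2
      · rw [Finset.card_image_of_injective _ hinj, hIm, Finset.card_univ, Fintype.card_fin]
    · exact DFunLike.ext _ _ fun k => Subtype.ext (congrFun h k)
    · rw [Finset.mem_filter, Finset.mem_filter] at hf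
      refine ⟨⟨fun k => ⟨f k, hf.2 ▸ Finset.mem_image_of_mem f (Finset.mem_univ k)⟩,
        fun a b hab => hf.1.2 (congrArg Subtype.val hab)⟩, Finset.mem_univ _, rfl⟩
  · intro f hf
    rw [Finset.mem_filter, Fintype.mem_piFinset] at hf
    rw [Finset.mem_powersetCard]
    refine ⟨fun x hx => ?_, ?_⟩
    · obtain ⟨k, -, rfl⟩ := Finset.mem_image.1 hx
      exact hf.1 k
    · rw [Finset.card_image_of_injective _ hf.2, Finset.card_univ, Fintype.card_fin]

/-! ### Volume of zonotopes -/

namespace ConvexBody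

variable {V : Type*} [NormedAddCommGroup V] [InnerProductSpace ℝ V] [FiniteDimensional ℝ V]
  [MeasurableSpace V] [BorelSpace V]

/-- The volume of a convex body. -/
noncomputable def vol (K : ConvexBody V) : ℝ := (volume (K : Set V)).toReal

theorem coe_sum {V : Type*} [NormedAddCommGroup V] [NormedSpace ℝ V] {ι : Type*} (s : Finset ι)
    (K : ι → ConvexBody V) : ((∑ i ∈ s, K i : ConvexBody V) : Set V) = ∑ i ∈ s, (K i : Set V) :=
  _root_.map_sum ({ toFun := fun L => (L : Set V), map_zero' := coe_zero, map_add' := coe_add } :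
    ConvexBody V →+ Set V) K s

theorem vol_mono {K L : ConvexBody V} (h : K ≤ L) : vol K ≤ vol L :=
  ENNReal.toReal_mono L.volume_ne_top (measure_mono h)

theorem vol_nonneg (K : ConvexBody V) : 0 ≤ vol K := ENNReal.toReal_nonneg

theorem vol_add_pt (K : ConvexBody V) (a : V) : vol (K + pt a) = vol K :=
  isTranslationInvariant_volume K a

theorem vol_smul {t : ℝ} (ht : 0 ≤ t) (K : ConvexBody V) :
    vol (t • K) = t ^ Module.finrank ℝ V * vol K := by
  rw [vol, coe_smul, Measure.addHaar_smul, ENNReal.toReal_mul, ENNReal.toReal_ofReal (abs_nonneg _),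
    abs_of_nonneg (by positivity)]
  rfl

theorem vol_map {f : V →ₗ[ℝ] V} (K : ConvexBody V) :
    vol (map f K) = |LinearMap.det f| * vol K := by
  rw [vol, coe_map, Measure.addHaar_image_linearMap, ENNReal.toReal_mul,
    ENNReal.toReal_ofReal (abs_nonneg _)]
  rfl

theorem vol_sum_seg_eq_zero {ι : Type*} (J : Finset ι) (v : ι → V)
    (hJ : J.card < Module.finrank ℝ V) : vol (∑ j ∈ J, seg 0 (v j)) = 0 := by
  classical
  have h1 : ((∑ j ∈ J, seg 0 (v j) : ConvexBody V) : Set V) ⊆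
      Submodule.span ℝ ((J.image v : Finset V) : Set V) := by
    have key : ∀ s : Finset ι, s ⊆ J → ∀ x ∈ (∑ j ∈ s, seg 0 (v j) : ConvexBody V),
        x ∈ Submodule.span ℝ ((J.image v : Finset V) : Set V) := by
      intro s
      induction s using Finset.induction_on with
      | empty =>
        intro _ x hx
        rw [Finset.sum_empty] at hx
        rw [mem_zero.1 hx]
        exact Submodule.zero_mem _
      | insert a s ha ih =>
        intro hs x hx
        rw [Finset.sum_insert ha] at hx
        obtain ⟨y, hy, z, hz, rfl⟩ := mem_add.1 hx
        obtain ⟨t, -, -, rfl⟩ := mem_seg_zero.1 hy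
        refine Submodule.add_mem _ (Submodule.smul_mem _ _ (Submodule.subset_span ?_))
          (ih (fun i hi => hs (Finset.mem_insert_of_mem hi)) z hz)
        exact Finset.mem_coe.2 (Finset.mem_image_of_mem v (hs (Finset.mem_insert_self _ _)))
    exact fun x hx => key J subset_rfl x hx
  have h2 : Submodule.span ℝ ((J.image v : Finset V) : Set V) ≠ ⊤ := fun h => by
    have h3 := finrank_span_finset_le_card (R := ℝ) (J.image v)
    rw [Set.finrank, h, finrank_top] at h3
    have := Finset.card_image_le (s := J) (f := v)
    omega
  rw [vol, measure_mono_null h1 (Measure.addHaar_submodule _ _ h2)]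
  rfl

theorem vol_sum_seg_update {ι : Type*} [DecidableEq ι] (J : Finset ι) (v : ι → V) {j : ι}
    (hj : j ∈ J) : vol (∑ i ∈ J, seg 0 (Function.update v j ((2 : ℝ) • v j) i)) =
      2 * vol (∑ i ∈ J, seg 0 (v i)) - vol (∑ i ∈ J.erase j, seg 0 (v i)) := by
  have h := (isValuation_volume (V := V)).add_seg isTranslationInvariant_volume
    (∑ i ∈ J.erase j, seg 0 (v i)) (v j) zero_le_one zero_le_one
  rw [one_smul, one_add_one_eq_two] at h
  have e1 : ∑ i ∈ J, seg 0 (Function.update v j ((2 : ℝ) • v j) i) =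
      ∑ i ∈ J.erase j, seg 0 (v i) + seg 0 ((2 : ℝ) • v j) := by
    rw [← Finset.sum_erase_add _ _ hj, Function.update_self]
    congr 1
    refine Finset.sum_congr rfl fun i hi => ?_
    rw [Function.update_of_ne (Finset.ne_of_mem_erase hi)]
  rw [e1, ← Finset.sum_erase_add J _ hj]
  simp only [vol]
  linarith

/-- The volume of a zonotope. -/
theorem vol_sum_seg {ι : Type*} [DecidableEq ι] (J : Finset ι) : ∀ v : ι → V,
    vol (∑ j ∈ J, seg 0 (v j)) =
      ∑ I ∈ Finset.powersetCard (Module.finrank ℝ V) J, vol (∑ j ∈ I, seg 0 (v j)) := by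
  set m := Module.finrank ℝ V with hm
  induction J using Finset.strongInduction with
  | H J ih =>
    intro v
    rcases lt_trichotomy J.card m with hJ | hJ | hJ
    · rw [Finset.powersetCard_eq_empty.2 hJ, Finset.sum_empty, vol_sum_seg_eq_zero J v hJ]
    · rw [← hJ, Finset.powersetCard_self, Finset.sum_singleton]
    -- The defect of the formula is homogeneous of degree one in each vector separately: the
    -- correction terms under doubling v_j express the formula for J without j, which holds by
    -- induction. Doubling all vectors then multiplies R by 2^|J|, but volume scales by 2^m. As |J|
    -- > m, the defect is zero.
    · let R : (ι → V) → ℝ := fun v => vol (∑ j ∈ J, seg 0 (v j)) -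
        ∑ I ∈ Finset.powersetCard m J, vol (∑ j ∈ I, seg 0 (v j))
      have hR : ∀ v, ∀ j ∈ J, R (Function.update v j ((2 : ℝ) • v j)) = 2 * R v := by
        intro v j hj
        have h1 := ih (J.erase j) (Finset.erase_ssubset hj) v
        have h2 : ∀ I ∈ Finset.powersetCard m J,
            vol (∑ i ∈ I, seg 0 (Function.update v j ((2 : ℝ) • v j) i)) =
              2 * vol (∑ i ∈ I, seg 0 (v i)) - if j ∉ I then vol (∑ i ∈ I, seg 0 (v i)) else 0 := by
          intro I hI
          obtain ⟨hIJ, hIm⟩ := Finset.mem_powersetCard.1 hI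
          by_cases hjI : j ∈ I
          · rw [vol_sum_seg_update I v hjI, vol_sum_seg_eq_zero (I.erase j), if_neg (not_not.2 hjI)]
            rw [← hm, ← hIm]
            exact Finset.card_erase_lt_of_mem hjI
          · rw [if_pos hjI, two_mul, add_sub_cancel_right]
            congr 1
            refine Finset.sum_congr rfl fun i hi => ?_
            rw [Function.update_of_ne (ne_of_mem_of_not_mem hi hjI)]
        have h3 : Finset.powersetCard m (J.erase j) =
            (Finset.powersetCard m J).filter fun I => j ∉ I := by
          ext I
          simp only [Finset.mem_powersetCard, Finset.mem_filter, Finset.subset_erase]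
          tauto
        simp only [R]
        rw [vol_sum_seg_update J v hj, h1, h3, Finset.sum_congr rfl h2, Finset.sum_sub_distrib,
          Finset.sum_filter, ← Finset.mul_sum]
        ring
      have hR2 : ∀ S ⊆ J, R (fun i => if i ∈ S then (2 : ℝ) • v i else v i) =
          2 ^ S.card * R v := by
        intro S
        induction S using Finset.induction_on with
        | empty => intro _; simp
        | insert a S ha ihS =>
          intro hS
          rw [Finset.card_insert_of_notMem ha, pow_succ', mul_assoc,
            ← ihS fun i hi => hS (Finset.mem_insert_of_mem hi),
            ← hR _ a (hS (Finset.mem_insert_self _ _))]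
          congr 1
          funext i
          by_cases hi : i = a
          · subst hi; simp [ha]
          · simp [hi]
      have hR3 : R (fun i => if i ∈ J then (2 : ℝ) • v i else v i) = 2 ^ m * R v := by
        have h4 : ∀ I ⊆ J, vol (∑ i ∈ I, seg 0 (if i ∈ J then (2 : ℝ) • v i else v i)) =
            2 ^ m * vol (∑ i ∈ I, seg 0 (v i)) := fun I hI => by
          rw [← vol_smul zero_le_two, Finset.smul_sum]
          congr 1
          refine Finset.sum_congr rfl fun i hi => ?_
          rw [if_pos (hI hi), smul_seg, smul_zero]
        simp only [R]
        rw [h4 J subset_rfl, mul_sub, Finset.mul_sum]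
        congr 1
        exact Finset.sum_congr rfl fun I hI => h4 I (Finset.mem_powersetCard.1 hI).1
      rw [hR2 J subset_rfl] at hR3
      have h5 : (2 : ℝ) ^ m < 2 ^ J.card := pow_lt_pow_right₀ one_lt_two hJ
      have h6 : (2 ^ J.card - 2 ^ m : ℝ) * R v = 0 := by rw [sub_mul, hR3, sub_self]
      rcases mul_eq_zero.1 h6 with h | h
      · linarith
      · exact sub_eq_zero.1 h

theorem vol_sum_seg_univ {m : ℕ} (b : OrthonormalBasis (Fin m) ℝ V) (w : Fin m → V) :
    vol (∑ i, seg 0 (w i)) = |b.toBasis.det w| := by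
  rw [vol, coe_sum]
  have := parallelepiped_eq_sum_segment w
  rw [show ∑ i, (seg 0 (w i) : Set V) = parallelepiped w from this.symm, ← b.addHaar_eq_volume,
    Measure.addHaar_parallelepiped, ENNReal.toReal_ofReal (abs_nonneg _)]

theorem factorial_mul_vol_sum_seg {m : ℕ} (b : OrthonormalBasis (Fin m) ℝ V) {ι : Type*}
    (J : Finset ι) (v : ι → V) : m.factorial * vol (∑ j ∈ J, seg 0 (v j)) =
      ∑ f ∈ Fintype.piFinset (fun _ : Fin m => J), |b.toBasis.det fun i => v (f i)| := by
  classical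
  have hm : Module.finrank ℝ V = m := by rw [Module.finrank_eq_card_basis b.toBasis, Fintype.card_fin]
  rw [vol_sum_seg, hm]
  symm
  refine Finset.sum_piFinset_eq_factorial_mul J _ (fun I => vol (∑ j ∈ I, seg 0 (v j)))
    (fun f hf => ?_) fun f hf => ?_
  · have h0 : b.toBasis.det (v ∘ f) = 0 :=
      AlternatingMap.map_eq_zero_of_not_injective _ _ fun h => hf h.of_comp
    change |b.toBasis.det (v ∘ f)| = 0
    rw [h0, abs_zero]
  · rw [← vol_sum_seg_univ, Finset.sum_image fun a _ c _ h => hf h]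

end ConvexBody

/-! ### Volume of zonoids -/

namespace ConvexBody

variable {V : Type*} [NormedAddCommGroup V] [InnerProductSpace ℝ V] [FiniteDimensional ℝ V]
  [MeasurableSpace V] [BorelSpace V] {Ω : Type*} [MeasurableSpace Ω] {κ : Measure Ω} {m : ℕ}

/-- Symmetric segments are translates of segments from 0 of twice the length; the factor 2^m in the
volume of a zonoid comes from here. -/
theorem sum_seg_neg {ι : Type*} (J : Finset ι) (u : ι → V) : ∑ j ∈ J, seg (-u j) (u j) =
    ∑ j ∈ J, seg 0 ((2 : ℝ) • u j) + pt (-∑ j ∈ J, u j) := by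
  refine ext_supp fun x => ?_
  rw [supp_add, supp_sum, supp_sum, supp_pt, inner_neg_right, inner_sum, ← sub_eq_add_neg,
    ← Finset.sum_sub_distrib]
  refine Finset.sum_congr rfl fun j _ => ?_
  rw [supp_seg, supp_seg, inner_zero_right, inner_neg_right, inner_smul_right, ← max_sub_sub_right]
  congr 1 <;> ring

theorem continuous_abs_det (b : OrthonormalBasis (Fin m) ℝ V) :
    Continuous fun w : Fin m → V => |b.toBasis.det w| := by
  have : (fun w : Fin m → V => |b.toBasis.det w|) =
      fun w => |(Matrix.of fun i j => b.repr (w j) i).det| := by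
    funext w
    rw [Module.Basis.det_apply]
    congr 2
  rw [this]
  refine (Continuous.matrix_det (continuous_matrix fun i j => ?_)).abs
  simp only [Matrix.of_apply]
  fun_prop

theorem integral_abs_det_simpleFunc [IsFiniteMeasure κ] (b : OrthonormalBasis (Fin m) ℝ V)
    (s : SimpleFunc Ω V) :
    ∫ ω : Fin m → Ω, |b.toBasis.det fun i => s (ω i)| ∂(Measure.pi fun _ => κ) =
      ∑ f ∈ Fintype.piFinset (fun _ : Fin m => s.range),
        (∏ i, κ.real (s ⁻¹' {f i})) * |b.toBasis.det f| := by
  classical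
  have hms : ∀ v, MeasurableSet (s ⁻¹' {v}) := fun v => s.measurableSet_fiber v
  have e1 : ∀ ω : Fin m → Ω, |b.toBasis.det fun i => s (ω i)| =
      ∑ f ∈ Fintype.piFinset (fun _ : Fin m => s.range),
        (∏ i, (s ⁻¹' {f i}).indicator (fun _ => (1 : ℝ)) (ω i)) * |b.toBasis.det f| := by
    intro ω
    rw [Finset.sum_eq_single fun i => s (ω i)]
    · rw [Finset.prod_eq_one, one_mul]
      intro i _
      exact Set.indicator_of_mem (show ω i ∈ s ⁻¹' {s (ω i)} from rfl) _
    · intro f _ hf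
      obtain ⟨i, hi⟩ := Function.ne_iff.1 hf
      rw [Finset.prod_eq_zero (Finset.mem_univ i), zero_mul]
      rw [Set.indicator_of_notMem]
      exact fun h => hi h.symm
    · intro h
      exact absurd (Fintype.mem_piFinset.2 fun i => s.mem_range_self (ω i)) h
  have hint : ∀ v, Integrable ((s ⁻¹' {v}).indicator fun _ => (1 : ℝ)) κ := fun v =>
    (integrable_const 1).indicator (hms v)
  simp only [e1]
  rw [integral_finsetSum]
  · refine Finset.sum_congr rfl fun f _ => ?_
    rw [integral_mul_const, integral_fintype_prod_eq_prod
      (f := fun i => (s ⁻¹' {f i}).indicator fun _ => (1 : ℝ))]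
    congr 1
    refine Finset.prod_congr rfl fun i _ => ?_
    rw [integral_indicator_const _ (hms _), smul_eq_mul, mul_one]
  · intro f _
    exact (Integrable.fintype_prod (f := fun i => (s ⁻¹' {f i}).indicator fun _ => (1 : ℝ))
      fun i => hint (f i)).mul_const _

theorem vol_zonoid_simpleFunc [IsFiniteMeasure κ] (b : OrthonormalBasis (Fin m) ℝ V)
    (s : SimpleFunc Ω V) (hs : Integrable s κ) :
    m.factorial * vol (zonoid κ s hs) =
      2 ^ m * ∫ ω : Fin m → Ω, |b.toBasis.det fun i => s (ω i)| ∂(Measure.pi fun _ => κ) := by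
  rw [zonoid_simpleFunc, sum_seg_neg, vol_add_pt, factorial_mul_vol_sum_seg b,
    integral_abs_det_simpleFunc, Finset.mul_sum]
  refine Finset.sum_congr rfl fun f _ => ?_
  simp only [smul_smul]
  have h := MultilinearMap.map_smul_univ b.toBasis.det.toMultilinearMap
    (fun i => 2 * κ.real (s ⁻¹' {f i})) f
  simp only [AlternatingMap.coe_multilinearMap] at h
  rw [h, smul_eq_mul, abs_mul, Finset.prod_mul_distrib, Finset.prod_const, Finset.card_univ,
    Fintype.card_fin, abs_of_nonneg (mul_nonneg (by positivity)
      (Finset.prod_nonneg fun i _ => measureReal_nonneg)), mul_assoc]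

theorem exists_abs_det_le (b : OrthonormalBasis (Fin m) ℝ V) (R : ℝ) :
    ∃ C, ∀ w : Fin m → V, (∀ i, ‖w i‖ ≤ R) → |b.toBasis.det w| ≤ C := by
  obtain ⟨C, hC⟩ := (isCompact_closedBall (0 : Fin m → V) |R|).exists_bound_of_continuousOn
    (continuous_abs_det b).continuousOn
  refine ⟨C, fun w hw => ?_⟩
  have := hC w (by
    rw [mem_closedBall_zero_iff, pi_norm_le_iff_of_nonneg (abs_nonneg R)]
    exact fun i => (hw i).trans (le_abs_self R))
  rwa [Real.norm_eq_abs, abs_abs] at this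

/-- The volume of a zonoid. -/
theorem vol_zonoid [IsFiniteMeasure κ] (b : OrthonormalBasis (Fin m) ℝ V) {φ : Ω → V}
    (hm : Measurable φ) (hφ : Integrable φ κ) {R : ℝ} (hR : ∀ ω, ‖φ ω‖ ≤ R) :
    m.factorial * vol (zonoid κ φ hφ) =
      2 ^ m * ∫ ω : Fin m → Ω, |b.toBasis.det fun i => φ (ω i)| ∂(Measure.pi fun _ => κ) := by
  obtain ⟨s, hs, h1, h2, h3⟩ := exists_tendsto_zonoid hm hφ
  obtain ⟨C, hC⟩ := exists_abs_det_le b (2 * R)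
  have hl := ((continuous_volume.tendsto _).comp h3).const_mul (m.factorial : ℝ)
  have hr : Filter.Tendsto
      (fun n => ∫ ω : Fin m → Ω, |b.toBasis.det fun i => s n (ω i)| ∂(Measure.pi fun _ => κ))
      Filter.atTop
      (nhds (∫ ω : Fin m → Ω, |b.toBasis.det fun i => φ (ω i)| ∂(Measure.pi fun _ => κ))) := by
    refine tendsto_integral_of_dominated_convergence (fun _ => C) (fun n => ?_)
      (integrable_const _) (fun n => Filter.Eventually.of_forall fun ω => ?_)
      (Filter.Eventually.of_forall fun ω => ?_)
    · refine ((continuous_abs_det b).measurable.comp ?_).aestronglyMeasurable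
      exact measurable_pi_lambda _ fun i => (s n).measurable.comp (measurable_pi_apply i)
    · rw [Real.norm_eq_abs, abs_abs]
      exact hC _ fun i => (h2 n _).trans (by gcongr; exact hR _)
    · exact ((continuous_abs_det b).tendsto _).comp (tendsto_pi_nhds.2 fun i => h1 (ω i))
  refine tendsto_nhds_unique hl ((hr.const_mul (2 ^ m)).congr fun n => ?_)
  exact (vol_zonoid_simpleFunc b (s n) (hs n)).symm

/-- The linear map with rows `w i`. -/
noncomputable def rows (w : Fin m → V) : V →ₗ[ℝ] EuclideanSpace ℝ (Fin m) :=
  (WithLp.linearEquiv 2 ℝ (Fin m → ℝ)).symm.toLinearMap ∘ₗ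
    LinearMap.pi fun i => (innerₛₗ ℝ (w i))

theorem rows_apply (w : Fin m → V) (x : V) : rows w x = WithLp.toLp 2 fun i => inner ℝ (w i) x :=
  rfl

/-- The volume of the image under the map with rows `w i`. -/
theorem vol_map_rows (b : OrthonormalBasis (Fin m) ℝ V) (w : Fin m → V) (K : ConvexBody V) :
    vol (map (rows w) K) = |b.toBasis.det w| * vol K := by
  let T : V →ₗ[ℝ] V := b.repr.symm.toLinearEquiv.toLinearMap ∘ₗ rows w
  -- The matrix of T has the vectors w i as rows, the determinant of the family has them as columns.
  have hT : LinearMap.det T = b.toBasis.det w := by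
    rw [← LinearMap.det_toMatrix b.toBasis, Module.Basis.det_apply, ← Matrix.det_transpose]
    congr 1
    ext i j
    rw [Matrix.transpose_apply, LinearMap.toMatrix_apply, Module.Basis.toMatrix_apply]
    simp only [OrthonormalBasis.coe_toBasis_repr_apply, OrthonormalBasis.coe_toBasis]
    have : b.repr (T (b i)) = rows w (b i) := b.repr.apply_symm_apply _
    rw [this, rows_apply, b.repr_apply_apply, real_inner_comm]
  rw [← hT, ← vol_map, vol, vol]
  congr 1
  rw [coe_map, coe_map]
  have e : (T : V → V) '' (K : Set V) = b.repr ⁻¹' (rows w '' (K : Set V)) := by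
    ext x
    constructor
    · rintro ⟨k, hk, rfl⟩
      exact ⟨k, hk, (b.repr.apply_symm_apply _).symm⟩
    · rintro ⟨k, hk, e⟩
      exact ⟨k, hk, show b.repr.symm (rows w k) = x by rw [e, b.repr.symm_apply_apply]⟩
  rw [e, b.measurePreserving_repr.measure_preimage]
  exact (map (rows w) K).measurableSet.nullMeasurableSet

end ConvexBody

/-! ### The mean volume of linear images -/

namespace ConvexBody

variable {V : Type*} [NormedAddCommGroup V] [InnerProductSpace ℝ V] [FiniteDimensional ℝ V]
  {Ω : Type*} [MeasurableSpace Ω] {κ : Measure Ω} {m : ℕ}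

theorem _root_.EuclideanSpace.norm_le_sum_abs (x : EuclideanSpace ℝ (Fin m)) :
    ‖x‖ ≤ ∑ i, |x i| := by
  nth_rewrite 1 [← (EuclideanSpace.basisFun (Fin m) ℝ).sum_repr x]
  refine (norm_sum_le _ _).trans (Finset.sum_le_sum fun i _ => ?_)
  rw [norm_smul, (EuclideanSpace.basisFun (Fin m) ℝ).norm_eq_one, mul_one, Real.norm_eq_abs]
  rfl

theorem continuous_map_rows (K : ConvexBody V) :
    Continuous fun w : Fin m → V => map (rows w) K := by
  obtain ⟨R, hR0, hR⟩ := K.exists_norm_le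
  have key : ∀ w w' : Fin m → V, dist (map (rows w) K) (map (rows w') K) ≤
      ∑ i, ‖w i - w' i‖ * R := by
    intro w w'
    have h : ∀ w w' : Fin m → V, ∀ k ∈ K, dist (rows w k) (rows w' k) ≤ ∑ i, ‖w i - w' i‖ * R := by
      intro w w' k hk
      rw [dist_eq_norm]
      refine (EuclideanSpace.norm_le_sum_abs _).trans (Finset.sum_le_sum fun i _ => ?_)
      change |inner ℝ (w i) k - inner ℝ (w' i) k| ≤ _
      rw [← inner_sub_left]
      exact (abs_real_inner_le_norm _ _).trans (by gcongr; exact hR k hk)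
    refine Metric.hausdorffDist_le_of_mem_dist (by positivity) ?_ ?_
    · rintro _ ⟨k, hk, rfl⟩
      exact ⟨_, ⟨k, hk, rfl⟩, h w w' k hk⟩
    · rintro _ ⟨k, hk, rfl⟩
      exact ⟨_, ⟨k, hk, rfl⟩, by rw [dist_comm]; exact h w w' k hk⟩
  refine continuous_iff_continuousAt.2 fun w => tendsto_iff_dist_tendsto_zero.2 ?_
  refine squeeze_zero (fun _ => dist_nonneg) (fun w' => key w' w) ?_
  have : Continuous fun w' : Fin m → V => ∑ i, ‖w' i - w i‖ * R := by fun_prop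
  simpa using this.tendsto w

theorem exists_vol_map_rows_le (K : ConvexBody V) (R : ℝ) :
    ∃ C, ∀ w : Fin m → V, (∀ i, ‖w i‖ ≤ R) → vol (map (rows w) K) ≤ C := by
  obtain ⟨C, hC⟩ := (isCompact_closedBall (0 : Fin m → V) |R|).exists_bound_of_continuousOn
    (continuous_volume.comp (continuous_map_rows K)).continuousOn
  refine ⟨C, fun w hw => (le_abs_self _).trans (hC w ?_)⟩
  rw [mem_closedBall_zero_iff, pi_norm_le_iff_of_nonneg (abs_nonneg R)]
  exact fun i => (hw i).trans (le_abs_self R)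

/-- The mean volume of the images of `K` under the maps with rows `φ (ω i)`. -/
noncomputable def meanVol (m : ℕ) (κ : Measure Ω) (φ : Ω → V) (K : ConvexBody V) : ℝ :=
  ∫ ω : Fin m → Ω, vol (map (rows fun i => φ (ω i)) K) ∂(Measure.pi fun _ => κ)

variable [MeasurableSpace V] [BorelSpace V]

theorem measurable_vol_map_rows {φ : Ω → V} (hφ : Measurable φ) (K : ConvexBody V) :
    Measurable fun ω : Fin m → Ω => vol (map (rows fun i => φ (ω i)) K) :=
  (continuous_volume.comp (continuous_map_rows K)).measurable.comp
    (measurable_pi_lambda _ fun i => hφ.comp (measurable_pi_apply i))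

variable [IsFiniteMeasure κ] {φ : Ω → V} {R : ℝ}

theorem integrable_vol_map_rows (hφ : Measurable φ) (hR : ∀ ω, ‖φ ω‖ ≤ R) (K : ConvexBody V) :
    Integrable (fun ω : Fin m → Ω => vol (map (rows fun i => φ (ω i)) K))
      (Measure.pi fun _ => κ) := by
  obtain ⟨C, hC⟩ := exists_vol_map_rows_le (m := m) K R
  refine Integrable.of_bound (measurable_vol_map_rows hφ K).aestronglyMeasurable C
    (Filter.Eventually.of_forall fun ω => ?_)
  rw [Real.norm_of_nonneg (vol_nonneg _)]
  exact hC _ fun i => hR _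

theorem continuous_meanVol (hφ : Measurable φ) (hR : ∀ ω, ‖φ ω‖ ≤ R) :
    Continuous (meanVol m κ φ) := by
  refine continuous_iff_continuousAt.2 fun K => ?_
  -- Every body within distance 1 of K lies in this enlarged body, which gives a dominating
  -- constant.
  obtain ⟨C, hC⟩ := exists_vol_map_rows_le (m := m) (K + ball 0 1 zero_le_one) R
  refine continuousAt_of_dominated (bound := fun _ => C)
    (Filter.Eventually.of_forall fun L => (measurable_vol_map_rows hφ L).aestronglyMeasurable)
    ?_ (integrable_const _) (Filter.Eventually.of_forall fun ω =>
      (continuous_volume.comp (continuous_map _)).continuousAt)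
  filter_upwards [Metric.closedBall_mem_nhds K one_pos] with L hL
  refine Filter.Eventually.of_forall fun ω => ?_
  rw [Real.norm_of_nonneg (vol_nonneg _)]
  refine le_trans (vol_mono ?_) (hC _ fun i => hR (ω i))
  refine Set.image_mono fun x hx => ?_
  obtain ⟨z, hz, hd⟩ := exists_dist_le_of_mem (L := K) (show x ∈ L from hx)
  refine mem_add.2 ⟨z, hz, x - z, mem_ball_zero.2 ?_, add_sub_cancel _ _⟩
  rw [← dist_eq_norm]
  exact hd.trans hL

theorem isValuation_meanVol (hφ : Measurable φ) (hR : ∀ ω, ‖φ ω‖ ≤ R) :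
    IsValuation (meanVol m κ φ) := by
  intro K L U I hU hI
  have h : ∀ K, Integrable (fun ω : Fin m → Ω => vol (map (rows fun i => φ (ω i)) K))
      (Measure.pi fun _ => κ) := integrable_vol_map_rows hφ hR
  rw [eq_sub_iff_add_eq]
  unfold meanVol
  rw [← integral_add (h K) (h L), ← integral_add (h U) (h I)]
  congr 1
  funext ω
  exact eq_sub_iff_add_eq.1 (isValuation_volume.comp_map (rows fun i => φ (ω i)) K L U I hU hI)

theorem isTranslationInvariant_meanVol : IsTranslationInvariant (meanVol m κ φ) := by
  intro K a
  unfold meanVol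
  simp only [map_add, map_pt, vol_add_pt]

theorem meanVol_smul {t : ℝ} (ht : 0 ≤ t) (K : ConvexBody V) :
    meanVol m κ φ (t • K) = t ^ m * meanVol m κ φ K := by
  unfold meanVol
  rw [← integral_const_mul]
  simp only [map_smul, vol_smul ht, finrank_euclideanSpace, Fintype.card_fin]

theorem meanVol_neg_one_smul (K : ConvexBody V) :
    meanVol m κ φ ((-1 : ℝ) • K) = meanVol m κ φ K := by
  unfold meanVol
  congr 1
  funext ω
  rw [map_smul, vol, coe_neg_one_smul, Measure.measure_neg]
  rfl

/-- The mean volume of a body in a translate of `F` factors through the volume of a zonoid. -/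
theorem meanVol_map_add_pt {F : Submodule ℝ V} (b : OrthonormalBasis (Fin m) ℝ F)
    (K : ConvexBody F) (a : V) :
    meanVol m κ φ (map F.subtype K + pt a) = vol K *
      ∫ ω : Fin m → Ω, |b.toBasis.det fun i => F.orthogonalProjectionOnto (φ (ω i))|
        ∂(Measure.pi fun _ => κ) := by
  rw [isTranslationInvariant_meanVol, mul_comm, ← integral_mul_const]
  unfold meanVol
  congr 1
  funext ω
  rw [← vol_map_rows]
  congr 1
  -- On F a row acts in the same way as its orthogonal projection to F.
  refine ConvexBody.ext ?_
  rw [coe_map, coe_map, coe_map, Set.image_image]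
  refine Set.image_congr fun x _ => ?_
  rw [rows_apply, rows_apply]
  congr 1
  funext i
  exact (Submodule.inner_orthogonalProjectionOnto_eq_of_mem_right x _).symm

end ConvexBody

/-! ### Holmes–Thompson valuations: existence and uniqueness -/

namespace ConvexBody

variable {n m : ℕ} {N : Seminorm ℝ (EuclideanSpace ℝ (Fin n))}
  {μ ν : ConvexBody (EuclideanSpace ℝ (Fin n)) → ℝ}

theorem _root_.IsHTValuation.sub_isEvenValuation (hμ : IsHTValuation N m μ)
    (hν : IsHTValuation N m ν) : IsEvenValuation m fun K => μ K - ν K where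
  valuation K L U I hU hI := by
    simp only
    rw [hμ.valuation K L U I hU hI, hν.valuation K L U I hU hI]; ring
  translation K a := by
    simp only
    rw [hμ.translation_invariant a K _ (coe_add_pt K a),
      hν.translation_invariant a K _ (coe_add_pt K a)]
  continuous := hμ.continuous.sub hν.continuous
  even K := by rw [hμ.even K _ (coe_neg_one_smul K), hν.even K _ (coe_neg_one_smul K)]
  two_smul K := by rw [hμ.homogeneous 2 two_pos, hν.homogeneous 2 two_pos, mul_sub]

theorem _root_.IsHTValuation.unique (hm : m ≤ n) (hμ : IsHTValuation N m μ)
    (hν : IsHTValuation N m ν) (K : ConvexBody (EuclideanSpace ℝ (Fin n))) : μ K = ν K := by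
  refine sub_eq_zero.1 ((hμ.sub_isEvenValuation hν).eq_zero hm (by simp) (fun L hL => ?_) K)
  obtain ⟨p, hp⟩ := L.nonempty
  have hp' := subset_affineSpan ℝ _ hp
  rw [hμ.eq_htVolume L hL p hp', hν.eq_htVolume L hL p hp', sub_self]

variable {Ω : Type*} [MeasurableSpace Ω] {κ : Measure Ω} [IsFiniteMeasure κ]
  {φ : Ω → EuclideanSpace ℝ (Fin n)} {R : ℝ}

/-- By homogeneity of the norm, y is in the polar ball exactly when ⟪x, y⟫ ≤ N x for all x in F, and
on F the norm is the cosine transform of the projected vectors. -/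
theorem polarUnitBall_eq_zonoid (hN0 : ∀ x, N x = 0 → x = 0)
    (hN : ∀ x, N x = ∫ ω, |inner ℝ x (φ ω)| ∂κ) (F : Submodule ℝ (EuclideanSpace ℝ (Fin n)))
    (hφ : Integrable (fun ω => F.orthogonalProjectionOnto (φ ω)) κ) :
    polarUnitBall N F = zonoid κ (fun ω => F.orthogonalProjectionOnto (φ ω)) hφ := by
  have hNF : ∀ x : F, ∫ ω, |inner ℝ x (F.orthogonalProjectionOnto (φ ω))| ∂κ = N x := fun x => by
    rw [hN]
    congr 1
    funext ω
    rw [Submodule.inner_orthogonalProjectionOnto_eq_of_mem_left]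
  rw [coe_zonoid]
  ext y
  simp only [hNF, polarUnitBall, Set.mem_ofPred_eq]
  constructor
  · intro h x
    by_cases hx : N x = 0
    · have hx0 : x = 0 := Subtype.ext (hN0 _ hx)
      rw [hx0, inner_zero_left]
      exact apply_nonneg N _
    · have hpos : 0 < N x := lt_of_le_of_ne (apply_nonneg N _) (Ne.symm hx)
      have := (real_inner_smul_left x y (N x)⁻¹).symm.trans_le (h ((N x)⁻¹ • x) (by
        rw [Submodule.coe_smul, map_smul_eq_mul, Real.norm_of_nonneg (by positivity),
          inv_mul_cancel₀ hx]))
      rwa [inv_mul_le_iff₀ hpos, mul_one] at this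
  · exact fun h x hx => (h x).trans hx

/-- Only the last field uses the norm: both the mean volume and the polar zonoid on F yield the same
mean absolute determinant, and the zonoid formula supplies the constant. -/
theorem isHTValuation_meanVol (hN0 : ∀ x, N x = 0 → x = 0)
    (hN : ∀ x, N x = ∫ ω, |inner ℝ x (φ ω)| ∂κ) (hφ : Measurable φ) (hR : ∀ ω, ‖φ ω‖ ≤ R) :
    IsHTValuation N m fun K => 2 ^ m / (m.factorial : ℝ) * meanVol m κ φ K where
  valuation K L U I hU hI := by
    simp only
    rw [isValuation_meanVol hφ hR K L U I hU hI]; ring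
  continuous := continuous_const.mul (continuous_meanVol hφ hR)
  even K L h := by
    have : L = (-1 : ℝ) • K := ConvexBody.ext (h.trans (coe_neg_one_smul K).symm)
    rw [this, meanVol_neg_one_smul]
  homogeneous t ht K := by rw [meanVol_smul ht.le]; ring
  translation_invariant v K L h := by
    have : L = K + pt v := ConvexBody.ext (h.trans (coe_add_pt K v).symm)
    rw [this, isTranslationInvariant_meanVol]
  eq_htVolume K hK p hp := by
    set F := (affineSpan ℝ (K : Set (EuclideanSpace ℝ (Fin n)))).direction with hF
    let b : OrthonormalBasis (Fin m) ℝ F := (stdOrthonormalBasis ℝ F).reindex (finCongr hK)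
    have hKF : ∀ x ∈ K, x - p ∈ F := fun x hx =>
      AffineSubspace.vsub_mem_direction (subset_affineSpan ℝ _ hx) hp
    have hpm : Measurable fun ω => F.orthogonalProjectionOnto (φ ω) :=
      F.orthogonalProjectionOnto.measurable.comp hφ
    have hpR : ∀ ω, ‖F.orthogonalProjectionOnto (φ ω)‖ ≤ R := fun ω =>
      (F.norm_orthogonalProjectionOnto_apply_le _).trans (hR ω)
    have hpi : Integrable (fun ω => F.orthogonalProjectionOnto (φ ω)) κ :=
      Integrable.of_bound hpm.aestronglyMeasurable R (Filter.Eventually.of_forall hpR)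
    have e := map_subtype_map_projection F hKF
    set L := map (F.orthogonalProjectionOnto : EuclideanSpace ℝ (Fin n) →ₗ[ℝ] F) (K + pt (-p))
    have hset : {v : F | p + (v : EuclideanSpace ℝ (Fin n)) ∈ K} = L := by
      ext v
      rw [Set.mem_ofPred_eq, ← e, mem_add_pt, add_sub_cancel_left, mem_map, SetLike.mem_coe]
      constructor
      · rintro ⟨w, hw, h⟩
        rwa [← Subtype.ext h]
      · exact fun h => ⟨v, h, rfl⟩
    rw [hset, htVolume, polarUnitBall_eq_zonoid hN0 hN F hpi, Measure.prod_prod,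
      ENNReal.toReal_mul, ← e, meanVol_map_add_pt b]
    have h1 := vol_zonoid b hpm hpi hpR
    have h2 : (m.factorial : ℝ) ≠ 0 := by positivity
    change _ = vol L * vol (zonoid κ _ hpi)
    rw [div_mul_eq_mul_div, div_eq_iff h2, mul_left_comm, ← h1]
    ring

theorem vol_eq_one_of_fin_zero (K : ConvexBody (EuclideanSpace ℝ (Fin 0))) : vol K = 1 := by
  have h := vol_sum_seg_univ (EuclideanSpace.basisFun (Fin 0) ℝ) 0
  rw [Finset.univ_eq_empty, Finset.sum_empty] at h
  have hK : K = 0 := SetLike.ext fun x => by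
    rw [mem_zero]
    obtain ⟨k, hk⟩ := K.nonempty
    exact ⟨fun _ => Subsingleton.elim _ _, fun _ => Subsingleton.elim k x ▸ hk⟩
  rw [hK, h, Module.Basis.det_apply, Matrix.det_isEmpty, abs_one]

/-- An empty product of measures has total mass 1 and a point in dimension zero has volume 1, so the
general formula also covers degree zero. -/
theorem meanVol_zero (K : ConvexBody (EuclideanSpace ℝ (Fin n))) : meanVol 0 κ φ K = 1 := by
  unfold meanVol
  simp only [vol_eq_one_of_fin_zero]
  rw [integral_const, Measure.real, Measure.pi_univ]
  simp

/-- The Schneider--Wieacker formula for an arbitrary parametrization of the generating measure. -/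
theorem isHTIntrinsicVolume_iff (hm : m ≤ n) (hN0 : ∀ x, N x = 0 → x = 0)
    (hN : ∀ x, N x = ∫ ω, |inner ℝ x (φ ω)| ∂κ) (hφ : Measurable φ) (hR : ∀ ω, ‖φ ω‖ ≤ R) :
    IsHTIntrinsicVolume N m μ ↔ ∀ K, μ K = 2 ^ m / (m.factorial : ℝ) * meanVol m κ φ K := by
  rcases Nat.eq_zero_or_pos m with rfl | hpos
  · simp [IsHTIntrinsicVolume, meanVol_zero]
  · have hex := isHTValuation_meanVol (m := m) hN0 hN hφ hR
    constructor
    · exact fun h => (h.2 hpos).unique hm hex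
    · intro h
      obtain rfl : μ = _ := funext h
      exact ⟨fun h0 => absurd h0 hpos.ne', fun _ => hex⟩

end ConvexBody

/-! ### The ℓ₁ norm -/

namespace ConvexBody

variable {n m : ℕ}

theorem l1Norm_apply (x : EuclideanSpace ℝ (Fin n)) : l1Norm n x = ∑ i, |x i| := rfl

theorem eq_zero_of_l1Norm_eq_zero (x : EuclideanSpace ℝ (Fin n)) (hx : l1Norm n x = 0) : x = 0 := by
  rw [l1Norm_apply, Finset.sum_eq_zero_iff_of_nonneg fun _ _ => abs_nonneg _] at hx
  ext i
  exact abs_eq_zero.1 (hx i (Finset.mem_univ i))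

theorem l1Norm_eq_integral (x : EuclideanSpace ℝ (Fin n)) :
    l1Norm n x = ∫ i, |inner ℝ x (EuclideanSpace.single i (1 : ℝ))| ∂Measure.count := by
  rw [integral_count, l1Norm_apply]
  refine Finset.sum_congr rfl fun i _ => ?_
  rw [EuclideanSpace.inner_single_right]
  simp

/-- Two equal rows force the image into a hyperplane where two coordinates agree. -/
theorem vol_map_rows_single_of_not_injective {f : Fin m → Fin n} (hf : ¬ Function.Injective f)
    (K : ConvexBody (EuclideanSpace ℝ (Fin n))) :
    vol (map (rows fun i => EuclideanSpace.single (f i) (1 : ℝ)) K) = 0 := by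
  obtain ⟨i, j, hij, hne⟩ := Function.not_injective_iff.1 hf
  let ℓ : EuclideanSpace ℝ (Fin m) →ₗ[ℝ] ℝ :=
    (EuclideanSpace.proj i - EuclideanSpace.proj j : EuclideanSpace ℝ (Fin m) →L[ℝ] ℝ)
  have hℓ : ∀ x, ℓ x = x i - x j := fun x => rfl
  have h1 : (map (rows fun i => EuclideanSpace.single (f i) (1 : ℝ)) K :
      Set (EuclideanSpace ℝ (Fin m))) ⊆ LinearMap.ker ℓ := by
    rintro _ ⟨k, -, rfl⟩
    rw [SetLike.mem_coe, LinearMap.mem_ker, hℓ, rows_apply]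
    simp only [hij, sub_self]
  have h2 : LinearMap.ker ℓ ≠ ⊤ := fun h => by
    have : EuclideanSpace.single i (1 : ℝ) ∈ LinearMap.ker ℓ := h ▸ Submodule.mem_top
    rw [LinearMap.mem_ker, hℓ] at this
    simp [hne.symm] at this
  rw [vol, measure_mono_null h1 (Measure.addHaar_submodule _ _ h2)]
  rfl

/-- The orthonormal basis of a coordinate subspace given by an enumeration of its index set. -/
noncomputable def coordBasis {f : Fin m → Fin n} (hf : Function.Injective f) :
    OrthonormalBasis (Fin m) ℝ (coordSubspace (Finset.univ.image f)) :=
  OrthonormalBasis.mk (v := fun i => ⟨EuclideanSpace.single (f i) (1 : ℝ), Submodule.subset_span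
      ⟨f i, Finset.mem_coe.2 (Finset.mem_image_of_mem f (Finset.mem_univ i)), rfl⟩⟩)
    (by
      have := (EuclideanSpace.orthonormal_single (𝕜 := ℝ) (ι := Fin n)).comp f hf
      exact (orthonormal_iff_ite.2 fun i j => orthonormal_iff_ite.1 this i j))
    (by
      refine le_of_eq_of_le Submodule.span_span_coe_preimage.symm (Submodule.span_mono ?_)
      rintro x ⟨j, hj, hx⟩
      obtain ⟨i, -, rfl⟩ := Finset.mem_image.1 (Finset.mem_coe.1 hj)
      exact ⟨i, Subtype.ext hx⟩)

theorem coe_coordBasis {f : Fin m → Fin n} (hf : Function.Injective f) (i : Fin m) :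
    (coordBasis hf i : EuclideanSpace ℝ (Fin n)) = EuclideanSpace.single (f i) 1 := by
  rw [coordBasis, OrthonormalBasis.coe_mk]

/-- Distinct coordinate rows give the coordinates of the orthogonal projection in an orthonormal
basis of the coordinate subspace, hence preserve its volume. -/
theorem vol_map_rows_single_of_injective {f : Fin m → Fin n} (hf : Function.Injective f)
    (K : ConvexBody (EuclideanSpace ℝ (Fin n))) :
    vol (map (rows fun i => EuclideanSpace.single (f i) (1 : ℝ)) K) =
      ((volume : Measure (coordSubspace (Finset.univ.image f)))
        ((coordSubspace (Finset.univ.image f)).orthogonalProjectionOnto ''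
          (K : Set (EuclideanSpace ℝ (Fin n))))).toReal := by
  set F := coordSubspace (Finset.univ.image f)
  let b : OrthonormalBasis (Fin m) ℝ F := coordBasis hf
  rw [vol, ← b.measurePreserving_repr.measure_preimage
    (map (rows fun i => EuclideanSpace.single (f i) (1 : ℝ)) K).measurableSet.nullMeasurableSet]
  congr 2
  have hb : ∀ x, b.repr (F.orthogonalProjectionOnto x) =
      rows (fun i => EuclideanSpace.single (f i) (1 : ℝ)) x := fun x => by
    ext i
    rw [b.repr_apply_apply, Submodule.inner_orthogonalProjectionOnto_eq_of_mem_left, rows_apply,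
      coe_coordBasis]
  ext x
  constructor
  · rintro ⟨k, hk, e⟩
    exact ⟨k, hk, b.repr.injective ((hb k).trans e)⟩
  · rintro ⟨k, hk, rfl⟩
    exact ⟨k, hk, (hb k).symm⟩

theorem meanVol_count (K : ConvexBody (EuclideanSpace ℝ (Fin n))) :
    meanVol m Measure.count (fun i : Fin n => EuclideanSpace.single i (1 : ℝ)) K =
      m.factorial * l1IntrinsicVolume m K := by
  have h1 : ∀ f : Fin m → Fin n,
      (Measure.pi fun _ : Fin m => (Measure.count : Measure (Fin n))).real {f} = 1 := fun f => by
    rw [Measure.real, Measure.pi_singleton]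
    simp
  rw [meanVol, integral_fintype (.of_finite)]
  simp only [h1, one_smul]
  have h2 := Finset.sum_piFinset_eq_factorial_mul (m := m) (Finset.univ : Finset (Fin n)) _
    (fun I => ((volume : Measure (coordSubspace I))
      ((coordSubspace I).orthogonalProjectionOnto '' (K : Set _))).toReal)
    (fun f hf => vol_map_rows_single_of_not_injective hf K)
    fun f hf => vol_map_rows_single_of_injective hf K
  rwa [Fintype.piFinset_univ] at h2

theorem isHTIntrinsicVolume_l1Norm_iff (hm : m ≤ n)
    (μ : ConvexBody (EuclideanSpace ℝ (Fin n)) → ℝ) :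
    IsHTIntrinsicVolume (l1Norm n) m μ ↔ ∀ K, μ K = 2 ^ m * l1IntrinsicVolume m K := by
  rw [isHTIntrinsicVolume_iff (κ := Measure.count) (R := 1) hm eq_zero_of_l1Norm_eq_zero
    l1Norm_eq_integral (measurable_of_finite _) fun i => by simp]
  have : (m.factorial : ℝ) ≠ 0 := by positivity
  simp only [meanVol_count, ← mul_assoc, div_mul_cancel₀ _ this]

theorem l1IntrinsicVolume_ball_pos (hm : m ≤ n) :
    0 < l1IntrinsicVolume m (ball (0 : EuclideanSpace ℝ (Fin n)) 1 zero_le_one) := by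
  refine Finset.sum_pos (fun I _ => ?_) (Finset.powersetCard_nonempty.2 (by simpa using hm))
  have h1 : Metric.closedBall (0 : coordSubspace I) 1 ⊆ (coordSubspace I).orthogonalProjectionOnto ''
      (ball (0 : EuclideanSpace ℝ (Fin n)) 1 zero_le_one : Set (EuclideanSpace ℝ (Fin n))) := by
    intro x hx
    refine ⟨x, mem_ball_zero.2 (mem_closedBall_zero_iff.1 hx), ?_⟩
    exact Submodule.orthogonalProjectionOnto_mem_subspace_eq_self x
  refine ENNReal.toReal_pos ?_ ?_
  · exact ((Metric.measure_closedBall_pos volume _ one_pos).trans_le (measure_mono h1)).ne'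
  · exact ((ball (0 : EuclideanSpace ℝ (Fin n)) 1 zero_le_one).isCompact.image
      (coordSubspace I).orthogonalProjectionOnto.continuous).measure_lt_top.ne

theorem rowIntegral_eq_meanVol (ρ : Measure (Metric.sphere (0 : EuclideanSpace ℝ (Fin n)) 1))
    (K : ConvexBody (EuclideanSpace ℝ (Fin n))) :
    rowIntegral m ρ K = meanVol m ρ (fun y => (y : EuclideanSpace ℝ (Fin n))) K := rfl

theorem schneiderWieackerFormula (hm : m ≤ n) :
    SchneiderWieackerFormula n m (2 ^ m / (m.factorial : ℝ)) := by
  intro N ρ hN0 hρ μ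
  have := hρ.finite
  simp only [rowIntegral_eq_meanVol]
  exact isHTIntrinsicVolume_iff (R := 1) hm hN0 hρ.norm_eq measurable_subtype_coe fun y =>
    (mem_sphere_zero_iff_norm.1 y.2).le

/-- The `ℓ₁` norm has a generating measure. -/
theorem exists_isGeneratingMeasure_l1Norm (n : ℕ) :
    ∃ ρ, IsGeneratingMeasure (l1Norm n) ρ := by
  let e : Fin n → Metric.sphere (0 : EuclideanSpace ℝ (Fin n)) 1 := fun i =>
    ⟨EuclideanSpace.single i 1, by simp⟩
  have he : Measurable e := measurable_of_finite _
  have hneg : Measurable fun y : Metric.sphere (0 : EuclideanSpace ℝ (Fin n)) 1 => -y :=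
    continuous_neg.measurable
  let ρ₁ : Measure (Metric.sphere (0 : EuclideanSpace ℝ (Fin n)) 1) := Measure.count.map e
  let ρ₂ : Measure (Metric.sphere (0 : EuclideanSpace ℝ (Fin n)) 1) := ρ₁.map fun y => -y
  have hfin1 : IsFiniteMeasure ρ₁ := Measure.isFiniteMeasure_map _ _
  have hfin2 : IsFiniteMeasure ρ₂ := Measure.isFiniteMeasure_map _ _
  have h21 : ρ₂.map (fun y => -y) = ρ₁ := by
    simp only [ρ₂]
    rw [Measure.map_map hneg hneg]
    have : ((fun y : Metric.sphere (0 : EuclideanSpace ℝ (Fin n)) 1 => -y) ∘ fun y => -y) = id :=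
      funext fun y => neg_neg y
    rw [this, Measure.map_id]
  -- Half a unit of mass at each vector ±e_i: averaging with the reflection makes the measure even
  -- and keeps the cosine transform.
  refine ⟨(1 / 2 : NNReal) • (ρ₁ + ρ₂), inferInstance, ?_, fun x => ?_⟩
  · rw [Measure.map_smul, Measure.map_add _ _ hneg, h21, add_comm]
  · have hc : Continuous fun y : Metric.sphere (0 : EuclideanSpace ℝ (Fin n)) 1 =>
        |inner ℝ x (y : EuclideanSpace ℝ (Fin n))| := by fun_prop
    have hint : ∀ (ρ : Measure (Metric.sphere (0 : EuclideanSpace ℝ (Fin n)) 1))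
        [IsFiniteMeasure ρ], Integrable (fun y : Metric.sphere (0 : EuclideanSpace ℝ (Fin n)) 1 =>
          |inner ℝ x (y : EuclideanSpace ℝ (Fin n))|) ρ := fun ρ _ =>
      Integrable.of_bound hc.aestronglyMeasurable ‖x‖ (Filter.Eventually.of_forall fun y => by
        rw [Real.norm_eq_abs, abs_abs]
        refine (abs_real_inner_le_norm _ _).trans_eq ?_
        rw [mem_sphere_zero_iff_norm.1 y.2, mul_one])
    have e1 : ∫ y, |inner ℝ x (y : EuclideanSpace ℝ (Fin n))| ∂ρ₁ = l1Norm n x := by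
      rw [integral_map he.aemeasurable hc.aestronglyMeasurable, l1Norm_eq_integral]
    have e2 : ∫ y, |inner ℝ x (y : EuclideanSpace ℝ (Fin n))| ∂ρ₂ = l1Norm n x := by
      rw [integral_map hneg.aemeasurable hc.aestronglyMeasurable, ← e1]
      simp
    rw [integral_smul_nnreal_measure, integral_add_measure (hint ρ₁) (hint ρ₂), e1, e2,
      NNReal.smul_def]
    simp
    ring

end ConvexBody

/-! ### The corollary -/

theorem corollary2p4 (n m : ℕ) (hm : m ≤ n) :
    (∀ μ : ConvexBody (EuclideanSpace ℝ (Fin n)) → ℝ,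
      IsHTIntrinsicVolume (l1Norm n) m μ ↔ ∀ K, μ K = 2 ^ m * l1IntrinsicVolume m K) ∧
    (∀ c : ℝ, SchneiderWieackerFormula n m c ↔ c = 2 ^ m / (m.factorial : ℝ)) := by
  refine ⟨ConvexBody.isHTIntrinsicVolume_l1Norm_iff hm, fun c => ⟨fun h => ?_, ?_⟩⟩
  · obtain ⟨ρ, hρ⟩ := ConvexBody.exists_isGeneratingMeasure_l1Norm n
    have hμ := (ConvexBody.isHTIntrinsicVolume_l1Norm_iff hm
      fun K => 2 ^ m * l1IntrinsicVolume m K).2 fun K => rfl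
    let B := ConvexBody.ball (0 : EuclideanSpace ℝ (Fin n)) 1 zero_le_one
    have h1 := (h _ ρ ConvexBody.eq_zero_of_l1Norm_eq_zero hρ _).1 hμ B
    have h2 := (ConvexBody.schneiderWieackerFormula hm _ ρ ConvexBody.eq_zero_of_l1Norm_eq_zero hρ
      _).1 hμ B
    have h3 : 0 < 2 ^ m * l1IntrinsicVolume m B :=
      mul_pos (by positivity) (ConvexBody.l1IntrinsicVolume_ball_pos hm)
    -- Both constants give the value of the same ℓ₁ intrinsic volume on the unit ball; its
    -- positivity forces the row integral to be nonzero.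
    refine mul_right_cancel₀ (b := rowIntegral m ρ B) (fun h0 => ?_) (h1.symm.trans h2)
    rw [h0, mul_zero] at h2
    exact h3.ne' h2
  · rintro rfl
    exact ConvexBody.schneiderWieackerFormula hm
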